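/- Let $M$ be a connected (Hausdorff) complex manifold that carries a nonconstant meromorphic function. Then there is an analytic hypersurface $S\subset M$ (a closed subset, possibly empty, which near every point of $M$ is the zero set of a single holomorphic function whose germ at that point is not zero) such that $M\setminus S$ has a universal covering and every universal covering of $M\setminus S$ (a simply connected complex manifold with a locally biholomorphic surjective covering map to $M\setminus S$; it is unique up to isomorphism) carries a nonconstant bounded holomorphic function. Moreover, for the same $S$, the manifold $M\setminus S$ is not universally dominated. Here complex spaces are reduced, and a complex space $Y$ is called universally dominated if for every irreducible Hausdorff complex space $X$ with countable topology and a nonconstant holomorphic function there is a holomorphic map $X\to Y$ with dense image. -/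

import Mathlib

open Set Filter Topology
open scoped Manifold ContDiff

universe u v

/-- The standard complex coordinate space of dimension `n`. -/
abbrev CSpace (n : ℕ) : Type := EuclideanSpace ℂ (Fin n)

/-! ### Reduced complex spaces

A reduced complex space is given as a topological space with a sheaf of continuous complex-valued
functions that is locally isomorphic to an analytic set in some `ℂⁿ` with the functions that
locally are restrictions of holomorphic functions of the ambient space. The sheaf is recorded by
the predicate `hol x f`: the germ of `f` at `x` is a section. -/

/-- `A` is an analytic subset of some open subset of `ℂⁿ`: near each of its points it is the common
zero set of finitely many holomorphic functions. -/
def IsLocallyAnalytic {n : ℕ} (A : Set (CSpace n)) : Prop :=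
  ∀ z ∈ A, ∃ (k : ℕ) (F : Fin k → CSpace n → ℂ),
    (∀ i, AnalyticAt ℂ (F i) z) ∧ ∀ᶠ w in 𝓝 z, (w ∈ A ↔ ∀ i, F i w = 0)

/-- `φ` identifies the open set `U` and its holomorphic germs with an analytic set in `ℂⁿ`. -/
structure IsAnalyticChart {X : Type u} [TopologicalSpace X] (hol : X → (X → ℂ) → Prop)
    {n : ℕ} (U : Set X) (φ : X → CSpace n) : Prop where
  isOpen : IsOpen U
  isEmbedding : IsEmbedding (U.domRestrict φ)
  isLocallyAnalytic : IsLocallyAnalytic (φ '' U)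
  hol_iff : ∀ y ∈ U, ∀ f : X → ℂ,
    hol y f ↔ ∃ G : CSpace n → ℂ, AnalyticAt ℂ G (φ y) ∧ f =ᶠ[𝓝 y] G ∘ φ

/-- The structure of a reduced complex space on a topological space. -/
structure ReducedComplexSpace (X : Type u) [TopologicalSpace X] where
  /-- `hol x f`: the function `f` is holomorphic near `x`. -/
  hol : X → (X → ℂ) → Prop
  exists_chart : ∀ x : X, ∃ (n : ℕ) (U : Set X) (φ : X → CSpace n),
    x ∈ U ∧ IsAnalyticChart hol U φ

namespace ReducedComplexSpace

variable {X : Type u} [TopologicalSpace X] {Y : Type v} [TopologicalSpace Y]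

/-- Holomorphic functions on a complex space. -/
def IsHolomorphic (𝒪 : ReducedComplexSpace X) (f : X → ℂ) : Prop :=
  ∀ x, 𝒪.hol x f

/-- Analytic subsets: around every point of the space, common zeros of finitely many holomorphic
functions. (Such a set is closed.) -/
def IsAnalyticSubset (𝒪 : ReducedComplexSpace X) (A : Set X) : Prop :=
  ∀ x : X, ∃ (k : ℕ) (F : Fin k → X → ℂ),
    (∀ i, 𝒪.hol x (F i)) ∧ ∀ᶠ y in 𝓝 x, (y ∈ A ↔ ∀ i, F i y = 0)

/-- A complex space is irreducible if it is nonempty and not the union of two proper analytic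
subsets. -/
def IsIrreducible (𝒪 : ReducedComplexSpace X) : Prop :=
  Nonempty X ∧ ∀ A B : Set X, 𝒪.IsAnalyticSubset A → 𝒪.IsAnalyticSubset B →
    A ∪ B = univ → A = univ ∨ B = univ

/-- Holomorphic maps: continuous maps that pull holomorphic germs back to holomorphic germs. -/
def IsHolomorphicMap (𝒪X : ReducedComplexSpace X) (𝒪Y : ReducedComplexSpace Y)
    (F : X → Y) : Prop :=
  Continuous F ∧ ∀ x : X, ∀ g : Y → ℂ, 𝒪Y.hol (F x) g → 𝒪X.hol x (g ∘ F)

/-- `Y` is dominated by `X`: there is a holomorphic map `X → Y` with dense image. -/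
def IsDominatedBy (𝒪Y : ReducedComplexSpace Y) (𝒪X : ReducedComplexSpace X) : Prop :=
  ∃ F : X → Y, IsHolomorphicMap 𝒪X 𝒪Y F ∧ DenseRange F

/-- `Y` is universally dominated: it is dominated by every irreducible complex space that has a
nonconstant holomorphic function. The complex spaces that are tested are Hausdorff with countable
topology; each of them has at most the cardinality of the continuum, so `Type` has them all. -/
def IsUniversallyDominated (𝒪Y : ReducedComplexSpace Y) : Prop :=
  ∀ (X : Type) [TopologicalSpace X] [T2Space X] [SecondCountableTopology X]
    (𝒪X : ReducedComplexSpace X), 𝒪X.IsIrreducible →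
    (∃ f : X → ℂ, 𝒪X.IsHolomorphic f ∧ ∃ x y, f x ≠ f y) → 𝒪Y.IsDominatedBy 𝒪X

end ReducedComplexSpace

/-! ### Complex manifolds of dimension `n`

They are manifolds of class `C^ω` over `ℂ` modelled on `ℂⁿ`, and holomorphic means `C^ω`
over `ℂ`. -/

section ComplexManifold

variable (n : ℕ) {M : Type u} [TopologicalSpace M] [ChartedSpace (CSpace n) M]

/-- `f` is holomorphic near the point `p` of the complex manifold `M`. -/
def HolomorphicAt (f : M → ℂ) (p : M) : Prop :=
  ContMDiffAt 𝓘(ℂ, CSpace n) 𝓘(ℂ, ℂ) ω f p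

/-- `M` carries a nonconstant bounded holomorphic function. -/
def HasNonconstantBoundedHolomorphic (M : Type u) [TopologicalSpace M]
    [ChartedSpace (CSpace n) M] : Prop :=
  ∃ f : M → ℂ, (∀ p, HolomorphicAt n f p) ∧ Bornology.IsBounded (range f) ∧ ∃ x y, f x ≠ f y

/-- An analytic hypersurface: a closed subset that, around every point of the manifold, is the
zero set of one holomorphic function with nonzero germ there. -/
structure IsAnalyticHypersurface (S : Set M) : Prop where
  isClosed : IsClosed S
  local_equation : ∀ p : M, ∃ h : M → ℂ, HolomorphicAt n h p ∧
    (¬ ∀ᶠ q in 𝓝 p, h q = 0) ∧ ∀ᶠ q in 𝓝 p, (q ∈ S ↔ h q = 0)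

/-- The complement of an analytic hypersurface, as an open submanifold. -/
def IsAnalyticHypersurface.complement {n : ℕ} {M : Type u} [TopologicalSpace M] [ChartedSpace (CSpace n) M]
    {S : Set M} (hS : IsAnalyticHypersurface n S) :
    TopologicalSpace.Opens M :=
  ⟨Sᶜ, hS.isClosed.isOpen_compl⟩

variable (M) in
/-- A meromorphic function, presented by local quotients: each point `p` has an open neighbourhood
`dom p` where the function is `num p / den p`, with `num p` and `den p` holomorphic on `dom p` and
`den p` not identically zero near any point of `dom p`; the quotients agree on overlaps. -/
structure MeromorphicFunction where
  dom : M → Set M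
  isOpen_dom : ∀ p, IsOpen (dom p)
  mem_dom : ∀ p, p ∈ dom p
  num : M → M → ℂ
  den : M → M → ℂ
  num_holomorphic : ∀ p, ∀ q ∈ dom p, HolomorphicAt n (num p) q
  den_holomorphic : ∀ p, ∀ q ∈ dom p, HolomorphicAt n (den p) q
  den_ne_zero : ∀ p, ∀ q ∈ dom p, ¬ ∀ᶠ y in 𝓝 q, den p y = 0
  compatible : ∀ p p', ∀ q ∈ dom p ∩ dom p', num p q * den p' q = num p' q * den p q

/-- The meromorphic function is equal to a constant `c`. (This does not depend on the choice of
the local quotients.) -/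
def MeromorphicFunction.IsConstant {n : ℕ} {M : Type u} [TopologicalSpace M] [ChartedSpace (CSpace n) M]
    (f : MeromorphicFunction n M) : Prop :=
  ∃ c : ℂ, ∀ p, ∀ q ∈ f.dom p, f.num p q = c * f.den p q

variable (M) in
/-- A universal covering of the complex manifold `M`: a simply connected complex manifold with a
surjective covering map to `M` that is locally biholomorphic. -/
structure UniversalCovering where
  total : Type u
  [topology : TopologicalSpace total]
  [charted : ChartedSpace (CSpace n) total]
  [manifold : IsManifold 𝓘(ℂ, CSpace n) ω total]
  [simplyConnected : SimplyConnectedSpace total]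
  proj : total → M
  isCoveringMap : IsCoveringMap proj
  surjective : Function.Surjective proj
  isLocalBiholomorphism : IsLocalDiffeomorph 𝓘(ℂ, CSpace n) 𝓘(ℂ, CSpace n) ω proj

attribute [instance] UniversalCovering.topology UniversalCovering.charted
  UniversalCovering.manifold UniversalCovering.simplyConnected

variable (M) in
/-- A complex manifold as a reduced complex space. -/
def manifoldComplexSpace [IsManifold 𝓘(ℂ, CSpace n) ω M] : ReducedComplexSpace M where
  hol p f := HolomorphicAt n f p
  exists_chart x := by
    refine ⟨n, (chartAt (CSpace n) x).source, chartAt (CSpace n) x,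
      mem_chart_source _ x, (chartAt (CSpace n) x).open_source, ?_, ?_, ?_⟩
    · exact (chartAt (CSpace n) x).isOpenEmbedding_restrict.isEmbedding
    · intro z hz
      rw [(chartAt (CSpace n) x).image_source_eq_target] at hz ⊢
      refine ⟨0, fun _ _ => 0, fun i => i.elim0, ?_⟩
      filter_upwards [(chartAt (CSpace n) x).open_target.mem_nhds hz] with w hw
      exact ⟨fun _ i => i.elim0, fun _ => hw⟩
    · intro y hy f
      have key : HolomorphicAt n f y ↔
          AnalyticAt ℂ (f ∘ (chartAt (CSpace n) x).symm) (chartAt (CSpace n) x y) := by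
        unfold HolomorphicAt
        rw [contMDiffAt_iff_source_of_mem_source hy]
        simp only [mfld_simps]
        rw [contMDiffWithinAt_univ, contMDiffAt_iff_contDiffAt, ← contDiffWithinAt_univ,
          contDiffWithinAt_omega_iff_analyticWithinAt, analyticWithinAt_univ]
      rw [key]
      constructor
      · intro h
        refine ⟨_, h, ?_⟩
        filter_upwards [(chartAt (CSpace n) x).open_source.mem_nhds hy] with w hw
        simp [(chartAt (CSpace n) x).left_inv hw]
      · rintro ⟨G, hG, hfG⟩
        refine hG.congr ?_
        have hc := (chartAt (CSpace n) x).continuousAt_symm ((chartAt (CSpace n) x).map_source hy)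
        have ht : Tendsto (chartAt (CSpace n) x).symm (𝓝 (chartAt (CSpace n) x y)) (𝓝 y) := by
          have := hc.tendsto
          rwa [(chartAt (CSpace n) x).left_inv hy] at this
        filter_upwards [ht.eventually hfG, (chartAt (CSpace n) x).open_target.mem_nhds
          ((chartAt (CSpace n) x).map_source hy)] with w hw hwt
        simp only [Function.comp_apply] at hw ⊢
        rw [hw, (chartAt (CSpace n) x).right_inv hwt]

end ComplexManifold

/-! Let `f` be the nonconstant meromorphic function and let `S` be the set where `f` is not a
holomorphic germ or has the value 0 or 1. On `M \ S` the function `f` is holomorphic, nonconstant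
and omits 0 and 1. The universal covering of `ℂ \ {0, 1}` is the upper half-plane, so from every
simply connected manifold over `M \ S` the function lifts to the half-plane, and a Cayley transform
makes the lift bounded (`exists_disc_lift`). The same lift and Liouville's theorem give Picard's
little theorem (`eq_of_omit_zero_one`): a holomorphic map from `ℂ` to `M \ S`, composed with `f`, is
constant. Its image cannot be dense, since `f` is nonconstant, so `ℂ` does not dominate `M \ S`.

That `S` is a hypersurface rests on `AnalyticAt.exists_reduced_fraction`: near each point `f = a /
b`, where `b` does not vanish at points where `f` is holomorphic, and then `S` is the zero set of `a
* b * (a - b)`. This replaces unique factorization of germs. On discs in a fixed direction, the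
quotient has a monic polynomial denominator of least degree, determined by the moments of the
quotient on the boundary circle. By Cramer's rule its coefficients are quotients of Hankel
determinants, which are analytic in the centre of the disc; they are bounded, so they extend by
Riemann's theorem (`AnalyticAt.exists_eq_mul_of_norm_le`).

The lift uses the inverse of the modular function: `periodRatio`, the ratio of two complete elliptic
integrals, maps a doubly slit plane to the upper half-plane. A three-term relation between the
integrals, proved by shifting a contour, shows that three branches of it, which together cover `ℂ \
{0, 1}`, differ by locally constant elements of `SL₂(ℤ)`. Pulled back to a simply connected space
they form a bundle with discrete fibre; a section of it glues the branches.

The universal covering of `M \ S` exists because `S` does not separate `M`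
(`IsAnalyticHypersurface.isConnected_compl`); it is built as a bundle of homotopy classes of paths
(`exists_universal_cover`). -/

/-! ### Integrals of analytic functions depending on a parameter in a normed space. -/

section ParametricIntegral

open MeasureTheory NNReal ENNReal

variable {E : Type*} [NormedAddCommGroup E] [NormedSpace ℂ E]

/-- The series of `f` is re-expanded at `x₀ + δ t` and integrated term by term. The bound `2 ρ < r`
leaves room for both the shift `δ t` and the variable `y`, and makes the re-expanded coefficients
summable uniformly in `t`. -/
theorem HasFPowerSeriesOnBall.analyticAt_setIntegral {f : E → ℂ}
    {q : FormalMultilinearSeries ℂ E ℂ} {x₀ : E} {r : ℝ≥0∞} (hf : HasFPowerSeriesOnBall f q x₀ r)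
    {ρ : ℝ≥0} (hρ0 : 0 < ρ) (hρ : (ρ + ρ : ℝ≥0∞) < r) {A : Set ℝ} (hA : MeasurableSet A)
    (hfin : volume A < ⊤) {δ : ℝ → E} (hδ : Continuous δ) (hδA : ∀ t ∈ A, ‖δ t‖ ≤ ρ)
    {φ : ℝ → ℂ} (hφ : Continuous φ) {C : ℝ} (hφA : ∀ t ∈ A, ‖φ t‖ ≤ C) :
    AnalyticAt ℂ (fun y => ∫ t in A, φ t * f (x₀ + y + δ t)) 0 := by
  have : IsFiniteMeasure (volume.restrict A) := ⟨by simpa using hfin⟩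
  have hrad : (ρ + ρ : ℝ≥0∞) < q.radius := hρ.trans_le hf.r_le
  have hrad1 : (ρ : ℝ≥0∞) < q.radius := lt_of_le_of_lt (by simp) hrad
  have hsum := q.changeOriginSeries_summable_aux₁ hrad
  set B : ℕ → ℝ≥0 := fun k =>
    ∑' s : Σ l : ℕ, { s : Finset (Fin (k + l)) // s.card = l }, ‖q (k + s.1)‖₊ * ρ ^ s.1 with hB
  have hBsum : Summable fun k => B k * ρ ^ k := by
    have := (NNReal.summable_sigma.1 hsum).2
    refine this.congr fun k => ?_
    rw [hB, ← NNReal.tsum_mul_right]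
  have hnorm : ∀ k, ∀ t ∈ A, ‖q.changeOrigin (δ t) k‖ ≤ B k := by
    intro k t ht
    have h1 : ‖δ t‖₊ ≤ ρ := hδA t ht
    have h2 := q.nnnorm_changeOrigin_le k (x := δ t)
      (lt_of_le_of_lt (by exact_mod_cast h1) hrad1)
    refine NNReal.coe_le_coe.2 (h2.trans ?_)
    have hs2 := q.changeOriginSeries_summable_aux₂ hrad1 k
    exact (NNReal.summable_of_le (fun s => by gcongr) hs2).tsum_le_tsum
      (fun s => by gcongr) hs2
  have hcont : ∀ k, ContinuousOn (fun t => φ t • q.changeOrigin (δ t) k) A := by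
    intro k
    refine hφ.continuousOn.smul ?_
    have h0 : 0 < q.radius := hf.r_pos.trans_le hf.r_le
    refine (q.hasFPowerSeriesOnBall_changeOrigin k h0).continuousOn.comp hδ.continuousOn ?_
    intro t ht
    have h1 : ‖δ t‖₊ ≤ ρ := hδA t ht
    rw [mem_eball_zero_iff]
    exact lt_of_le_of_lt (by exact_mod_cast h1) hrad1
  have hC : ∀ k, ∀ t ∈ A, ‖φ t • q.changeOrigin (δ t) k‖ ≤ |C| * B k := by
    intro k t ht
    rw [norm_smul]
    exact mul_le_mul ((hφA t ht).trans (le_abs_self C)) (hnorm k t ht) (norm_nonneg _) (abs_nonneg _)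
  have hint : ∀ k, Integrable (fun t => φ t • q.changeOrigin (δ t) k) (volume.restrict A) := by
    intro k
    exact Integrable.of_bound ((hcont k).aestronglyMeasurable hA) _
      ((ae_restrict_iff' hA).2 (ae_of_all _ (hC k)))
  let P : FormalMultilinearSeries ℂ E ℂ := fun k => ∫ t in A, φ t • q.changeOrigin (δ t) k
  refine ⟨P, ρ, ?_, by exact_mod_cast hρ0, ?_⟩
  · apply P.le_radius_of_summable
    refine Summable.of_nonneg_of_le (fun k => by positivity) (fun k => ?_)
      ((NNReal.summable_coe.2 hBsum).mul_left (|C| * volume.real A))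
    have : ‖P k‖ ≤ |C| * B k * volume.real A :=
      norm_setIntegral_le_of_norm_le_const hfin (hC k)
    calc ‖P k‖ * (ρ : ℝ) ^ k ≤ |C| * B k * volume.real A * (ρ : ℝ) ^ k := by gcongr
      _ = _ := by push_cast; ring
  · intro y hy
    have hy' : ‖y‖₊ < ρ := by
      rw [mem_eball_zero_iff] at hy; exact_mod_cast hy
    have hP : ∀ k, P k (fun _ => y) = ∫ t in A, φ t * q.changeOrigin (δ t) k (fun _ => y) := by
      intro k
      simp only [P]
      rw [ContinuousMultilinearMap.integral_apply (hint k)]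
      rfl
    have hs : ∀ t ∈ A, HasSum (fun k => φ t * q.changeOrigin (δ t) k (fun _ => y))
        (φ t * f (x₀ + (0 + y) + δ t)) := by
      intro t ht
      have h1 : ‖δ t‖₊ ≤ ρ := hδA t ht
      have h3 := hf.changeOrigin (y := δ t) (lt_of_le_of_lt (by
        have : (‖δ t‖₊ : ℝ≥0∞) ≤ ρ := by exact_mod_cast h1
        exact this.trans (le_add_right le_rfl)) hρ)
      have h4 := h3.hasSum (y := y) (by
        rw [mem_eball_zero_iff, lt_tsub_iff_right]
        refine lt_of_le_of_lt ?_ hρ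
        gcongr
        · exact_mod_cast hy'.le
        )
      have h5 : x₀ + (0 + y) + δ t = x₀ + δ t + y := by abel
      rw [h5]
      exact h4.mul_left _
    have hbd : ∀ k, ∀ t ∈ A, ‖φ t * q.changeOrigin (δ t) k (fun _ => y)‖ ≤
        |C| * (B k * (ρ : ℝ) ^ k) := by
      intro k t ht
      rw [norm_mul]
      refine mul_le_mul ((hφA t ht).trans (le_abs_self C)) ?_ (norm_nonneg _) (abs_nonneg _)
      have := (q.changeOrigin (δ t) k).le_opNorm (fun _ => y)
      rw [Finset.prod_const, Finset.card_univ, Fintype.card_fin] at this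
      refine this.trans ?_
      have hy2 : ‖y‖ ≤ ρ := hy'.le
      exact mul_le_mul (hnorm k t ht) (by gcongr) (by positivity) (by positivity)
    have hint2 : ∀ k, Integrable (fun t => φ t * q.changeOrigin (δ t) k (fun _ => y))
        (volume.restrict A) := by
      intro k
      refine Integrable.of_bound ?_ _
        ((ae_restrict_iff' hA).2 (ae_of_all _ (hbd k)))
      refine ContinuousOn.aestronglyMeasurable ?_ hA
      exact ((ContinuousMultilinearMap.apply ℂ (fun _ : Fin k => E) ℂ
        (fun _ => y)).continuous.comp_continuousOn (hcont k))
    have key := hasSum_integral_of_summable_integral_norm (μ := volume.restrict A) hint2 (by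
      refine Summable.of_nonneg_of_le (fun k => by positivity) (fun k => ?_)
        ((NNReal.summable_coe.2 hBsum).mul_left (|C| * volume.real A))
      have := norm_setIntegral_le_of_norm_le_const (f := fun t =>
        ‖φ t * q.changeOrigin (δ t) k (fun _ => y)‖) hfin (C := |C| * (B k * (ρ : ℝ) ^ k))
        (fun t ht => by rw [norm_norm]; exact hbd k t ht)
      calc _ ≤ _ := Real.le_norm_self _
        _ ≤ _ := this
        _ = _ := by push_cast; ring)
    simp_rw [hP]
    convert! key using 1
    exact setIntegral_congr_fun hA fun t ht => (hs t ht).tsum_eq.symm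

/-- Integrals of translates of an analytic function along a compact curve are analytic. -/
theorem analyticAt_intervalIntegral_translate {f : E → ℂ} {z₀ : E} {a b : ℝ} (hab : a ≤ b)
    {γ : ℝ → E} (hγ : Continuous γ) {φ : ℝ → ℂ} (hφ : Continuous φ)
    (hf : ∀ t ∈ Icc a b, AnalyticAt ℂ f (z₀ + γ t)) :
    AnalyticAt ℂ (fun z => ∫ t in a..b, φ t * f (z + γ t)) z₀ := by
  obtain ⟨C, hC⟩ := (isCompact_Icc (a := a) (b := b)).exists_bound_of_continuousOn hφ.continuousOn
  have hint : ∀ {A : Set ℝ}, MeasurableSet A → A ⊆ Icc a b → ∀ᶠ z in 𝓝 z₀,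
      IntegrableOn (fun t => φ t * f (z + γ t)) A := by
    intro A hA hAs
    have h1 : ∀ᶠ z in 𝓝 z₀, ∀ t ∈ Icc a b, AnalyticAt ℂ f (z + γ t) := by
      refine isCompact_Icc.eventually_forall_of_forall_eventually fun t ht => ?_
      have hc : Continuous fun p : E × ℝ => p.1 + γ p.2 := by fun_prop
      exact (hc.tendsto (z₀, t)).eventually (hf t ht).eventually_analyticAt
    filter_upwards [h1] with z hz
    refine IntegrableOn.mono_set ?_ hAs
    refine ContinuousOn.integrableOn_Icc (hφ.continuousOn.mul fun t ht => ?_)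
    exact ((hz t ht).continuousAt.comp (f := fun t => z + γ t)
      (by fun_prop : ContinuousAt _ t)).continuousWithinAt
  -- Asking for analyticity over every measurable part of `s'` makes the property stable under
  -- unions: `A` splits into `A ∩ s'` and `A \ s'`. Compactness then reduces to short pieces of the
  -- curve.
  let p : Set ℝ → Prop := fun s => ∃ s', MeasurableSet s' ∧ s ⊆ s' ∧
    ∀ A, MeasurableSet A → A ⊆ s' → A ⊆ Icc a b →
      AnalyticAt ℂ (fun z => ∫ t in A, φ t * f (z + γ t)) z₀
  have hp : p (Icc a b) := by
    refine isCompact_Icc.induction_on (p := p) ?_ ?_ ?_ ?_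
    · refine ⟨∅, MeasurableSet.empty, subset_rfl, fun A _ hA' _ => ?_⟩
      obtain rfl := subset_empty_iff.1 hA'
      simpa using analyticAt_const
    · rintro s t hst ⟨s', h1, h2, h3⟩
      exact ⟨s', h1, hst.trans h2, h3⟩
    · rintro s t ⟨s', h1, h2, h3⟩ ⟨t', h1', h2', h3'⟩
      refine ⟨s' ∪ t', h1.union h1', union_subset_union h2 h2', fun A hA hA' hAs => ?_⟩
      refine ((h3 (A ∩ s') (hA.inter h1) inter_subset_right (inter_subset_left.trans hAs)).add
        (h3' (A \ s') (hA.diff h1) ?_ (sdiff_subset.trans hAs))).congr ?_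
      · rintro x ⟨hx, hx'⟩
        exact (hA' hx).resolve_left hx'
      · filter_upwards [hint hA hAs] with z hz
        exact integral_inter_add_sdiff h1 hz
    · intro t₀ ht₀
      obtain ⟨q, r, hq⟩ := hf t₀ ht₀
      obtain ⟨ρ, hρ0, hρ⟩ : ∃ ρ : ℝ≥0, 0 < ρ ∧ (ρ + ρ : ℝ≥0∞) < r := by
        obtain ⟨ρ, h0, h1⟩ := ENNReal.lt_iff_exists_nnreal_btwn.1 hq.r_pos
        refine ⟨ρ / 2, half_pos (by exact_mod_cast h0), ?_⟩
        rw [← ENNReal.coe_add, add_halves]; exact h1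
      set s' := {t : ℝ | ‖γ t - γ t₀‖ ≤ ρ} with hs'
      have hms : MeasurableSet s' :=
        (isClosed_le (by fun_prop) continuous_const).measurableSet
      refine ⟨s', mem_nhdsWithin_of_mem_nhds ?_, s', hms, subset_rfl, fun A hA hA' hAs => ?_⟩
      · have hc : ContinuousAt (fun t => ‖γ t - γ t₀‖) t₀ := by fun_prop
        exact (hc.eventually_lt (continuousAt_const (y := (ρ : ℝ)))
          (by simpa using hρ0)).mono fun t ht => le_of_lt ht
      have key := hq.analyticAt_setIntegral hρ0 hρ hA
        (lt_of_le_of_lt (measure_mono hAs) measure_Icc_lt_top)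
        (δ := fun t => γ t - γ t₀) (by fun_prop) (fun t ht => hA' ht) hφ (C := C)
        (fun t ht => hC t (hAs ht))
      have h2 : AnalyticAt ℂ (fun z : E => z - z₀) z₀ := analyticAt_id.sub analyticAt_const
      have h3 := key.comp_of_eq h2 (by simp)
      refine h3.congr (Eventually.of_forall fun z => ?_)
      simp only [Function.comp_apply]
      congr 1
      ext t
      congr 2
      abel
  obtain ⟨s', -, hs, h⟩ := hp
  have := h (Ioc a b) measurableSet_Ioc (Ioc_subset_Icc_self.trans hs) Ioc_subset_Icc_self
  simpa only [intervalIntegral.integral_of_le hab] using this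

theorem analyticAt_circleIntegral_translate {f : E → ℂ} {z₀ v : E} {r : ℝ}
    {φ : ℂ → ℂ} (hr : 0 ≤ r) (hφ : ContinuousOn φ (Metric.sphere 0 r))
    (hf : ∀ w : ℂ, ‖w‖ = r → AnalyticAt ℂ f (z₀ + w • v)) :
    AnalyticAt ℂ (fun z => ∮ w in C(0, r), φ w * f (z + w • v)) z₀ := by
  have h : ∀ t, ‖circleMap 0 r t‖ = r := by intro t; simp [abs_of_nonneg hr]
  have hc : Continuous fun t => φ (circleMap 0 r t) :=
    hφ.comp_continuous (continuous_circleMap 0 r) fun t => by simp [abs_of_nonneg hr]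
  have := analyticAt_intervalIntegral_translate (f := f) (z₀ := z₀) (a := 0) (b := 2 * Real.pi)
    Real.two_pi_pos.le (γ := fun t => circleMap 0 r t • v)
    ((continuous_circleMap 0 r).smul continuous_const)
    (φ := fun t => deriv (circleMap 0 r) t * φ (circleMap 0 r t))
    (by
      have : (fun t => deriv (circleMap 0 r) t) = fun t => circleMap 0 r t * Complex.I := by
        ext t; simp
      simp only [deriv_circleMap]
      exact ((continuous_circleMap 0 r).mul continuous_const).mul hc)
    (fun t _ => hf _ (h t))
  refine this.congr (Eventually.of_forall fun z => ?_)
  simp only [circleIntegral, smul_eq_mul, mul_assoc]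

end ParametricIntegral

/-! ### Splitting off zeros of holomorphic functions on a disc. -/

section OneVariable

open Metric

theorem AnalyticOnNhd.dslope {h : ℂ → ℂ} {K : Set ℂ} (hh : AnalyticOnNhd ℂ h K) {a : ℂ}
    (ha : a ∈ K) : AnalyticOnNhd ℂ (dslope h a) K := by
  have hU : IsOpen {x | AnalyticAt ℂ h x} := isOpen_analyticAt ℂ h
  have hd : DifferentiableOn ℂ h {x | AnalyticAt ℂ h x} :=
    fun x hx => (AnalyticAt.differentiableAt hx).differentiableWithinAt
  have := (Complex.differentiableOn_dslope (hU.mem_nhds (hh a ha))).2 hd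
  exact fun x hx => this.analyticAt (hU.mem_nhds (hh x hx))

theorem eq_sub_mul_dslope {h : ℂ → ℂ} {a : ℂ} (ha : h a = 0) (w : ℂ) :
    h w = (w - a) * dslope h a w := by
  have := sub_smul_dslope h a w
  rw [smul_eq_mul, ha, sub_zero] at this
  exact this.symm

/-- The bound forces a zero of `D` at each `ζ`. After division by `w - ζ` the bound persists away
from `ζ`, and at `ζ` by continuity, so induction on the multiset applies, multiplicities included.
-/
theorem exists_eq_prod_mul_of_norm_le {s : Multiset ℂ} {r C : ℝ} (hs : ∀ ζ ∈ s, ‖ζ‖ < r)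
    {D : ℂ → ℂ} (hD : AnalyticOnNhd ℂ D (closedBall 0 r))
    (hDs : ∀ w ∈ closedBall (0 : ℂ) r, ‖D w‖ ≤ C * ‖(s.map fun ζ => w - ζ).prod‖) :
    ∃ D₁ : ℂ → ℂ, AnalyticOnNhd ℂ D₁ (closedBall 0 r) ∧
      ∀ w, D w = (s.map fun ζ => w - ζ).prod * D₁ w := by
  induction s using Multiset.induction_on generalizing D with
  | empty => exact ⟨D, hD, fun w => by simp⟩
  | cons ζ s ih =>
    have hζ : ‖ζ‖ < r := hs ζ (Multiset.mem_cons_self _ _)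
    have hζm : ζ ∈ closedBall (0 : ℂ) r := by simpa using hζ.le
    have h0 : D ζ = 0 := by simpa using hDs ζ hζm
    obtain ⟨D₁, h1, h2⟩ := ih (fun ξ hξ => hs ξ (Multiset.mem_cons_of_mem hξ)) (hD.dslope hζm)
      (by
        have off : ∀ w ∈ closedBall (0 : ℂ) r, w ≠ ζ →
            ‖_root_.dslope D ζ w‖ ≤ C * ‖(s.map fun ζ => w - ζ).prod‖ := by
          intro w hw hne
          have h := hDs w hw
          rw [eq_sub_mul_dslope h0 w, Multiset.map_cons, Multiset.prod_cons, norm_mul,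
            norm_mul] at h
          have hpos : 0 < ‖w - ζ‖ := norm_pos_iff.2 (sub_ne_zero.2 hne)
          refine le_of_mul_le_mul_left ?_ hpos
          linarith [h]
        intro w hw
        by_cases hne : w = ζ
        · subst hne
          have c1 : ContinuousAt (fun x => ‖_root_.dslope D w x‖) w :=
            ((hD.dslope hζm) w hζm).continuousAt.norm
          have c2 : ContinuousAt (fun x => C * ‖(s.map fun ζ => x - ζ).prod‖) w := by
            have : Continuous fun x : ℂ => (s.map fun ζ => x - ζ).prod :=
              continuous_multiset_prod s fun i _ => by fun_prop
            exact continuousAt_const.mul this.norm.continuousAt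
          refine le_of_tendsto_of_tendsto (c1.tendsto.mono_left nhdsWithin_le_nhds)
            (c2.tendsto.mono_left nhdsWithin_le_nhds) (b := 𝓝[≠] w) ?_
          have hb : ball (0 : ℂ) r ∈ 𝓝 w := isOpen_ball.mem_nhds (by simpa using hζ)
          filter_upwards [nhdsWithin_le_nhds hb, self_mem_nhdsWithin] with x hx hx'
          exact off x (ball_subset_closedBall hx) hx'
        · exact off w hw hne)
    refine ⟨D₁, h1, fun w => ?_⟩
    rw [eq_sub_mul_dslope h0 w, h2 w, Multiset.map_cons, Multiset.prod_cons, mul_assoc]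

theorem norm_multiset_prod_sub_le {s : Multiset ℂ} {w : ℂ} {a : ℝ}
    (h : ∀ ζ ∈ s, ‖w - ζ‖ ≤ a) : ‖(s.map fun ζ => w - ζ).prod‖ ≤ a ^ s.card := by
  induction s using Multiset.induction_on with
  | empty => simp
  | cons ζ s ih =>
    rw [Multiset.map_cons, Multiset.prod_cons, norm_mul, Multiset.card_cons, pow_succ']
    have h1 := h ζ (Multiset.mem_cons_self _ _)
    exact mul_le_mul h1 (ih fun ξ hξ => h ξ (Multiset.mem_cons_of_mem hξ)) (norm_nonneg _)
      ((norm_nonneg _).trans h1)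

theorem le_norm_multiset_prod_sub {s : Multiset ℂ} {w : ℂ} {a : ℝ} (ha : 0 ≤ a)
    (h : ∀ ζ ∈ s, a ≤ ‖w - ζ‖) : a ^ s.card ≤ ‖(s.map fun ζ => w - ζ).prod‖ := by
  induction s using Multiset.induction_on with
  | empty => simp
  | cons ζ s ih =>
    rw [Multiset.map_cons, Multiset.prod_cons, norm_mul, Multiset.card_cons, pow_succ']
    have h1 := h ζ (Multiset.mem_cons_self _ _)
    exact mul_le_mul h1 (ih fun ξ hξ => h ξ (Multiset.mem_cons_of_mem hξ)) (by positivity)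
      (norm_nonneg _)

/-- The number of zeros is bounded by the maximum modulus principle. -/
theorem card_le_of_eq_prod_mul {g h : ℂ → ℂ} {r M c : ℝ} (hr : 0 < r)
    (hM : ∀ w, ‖w‖ = r → ‖g w‖ ≤ M) (hgc : c ≤ ‖g (r / 4 : ℝ)‖)
    {N : ℕ} (hN : M * (1 / 2) ^ (N + 1) < c) {s : Multiset ℂ} (hs : ∀ ζ ∈ s, ‖ζ‖ < r / 8)
    (hh : AnalyticOnNhd ℂ h (closedBall 0 r))
    (hg : ∀ w ∈ closedBall (0 : ℂ) r, g w = (s.map fun ζ => w - ζ).prod * h w) : s.card ≤ N := by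
  by_contra! hk
  have hM0 : 0 ≤ M := (norm_nonneg _).trans (hM r (by simp [abs_of_pos hr]))
  -- Each factor `w - ζ` has modulus at least `7r/8` on the circle and at most `3r/8` at the point
  -- `r/4`. Each zero thus costs a factor `3/7 < 1/2` in the bound for `g (r/4)`.
  have hb : ∀ w ∈ frontier (ball (0 : ℂ) r), ‖h w‖ ≤ M / (7 * r / 8) ^ s.card := by
    intro w hw
    rw [frontier_ball _ hr.ne', mem_sphere_zero_iff_norm] at hw
    have h1 := hM w hw
    rw [hg w (by simp [hw]), norm_mul] at h1
    have h2 : (7 * r / 8) ^ s.card ≤ ‖(s.map fun ζ => w - ζ).prod‖ := by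
      refine le_norm_multiset_prod_sub (by positivity) fun ζ hζ => ?_
      have := norm_sub_norm_le w ζ
      have := hs ζ hζ
      linarith
    rw [le_div_iff₀ (by positivity), mul_comm]
    exact (mul_le_mul_of_nonneg_right h2 (norm_nonneg _)).trans h1
  have h4 : ‖((r / 4 : ℝ) : ℂ)‖ = r / 4 := by
    rw [Complex.norm_real, Real.norm_eq_abs, abs_of_pos (by positivity)]
  have hmem : ((r / 4 : ℝ) : ℂ) ∈ closedBall (0 : ℂ) r := by
    rw [mem_closedBall_zero_iff, h4]; linarith
  have hd : DiffContOnCl ℂ h (ball 0 r) := by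
    refine ⟨fun x hx => (hh x (ball_subset_closedBall hx)).differentiableAt.differentiableWithinAt,
      ?_⟩
    rw [closure_ball _ hr.ne']
    exact hh.continuousOn
  have hmax := Complex.norm_le_of_forall_mem_frontier_norm_le isBounded_ball hd hb
    (z := ((r / 4 : ℝ) : ℂ)) (by rwa [closure_ball _ hr.ne'])
  have h5 : ‖(s.map fun ζ => ((r / 4 : ℝ) : ℂ) - ζ).prod‖ ≤ (3 * r / 8) ^ s.card := by
    refine norm_multiset_prod_sub_le fun ζ hζ => ?_
    have := norm_sub_le ((r / 4 : ℝ) : ℂ) ζ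
    have := hs ζ hζ
    linarith
  rw [hg _ hmem, norm_mul] at hgc
  have h6 : c ≤ (3 * r / 8) ^ s.card * (M / (7 * r / 8) ^ s.card) :=
    hgc.trans (mul_le_mul h5 hmax (norm_nonneg _) (by positivity))
  have h7 : (3 * r / 8) ^ s.card * (M / (7 * r / 8) ^ s.card) = M * (3 / 7) ^ s.card := by
    rw [mul_div_assoc', mul_comm, mul_div_assoc, ← div_pow]
    congr 2
    field_simp
  have h8 : (3 / 7 : ℝ) ^ s.card ≤ (1 / 2) ^ (N + 1) :=
    (pow_le_pow_left₀ (by norm_num) (by norm_num) _).trans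
      (pow_le_pow_of_le_one (by norm_num) (by norm_num) hk)
  have := mul_le_mul_of_nonneg_left h8 hM0
  linarith

/-- Zeros are split off one at a time; `card_le_of_eq_prod_mul` stops the process after at most `N`
of them. The bound `N` depends only on `M` and `c`, hence is uniform over a family of discs. -/
theorem exists_eq_prod_mul {g : ℂ → ℂ} {r M c : ℝ} (hr : 0 < r)
    (hga : AnalyticOnNhd ℂ g (closedBall 0 r))
    (hne : ∀ w, r / 8 ≤ ‖w‖ → ‖w‖ ≤ r → g w ≠ 0)
    (hM : ∀ w, ‖w‖ = r → ‖g w‖ ≤ M) (hgc : c ≤ ‖g (r / 4 : ℝ)‖)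
    {N : ℕ} (hN : M * (1 / 2) ^ (N + 1) < c) :
    ∃ s : Multiset ℂ, s.card ≤ N ∧ (∀ ζ ∈ s, ‖ζ‖ < r / 8) ∧ ∃ h : ℂ → ℂ,
      AnalyticOnNhd ℂ h (closedBall 0 r) ∧ (∀ w ∈ closedBall (0 : ℂ) r, h w ≠ 0) ∧
      ∀ w, g w = (s.map fun ζ => w - ζ).prod * h w := by
  by_contra hcon
  have key : ∀ k : ℕ, ∃ s : Multiset ℂ, s.card = k ∧ (∀ ζ ∈ s, ‖ζ‖ < r / 8) ∧ ∃ h : ℂ → ℂ,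
      AnalyticOnNhd ℂ h (closedBall 0 r) ∧
      ∀ w, g w = (s.map fun ζ => w - ζ).prod * h w := by
    intro k
    induction k with
    | zero => exact ⟨0, rfl, by simp, g, hga, by simp⟩
    | succ k ih =>
      obtain ⟨s, rfl, hs, h, hh, hgh⟩ := ih
      have hcard := card_le_of_eq_prod_mul hr hM hgc hN hs hh fun w _ => hgh w
      have : ∃ w ∈ closedBall (0 : ℂ) r, h w = 0 := by
        by_contra! hn
        exact hcon ⟨s, hcard, hs, h, hh, hn, hgh⟩
      obtain ⟨a, ha, h0⟩ := this
      refine ⟨a ::ₘ s, Multiset.card_cons _ _, ?_, _root_.dslope h a, hh.dslope ha, fun w => ?_⟩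
      · intro ζ hζ
        rcases Multiset.mem_cons.1 hζ with rfl | hζ
        · by_contra! hle
          exact hne ζ hle (by simpa using ha) (by rw [hgh, h0, mul_zero])
        · exact hs ζ hζ
      · rw [hgh w, eq_sub_mul_dslope h0 w, Multiset.map_cons, Multiset.prod_cons]; ring
  obtain ⟨s, hk, hs, h, hh, hgh⟩ := key (N + 1)
  have := card_le_of_eq_prod_mul hr hM hgc hN hs hh fun w _ => hgh w
  omega

end OneVariable

/-! ### Discs in a fixed direction, and Riemann's extension theorem. -/

section Slices

open Metric

variable {E : Type*} [NormedAddCommGroup E] [NormedSpace ℂ E]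

/-- Discs in a suitable direction, on whose outer part an analytic function with nonzero germ has
no zeros. -/
theorem AnalyticAt.exists_disc_direction {g : E → ℂ} {p : E} (hg : AnalyticAt ℂ g p)
    (hg0 : ¬ ∀ᶠ z in 𝓝 p, g z = 0) {P : E → Prop} (hP : ∀ᶠ z in 𝓝 p, P z) :
    ∃ (v : E) (r : ℝ) (M c : ℝ), 0 < r ∧ 0 < c ∧ ∀ᶠ z in 𝓝 p,
      (∀ w : ℂ, ‖w‖ ≤ r → P (z + w • v)) ∧
      (∀ w : ℂ, r / 8 ≤ ‖w‖ → ‖w‖ ≤ r → g (z + w • v) ≠ 0) ∧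
      (∀ w : ℂ, ‖w‖ ≤ r → ‖g (z + w • v)‖ ≤ M) ∧ c ≤ ‖g (z + ((r / 4 : ℝ) : ℂ) • v)‖ := by
  have hbd : ∀ᶠ z in 𝓝 p, ‖g z‖ ≤ ‖g p‖ + 1 :=
    (hg.continuousAt.norm.eventually_lt (continuousAt_const (y := ‖g p‖ + 1))
      (by simp)).mono fun z hz => le_of_lt hz
  obtain ⟨ε, hε, hball⟩ := Metric.eventually_nhds_iff_ball.1
    (hg.eventually_analyticAt.and (hP.eventually_nhds.and hbd))
  obtain ⟨y, hy, hgy⟩ : ∃ y ∈ ball p ε, g y ≠ 0 := by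
    by_contra! h
    exact hg0 (Filter.mem_of_superset (ball_mem_nhds p hε) h)
  -- On the line from `p` to a nearby point `y` with `g y ≠ 0` the function is not identically zero,
  -- so its zero at `p`, if any, is isolated on that line.
  set v := y - p with hv
  have hcont : Continuous fun q : E × ℂ => q.1 + q.2 • v := by fun_prop
  have hcw : Continuous fun w : ℂ => p + w • v := by fun_prop
  have hW : IsPreconnected {w : ℂ | p + w • v ∈ ball p ε} := by
    refine Convex.isPreconnected ?_
    have : {w : ℂ | p + w • v ∈ ball p ε} = {w : ℂ | ‖w‖ * ‖v‖ < ε} := by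
      ext w; simp [norm_smul]
    rw [this]
    intro a ha b hb s t hs ht hst
    simp only [mem_ofPred_eq] at *
    have h1 : ‖s • a + t • b‖ ≤ s * ‖a‖ + t * ‖b‖ := by
      refine (norm_add_le _ _).trans ?_
      simp [abs_of_nonneg hs, abs_of_nonneg ht]
    have h2 : ‖s • a + t • b‖ * ‖v‖ ≤ s * (‖a‖ * ‖v‖) + t * (‖b‖ * ‖v‖) := by
      nlinarith [norm_nonneg v]
    have h3 : s * (‖a‖ * ‖v‖) + t * (‖b‖ * ‖v‖) < s * ε + t * ε := by
      rcases hs.eq_or_lt with rfl | hs'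
      · have : t = 1 := by linarith
        subst this; linarith
      · nlinarith
    have : s * ε + t * ε = ε := by rw [← add_mul, hst, one_mul]
    linarith
  have han : AnalyticOnNhd ℂ (fun w : ℂ => g (p + w • v)) {w : ℂ | p + w • v ∈ ball p ε} := by
    intro w hw
    have h1 : AnalyticAt ℂ (fun w : ℂ => p + w • v) w :=
      analyticAt_const.add (analyticAt_id.smul analyticAt_const)
    exact AnalyticAt.fun_comp (hball _ hw).1 h1
  have h0m : (0 : ℂ) ∈ {w : ℂ | p + w • v ∈ ball p ε} := by simp [hε]
  have h1m : (1 : ℂ) ∈ {w : ℂ | p + w • v ∈ ball p ε} := by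
    simpa [hv, dist_eq_norm] using hy
  have hev : ∀ᶠ w in 𝓝[≠] (0 : ℂ), g (p + w • v) ≠ 0 := by
    rcases (han 0 h0m).eventually_eq_zero_or_eventually_ne_zero with h | h
    · exact absurd (han.eqOn_zero_of_preconnected_of_eventuallyEq_zero hW h0m h h1m)
        (by simpa [hv] using hgy)
    · exact h
  rw [eventually_nhdsWithin_iff] at hev
  have hev2 : ∀ᶠ w in 𝓝 (0 : ℂ), p + w • v ∈ ball p ε :=
    hcw.continuousAt.eventually (isOpen_ball.mem_nhds (by simpa using hε))
  obtain ⟨r', hr', hb⟩ := Metric.eventually_nhds_iff_ball.1 (hev.and hev2)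
  have hr : 0 < r' / 2 := by positivity
  have hin : ∀ w : ℂ, ‖w‖ ≤ r' / 2 → w ∈ ball (0 : ℂ) r' := fun w hw => by
    rw [mem_ball_zero_iff]; linarith
  refine ⟨v, r' / 2, ‖g p‖ + 1, ‖g (p + ((r' / 2 / 4 : ℝ) : ℂ) • v)‖ / 2, hr, ?_, ?_⟩
  · have h4 : ‖((r' / 2 / 4 : ℝ) : ℂ)‖ = r' / 2 / 4 := by
      rw [Complex.norm_real, Real.norm_eq_abs, abs_of_pos (by positivity)]
    have : g (p + ((r' / 2 / 4 : ℝ) : ℂ) • v) ≠ 0 :=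
      (hb _ (hin _ (by rw [h4]; linarith))).1 (by
        rw [mem_compl_singleton_iff, ← norm_pos_iff, h4]; positivity)
    have := norm_pos_iff.2 this
    linarith
  · have e1 : ∀ᶠ z in 𝓝 p, ∀ w ∈ closedBall (0 : ℂ) (r' / 2),
        P (z + w • v) ∧ ‖g (z + w • v)‖ ≤ ‖g p‖ + 1 := by
      refine (isCompact_closedBall _ _).eventually_forall_of_forall_eventually fun w hw => ?_
      have hw' := (hb w (hin w (by simpa using hw))).2
      have : ∀ᶠ x in 𝓝 (p + w • v), P x ∧ ‖g x‖ ≤ ‖g p‖ + 1 := by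
        filter_upwards [(hball _ hw').2.1, isOpen_ball.mem_nhds hw'] with x hx hx'
        exact ⟨hx, (hball x hx').2.2⟩
      exact (hcont.tendsto (p, w)).eventually this
    have e2 : ∀ᶠ z in 𝓝 p, ∀ w ∈ closedBall (0 : ℂ) (r' / 2) ∩ {w | r' / 2 / 8 ≤ ‖w‖},
        g (z + w • v) ≠ 0 := by
      have hK : IsCompact (closedBall (0 : ℂ) (r' / 2) ∩ {w | r' / 2 / 8 ≤ ‖w‖}) :=
        (isCompact_closedBall _ _).inter_right (isClosed_le continuous_const continuous_norm)
      refine hK.eventually_forall_of_forall_eventually fun w hw => ?_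
      have hw' := hb w (hin w (by simpa using hw.1))
      have hne : g (p + w • v) ≠ 0 := hw'.1 (by
        have h := hw.2
        rw [mem_ofPred_eq] at h
        rw [mem_compl_singleton_iff, ← norm_pos_iff]; linarith)
      exact (hcont.tendsto (p, w)).eventually
        ((hball _ hw'.2).1.continuousAt.eventually_ne hne)
    have e3 : ∀ᶠ z in 𝓝 p, ‖g (p + ((r' / 2 / 4 : ℝ) : ℂ) • v)‖ / 2 ≤
        ‖g (z + ((r' / 2 / 4 : ℝ) : ℂ) • v)‖ := by
      have h4 : ‖((r' / 2 / 4 : ℝ) : ℂ)‖ = r' / 2 / 4 := by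
        rw [Complex.norm_real, Real.norm_eq_abs, abs_of_pos (by positivity)]
      have hw' := hb ((r' / 2 / 4 : ℝ) : ℂ) (hin _ (by rw [h4]; linarith))
      have hne : g (p + ((r' / 2 / 4 : ℝ) : ℂ) • v) ≠ 0 := hw'.1 (by
        rw [mem_compl_singleton_iff, ← norm_pos_iff, h4]; positivity)
      have hc : ContinuousAt (fun z => ‖g (z + ((r' / 2 / 4 : ℝ) : ℂ) • v)‖) p := by
        refine ContinuousAt.norm (ContinuousAt.comp (f := fun z : E => z + _ • v)
          (hball _ hw'.2).1.continuousAt (by fun_prop))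
      refine ((continuousAt_const (y := ‖g (p + ((r' / 2 / 4 : ℝ) : ℂ) • v)‖ / 2)).eventually_lt hc
        ?_).mono fun z hz => le_of_lt hz
      have := norm_pos_iff.2 hne
      linarith
    filter_upwards [e1, e2, e3] with z h1 h2 h3
    exact ⟨fun w hw => (h1 w (by simpa using hw)).1, fun w h8 hw => h2 w ⟨by simpa using hw, h8⟩,
      fun w hw => (h1 w (by simpa using hw)).2, h3⟩

theorem AnalyticAt.comp_line {g : E → ℂ} {z v : E} {w : ℂ} (h : AnalyticAt ℂ g (z + w • v)) :
    AnalyticAt ℂ (fun w : ℂ => g (z + w • v)) w := by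
  have h1 : AnalyticAt ℂ (fun w : ℂ => z + w • v) w :=
    analyticAt_const.add (analyticAt_id.smul analyticAt_const)
  exact AnalyticAt.fun_comp h h1

theorem exists_lt_of_geometric (M : ℝ) {c : ℝ} (hc : 0 < c) :
    ∃ N : ℕ, M * (1 / 2) ^ (N + 1) < c := by
  have h : Tendsto (fun N : ℕ => M * (1 / 2 : ℝ) ^ (N + 1)) atTop (𝓝 (M * 0)) :=
    ((tendsto_pow_atTop_nhds_zero_of_lt_one (by norm_num) (by norm_num)).comp
      (tendsto_add_atTop_nat 1)).const_mul M
  rw [mul_zero] at h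
  exact (h.eventually (gt_mem_nhds hc)).exists

/-- Riemann's extension theorem for bounded quotients of analytic functions. -/
theorem AnalyticAt.exists_eq_mul_of_norm_le {D H : E → ℂ} {p : E} (hD : AnalyticAt ℂ D p)
    (hH : AnalyticAt ℂ H p) (hH0 : ¬ ∀ᶠ z in 𝓝 p, H z = 0) {C : ℝ}
    (hDH : ∀ᶠ z in 𝓝 p, ‖D z‖ ≤ C * ‖H z‖) :
    ∃ q : E → ℂ, AnalyticAt ℂ q p ∧ ∀ᶠ z in 𝓝 p, D z = q z * H z := by
  obtain ⟨v, r, M, c, hr, hc, hev⟩ := hH.exists_disc_direction hH0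
    (hD.eventually_analyticAt.and (hH.eventually_analyticAt.and hDH))
  obtain ⟨N, hN⟩ := exists_lt_of_geometric M hc
  have hr8 : r / 8 ≤ r := by linarith
  -- The value of the quotient at `z` is recovered by Cauchy's formula from a circle through `z + w
  -- • v`, `‖w‖ = r`, on which `H` has no zeros; the integral is analytic in `z`. On the disc itself
  -- the bound allows the zeros of `H` to be cancelled, so the quotient is there a holomorphic `D₁ /
  -- h`.
  refine ⟨fun z => (2 * Real.pi * Complex.I)⁻¹ *
    ∮ w in C(0, r), w⁻¹ * (fun x => D x / H x) (z + w • v), ?_, ?_⟩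
  · refine analyticAt_const.mul
      (analyticAt_circleIntegral_translate (f := fun x => D x / H x) (φ := fun w => w⁻¹) hr.le ?_ ?_)
    · exact continuousOn_id.inv₀ fun w hw h => by
        rw [mem_sphere_zero_iff_norm] at hw; simp only [id] at h
        rw [h, norm_zero] at hw; linarith
    · intro w hw
      have h := hev.self_of_nhds
      exact (h.1 w hw.le).1.div (h.1 w hw.le).2.1 (h.2.1 w (by rw [hw]; exact hr8) hw.le)
  · filter_upwards [hev] with z hz
    obtain ⟨hz1, hz2, hz3, hz4⟩ := hz
    obtain ⟨s, -, hs, h, hh, hh0, hgh⟩ := exists_eq_prod_mul (g := fun w => H (z + w • v)) hr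
      (fun w hw => (hz1 w (by simpa using hw)).2.1.comp_line) hz2
      (fun w hw => hz3 w hw.le) hz4 hN
    obtain ⟨K, hK⟩ := (isCompact_closedBall (0 : ℂ) r).exists_bound_of_continuousOn hh.continuousOn
    have hC : 0 ≤ |C| := abs_nonneg C
    obtain ⟨D₁, hD₁, hDD⟩ := exists_eq_prod_mul_of_norm_le (C := |C| * K) (s := s)
      (D := fun w => D (z + w • v)) (r := r) (fun ζ hζ => (hs ζ hζ).trans_le hr8)
      (fun w hw => (hz1 w (by simpa using hw)).1.comp_line) (fun w hw => by
        have h1 := (hz1 w (by simpa using hw)).2.2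
        have h2 := hgh w
        rw [h2, norm_mul] at h1
        have h3 := hK w hw
        calc _ ≤ _ := h1
          _ ≤ |C| * (‖(s.map fun ζ => w - ζ).prod‖ * K) := by
            refine mul_le_mul (le_abs_self C) ?_ (by positivity) hC
            exact mul_le_mul_of_nonneg_left h3 (norm_nonneg _)
          _ = _ := by ring)
    have hcauchy := DifferentiableOn.circleIntegral_sub_inv_smul (R := r) (c := 0) (w := 0)
      (f := fun w => D₁ w / h w) (fun w hw =>
        ((hD₁ w hw).div (hh w hw) (hh0 w hw)).differentiableAt.differentiableWithinAt)
      (by simpa using hr)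
    have hcongr : (∮ w in C(0, r), w⁻¹ * (D (z + w • v) / H (z + w • v))) =
        ∮ w in C(0, r), (w - 0)⁻¹ • (D₁ w / h w) := by
      refine circleIntegral.integral_congr hr.le fun w hw => ?_
      have hw' : ‖w‖ = r := by simpa using hw
      have h1 := hgh w
      have h2 := hDD w
      have h3 : H (z + w • v) ≠ 0 := hz2 w (by rw [hw']; exact hr8) hw'.le
      have h4 : (s.map fun ζ => w - ζ).prod ≠ 0 := by
        intro h0; rw [h0, zero_mul] at h1; exact h3 h1
      rw [h1, h2, mul_div_mul_left _ _ h4, sub_zero, smul_eq_mul]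
    rw [hcongr, hcauchy, smul_eq_mul]
    have h1 := hgh 0
    have h2 := hDD 0
    simp only [zero_smul, add_zero] at h1 h2
    have h5 := hh0 0 (by simpa using hr.le)
    rw [h1, h2]
    have := Complex.two_pi_I_ne_zero
    field_simp

end Slices

/-! ### Moment functionals, their annihilators and Hankel determinants. -/

section Hankel

open Polynomial Matrix

/-- The linear functional on polynomials with given moments. -/
noncomputable def momentFunctional (c : ℕ → ℂ) : ℂ[X] →ₗ[ℂ] ℂ :=
  Polynomial.lsum fun j => c j • LinearMap.id

theorem momentFunctional_monomial (c : ℕ → ℂ) (j : ℕ) (a : ℂ) :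
    momentFunctional c (monomial j a) = a * c j := by
  simp [momentFunctional, mul_comm]

theorem momentFunctional_X_pow (c : ℕ → ℂ) (j : ℕ) : momentFunctional c (X ^ j) = c j := by
  rw [← monomial_one_right_eq_X_pow, momentFunctional_monomial, one_mul]

/-- The largest ideal of polynomials on which the functional vanishes. -/
def annihilatorIdeal (μ : ℂ[X] →ₗ[ℂ] ℂ) : Ideal ℂ[X] where
  carrier := {T | ∀ S, μ (T * S) = 0}
  add_mem' := fun ha hb S => by rw [add_mul, map_add, ha S, hb S, add_zero]
  zero_mem' := fun S => by simp
  smul_mem' := fun a T hT S => by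
    rw [smul_eq_mul, mul_comm a T, mul_assoc]; exact hT _

/-- Hankel matrices of a moment sequence. -/
def hankel (c : ℕ → ℂ) (m : ℕ) : Matrix (Fin m) (Fin m) ℂ :=
  Matrix.of fun i j => c (i + j)

theorem hankel_mulVec_coeff (c : ℕ → ℂ) (m : ℕ) (T : ℂ[X]) (hT : T.degree < m) (i : Fin m) :
    (hankel c m *ᵥ fun j : Fin m => T.coeff j) i = momentFunctional c (T * X ^ (i : ℕ)) := by
  conv_rhs => rw [T.as_sum_range' m (by
    by_cases h0 : T = 0
    · subst h0; simpa using i.pos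
    · exact (natDegree_lt_iff_degree_lt h0).2 hT)]
  rw [Finset.sum_mul, map_sum, Finset.sum_range]
  simp only [Matrix.mulVec, dotProduct, hankel, Matrix.of_apply]
  refine Finset.sum_congr rfl fun j _ => ?_
  rw [monomial_mul_X_pow, momentFunctional_monomial, mul_comm, add_comm]

theorem det_hankel_eq_zero {c : ℕ → ℂ} {m : ℕ} {T : ℂ[X]}
    (hT : T ∈ annihilatorIdeal (momentFunctional c)) (h0 : T ≠ 0) (hm : T.degree < m) :
    (hankel c m).det = 0 := by
  rw [← Matrix.exists_mulVec_eq_zero_iff]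
  refine ⟨fun j => T.coeff j, ?_, ?_⟩
  · intro h
    have hlt : T.natDegree < m := (natDegree_lt_iff_degree_lt h0).2 hm
    have := congrFun h ⟨T.natDegree, hlt⟩
    exact h0 (leadingCoeff_eq_zero.1 this)
  · ext i
    rw [hankel_mulVec_coeff c m T hm i]
    exact hT _

/-- A kernel vector is a polynomial `T` of degree below that of `b` with `T * X ^ i` annihilated for
small `i`. Reducing any multiplier modulo `b` shows that `T` lies in the annihilator, against the
minimality of `b`. -/
theorem det_hankel_ne_zero {c : ℕ → ℂ} {b : ℂ[X]}
    (hb : b ∈ annihilatorIdeal (momentFunctional c)) (hmon : b.Monic)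
    (hmin : ∀ T ∈ annihilatorIdeal (momentFunctional c), T ≠ 0 → b.natDegree ≤ T.natDegree) :
    (hankel c b.natDegree).det ≠ 0 := by
  intro hdet
  obtain ⟨d, hd⟩ : ∃ d, d = b.natDegree := ⟨_, rfl⟩
  rw [← hd] at hdet hmin
  obtain ⟨x, hx0, hx⟩ := Matrix.exists_mulVec_eq_zero_iff.2 hdet
  set T : ℂ[X] := ∑ j : Fin d, monomial j (x j) with hTdef
  have hcoeff : ∀ j : Fin d, T.coeff j = x j := by
    intro j
    rw [hTdef, finsetSum_coeff]
    simp only [coeff_monomial]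
    rw [Finset.sum_eq_single j]
    · simp
    · intro k _ hk
      rw [if_neg]
      exact fun h => hk (Fin.ext h)
    · simp
  have hdeg : T.degree < d := by
    refine lt_of_le_of_lt (degree_sum_le _ _) ?_
    refine (Finset.sup_lt_iff (WithBot.bot_lt_coe d)).2 fun j _ => ?_
    exact lt_of_le_of_lt (degree_monomial_le _ _) (WithBot.coe_lt_coe.2 j.2)
  have hT0 : T ≠ 0 := by
    intro h
    apply hx0
    ext j
    rw [← hcoeff j, h]; simp
  have hpow : ∀ i : Fin d, momentFunctional c (T * X ^ (i : ℕ)) = 0 := by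
    intro i
    rw [← hankel_mulVec_coeff c d T hdeg i]
    simp only [hcoeff]
    exact congrFun hx i
  have hTJ : T ∈ annihilatorIdeal (momentFunctional c) := by
    intro S
    have hS := modByMonic_add_div S (q := b)
    rw [← hS, mul_add, map_add]
    have h1 : momentFunctional c (T * (b * (S /ₘ b))) = 0 := by
      have : T * (b * (S /ₘ b)) = b * (T * (S /ₘ b)) := by ring
      rw [this]; exact hb _
    rw [h1, add_zero]
    have hR : (S %ₘ b).degree < d := by
      rw [hd, ← degree_eq_natDegree hmon.ne_zero]
      exact degree_modByMonic_lt S hmon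
    by_cases hR0 : S %ₘ b = 0
    · rw [hR0, mul_zero, map_zero]
    · rw [(S %ₘ b).as_sum_range' d ((natDegree_lt_iff_degree_lt hR0).2 hR), Finset.mul_sum, map_sum]
      refine Finset.sum_eq_zero fun i hi => ?_
      rw [← C_mul_X_pow_eq_monomial, mul_left_comm, ← smul_eq_C_mul, map_smul,
        hpow ⟨i, Finset.mem_range.1 hi⟩, smul_zero]
  have h1 := hmin T hTJ hT0
  have h2 := (natDegree_lt_iff_degree_lt hT0).2 hdeg
  omega

/-- Orthogonality of the monic `b` to `1, X, …, X ^ (m - 1)` is a Hankel system for its lower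
coefficients. Solved by Cramer's rule, it exhibits them as quotients of polynomials in the moments.
-/
theorem det_mul_coeff_eq_cramer {c : ℕ → ℂ} {b : ℂ[X]}
    (hb : b ∈ annihilatorIdeal (momentFunctional c)) (hmon : b.Monic) {m : ℕ}
    (hm : b.natDegree = m) (i : Fin m) :
    (hankel c m).det * b.coeff i = (hankel c m).cramer (fun j => - c (j + m)) i := by
  have h1 : (hankel c m *ᵥ fun j : Fin m => b.coeff j) = fun j : Fin m => - c (j + m) := by
    ext j
    have hdeg : (b - X ^ m : ℂ[X]).degree < (m : WithBot ℕ) := by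
      have h := degree_eq_natDegree hmon.ne_zero
      rw [hm] at h
      rw [← h]
      exact degree_sub_lt_left (by simp [h]) hmon.ne_zero (by simp [hmon.leadingCoeff])
    have hc : (fun j : Fin m => b.coeff j) = fun j : Fin m => (b - X ^ m).coeff j := by
      ext k
      have : (k : ℕ) ≠ m := k.2.ne
      simp [coeff_X_pow, this]
    rw [hc, hankel_mulVec_coeff c m _ hdeg j, sub_mul, map_sub, hb, zero_sub, ← pow_add,
      momentFunctional_X_pow, add_comm]
  rw [Matrix.cramer_eq_adjugate_mulVec, ← h1, Matrix.mulVec_mulVec, Matrix.adjugate_mul,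
    Matrix.smul_mulVec, Matrix.one_mulVec]
  rfl

end Hankel

/-! ### The denominator of a meromorphic function on a disc, read from its boundary moments. -/

section CircleMoments

open Polynomial Metric

theorem circleIntegrable_eval_mul {F : ℂ → ℂ} {r : ℝ} (hr : 0 ≤ r)
    (hF : ContinuousOn F (sphere 0 r)) (T : ℂ[X]) :
    CircleIntegrable (fun w => T.eval w * F w) 0 r :=
  (T.continuous.continuousOn.mul hF).circleIntegrable hr

theorem momentFunctional_circleIntegral {F : ℂ → ℂ} {r : ℝ} (hr : 0 ≤ r)
    (hF : ContinuousOn F (sphere 0 r)) (T : ℂ[X]) :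
    momentFunctional (fun j => ∮ w in C(0, r), w ^ j * F w) T =
      ∮ w in C(0, r), T.eval w * F w := by
  induction T using Polynomial.induction_on' with
  | add p q hp hq =>
    rw [map_add, hp, hq, ← circleIntegral.integral_add (circleIntegrable_eval_mul hr hF p)
      (circleIntegrable_eval_mul hr hF q)]
    simp only [eval_add, add_mul]
  | monomial j a =>
    rw [momentFunctional_monomial, ← circleIntegral.integral_const_mul]
    simp only [eval_monomial, mul_assoc]

/-- `e` is holomorphic on a slightly larger disc, so its Taylor polynomials converge to it uniformly
on the circle. -/
theorem circleIntegral_mul_eq_zero_of_polynomial {F : ℂ → ℂ} {r : ℝ} (hr : 0 < r)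
    (hF : ContinuousOn F (sphere 0 r))
    (h0 : ∀ S : ℂ[X], ∮ w in C(0, r), S.eval w * F w = 0) {e : ℂ → ℂ}
    (he : AnalyticOnNhd ℂ e (closedBall 0 r)) : ∮ w in C(0, r), e w * F w = 0 := by
  obtain ⟨δ, hδ, hsub⟩ := (isCompact_closedBall (0 : ℂ) r).exists_cthickening_subset_open
    (isOpen_analyticAt ℂ e) he
  rw [cthickening_closedBall hδ.le hr.le] at hsub
  have hd : DifferentiableOn ℂ e (closedBall 0 (r + δ)) := fun x hx =>
    (AnalyticAt.differentiableAt (hsub (by rwa [add_comm]))).differentiableWithinAt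
  lift r to NNReal using hr.le
  lift δ to NNReal using hδ.le
  have hps := hd.hasFPowerSeriesOnBall (R := r + δ) (by
    have : (0 : ℝ) < ((r + δ : NNReal) : ℝ) := by push_cast; linarith
    exact_mod_cast this)
  have hunif := hps.tendstoUniformlyOn' (r' := r + δ / 2) (by
    have : (r + δ / 2 : NNReal) < r + δ := by
      have h2 : (0:ℝ) < δ := hδ
      apply NNReal.coe_lt_coe.1; push_cast; linarith
    exact_mod_cast this)
  obtain ⟨K, hK⟩ := (isCompact_sphere (0 : ℂ) r).exists_bound_of_continuousOn hF
  have hK0 : 0 ≤ K := (norm_nonneg _).trans (hK (r : ℂ) (by simp))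
  by_contra hne
  have hpos := norm_pos_iff.2 hne
  set I₀ := ‖∮ w in C(0, (r : ℝ)), e w * F w‖ with hI
  -- Chosen so that an approximation of `e` within `η` bounds the integral by half of its own
  -- modulus `I₀`.
  set η := I₀ / (2 * (2 * Real.pi * r * (K + 1))) with hη
  have hη0 : 0 < η := by positivity
  obtain ⟨k, hk⟩ := ((Metric.tendstoUniformlyOn_iff.1 hunif) η hη0).exists
  set p := cauchyPowerSeries e 0 ((r + δ : NNReal) : ℝ) with hp
  let S : ℂ[X] := ∑ i ∈ Finset.range k, monomial i (p.coeff i)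
  have hS : ∀ w, S.eval w = p.partialSum k w := by
    intro w
    simp only [S, eval_finsetSum, eval_monomial, FormalMultilinearSeries.partialSum]
    refine Finset.sum_congr rfl fun i _ => ?_
    rw [FormalMultilinearSeries.apply_eq_pow_smul_coeff, smul_eq_mul, mul_comm]
  have heF : CircleIntegrable (fun w => e w * F w) 0 r :=
    ContinuousOn.circleIntegrable hr.le
      ((he.continuousOn.mono sphere_subset_closedBall).mul hF)
  have hdiff : (∮ w in C(0, (r : ℝ)), e w * F w) = ∮ w in C(0, (r : ℝ)), (e w - S.eval w) * F w := by
    have := circleIntegral.integral_sub heF (circleIntegrable_eval_mul hr.le hF S)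
    rw [h0 S, sub_zero] at this
    rw [← this]
    simp only [sub_mul]
  have hle : I₀ ≤ 2 * Real.pi * r * (η * K) := by
    rw [hI, hdiff]
    refine circleIntegral.norm_integral_le_of_norm_le_const hr.le fun w hw => ?_
    rw [norm_mul]
    have hw' : w ∈ ball (0 : ℂ) ((r + δ / 2 : NNReal) : ℝ) := by
      rw [mem_sphere_zero_iff_norm] at hw
      rw [mem_ball_zero_iff, hw]; push_cast
      have h2 : (0:ℝ) < δ := hδ
      linarith
    have h1 := hk w hw'
    rw [sub_zero, ← hS, dist_eq_norm] at h1
    exact mul_le_mul h1.le (hK w hw) (norm_nonneg _) hη0.le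
  have h3 : 2 * Real.pi * r * (η * (K + 1)) = I₀ / 2 := by
    rw [hη]; field_simp
  have h4 : 2 * Real.pi * r * (η * K) ≤ 2 * Real.pi * r * (η * (K + 1)) := by
    have : 0 ≤ Real.pi := Real.pi_pos.le
    gcongr; linarith
  linarith

/-- The moments of the quotient `n / g` on a circle. -/
noncomputable def circleMoments (n g : ℂ → ℂ) (r : ℝ) (j : ℕ) : ℂ :=
  ∮ w in C(0, r), w ^ j * (n w / g w)

variable {n g : ℂ → ℂ} {r : ℝ}

theorem continuousOn_div_sphere (hr : 0 < r) (hn : AnalyticOnNhd ℂ n (closedBall 0 r))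
    (hg : AnalyticOnNhd ℂ g (closedBall 0 r))
    (hne : ∀ w, r / 8 ≤ ‖w‖ → ‖w‖ ≤ r → g w ≠ 0) :
    ContinuousOn (fun w => n w / g w) (sphere 0 r) :=
  (hn.continuousOn.mono sphere_subset_closedBall).div
    (hg.continuousOn.mono sphere_subset_closedBall) fun w hw => by
      rw [mem_sphere_zero_iff_norm] at hw
      exact hne w (by linarith) hw.le

/-- If `T` annihilates the moments of `n / g`, then `T n / g` extends to the disc. -/
theorem exists_extension_of_mem_annihilatorIdeal (hr : 0 < r)
    (hn : AnalyticOnNhd ℂ n (closedBall 0 r)) (hg : AnalyticOnNhd ℂ g (closedBall 0 r))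
    (hne : ∀ w, r / 8 ≤ ‖w‖ → ‖w‖ ≤ r → g w ≠ 0) {T : ℂ[X]}
    (hT : T ∈ annihilatorIdeal (momentFunctional (circleMoments n g r))) :
    ∃ Φ : ℂ → ℂ, DifferentiableOn ℂ Φ (ball 0 r) ∧
      (∀ w ∈ ball (0 : ℂ) r, T.eval w * n w = g w * Φ w) ∧
      Φ 0 = (2 * Real.pi * Complex.I)⁻¹ * ∮ w in C(0, r), T.eval w * (w⁻¹ * (n w / g w)) := by
  have hF := continuousOn_div_sphere hr hn hg hne
  set F : ℂ → ℂ := fun w => T.eval w * (n w / g w) with hFdef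
  have hFc : ContinuousOn F (sphere 0 r) := T.continuous.continuousOn.mul hF
  have hF0 : ∀ S : ℂ[X], ∮ w in C(0, r), S.eval w * F w = 0 := by
    intro S
    have h1 := hT S
    unfold circleMoments at h1
    rw [momentFunctional_circleIntegral hr.le hF] at h1
    refine Eq.trans (circleIntegral.integral_congr hr.le fun w _ => ?_) h1
    simp only [hFdef, eval_mul]
    ring
  refine ⟨fun w => (2 * Real.pi * Complex.I)⁻¹ • ∮ z in C(0, r), (z - w)⁻¹ • F z, ?_, ?_, ?_⟩
  · lift r to NNReal using hr.le
    have := (hasFPowerSeriesOn_cauchy_integral (hFc.circleIntegrable hr.le)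
      (by exact_mod_cast hr)).differentiableOn
    rwa [eball_coe] at this
  · intro w hw
    have hcT := DifferentiableOn.circleIntegral_sub_inv_smul (R := r) (c := 0) (w := w)
      (f := fun w => T.eval w * n w) (fun x hx =>
        (T.differentiable.differentiableAt.mul (hn x hx).differentiableAt).differentiableWithinAt) hw
    have hw' : w ∈ closedBall (0 : ℂ) r := ball_subset_closedBall hw
    have hz := circleIntegral_mul_eq_zero_of_polynomial hr hFc hF0 (hg.dslope hw')
    have hint1 : CircleIntegrable (fun z => (z - w)⁻¹ * (T.eval z * n z)) 0 r := by
      refine ContinuousOn.circleIntegrable hr.le (ContinuousOn.mul ?_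
        (T.continuous.continuousOn.mul (hn.continuousOn.mono sphere_subset_closedBall)))
      refine ContinuousOn.inv₀ (by fun_prop) fun z hz h => ?_
      rw [sub_eq_zero.1 h] at hz
      rw [mem_sphere_zero_iff_norm] at hz; rw [mem_ball_zero_iff] at hw; linarith
    have hint2 : CircleIntegrable (fun z => _root_.dslope g w z * F z) 0 r :=
      ContinuousOn.circleIntegrable hr.le
        (((hg.dslope hw').continuousOn.mono sphere_subset_closedBall).mul hFc)
    -- Write `g w = g z - (z - w) * dslope g w z` and use `g z * F z = T z * n z`. The term with
    -- `dslope` integrates to zero because `F` annihilates all functions analytic on the closed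
    -- disc.
    have hkey : (∮ z in C(0, r), g w * ((z - w)⁻¹ * F z)) =
        (∮ z in C(0, r), (z - w)⁻¹ * (T.eval z * n z)) -
          ∮ z in C(0, r), _root_.dslope g w z * F z := by
      rw [← circleIntegral.integral_sub hint1 hint2]
      refine circleIntegral.integral_congr hr.le fun z hz => ?_
      rw [mem_sphere_zero_iff_norm] at hz
      have hzw : z ≠ w := by
        rintro rfl
        rw [mem_ball_zero_iff] at hw; linarith
      have hgz : g z ≠ 0 := hne z (by linarith) hz.le
      have hsub : z - w ≠ 0 := sub_ne_zero.2 hzw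
      simp only [hFdef]
      rw [dslope_of_ne _ hzw, slope_def_field]
      field_simp
      ring
    rw [hz, sub_zero, circleIntegral.integral_const_mul] at hkey
    simp only [smul_eq_mul] at hcT ⊢
    rw [hcT] at hkey
    rw [mul_left_comm, hkey]
    have := Complex.two_pi_I_ne_zero
    field_simp
  · simp only [smul_eq_mul, sub_zero, hFdef]
    congr 2
    ext w; ring

/-- Converse of the preceding theorem. `Φ` is only known on the open disc, so the contour is first
moved to radius `r / 2`, across an annulus without zeros of `g`; there the integrand is `S * Φ` and
Cauchy's theorem applies. -/
theorem mem_annihilatorIdeal_of_extension (hr : 0 < r)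
    (hn : AnalyticOnNhd ℂ n (closedBall 0 r)) (hg : AnalyticOnNhd ℂ g (closedBall 0 r))
    (hne : ∀ w, r / 8 ≤ ‖w‖ → ‖w‖ ≤ r → g w ≠ 0) {T : ℂ[X]} {Φ : ℂ → ℂ}
    (hΦ : DifferentiableOn ℂ Φ (ball 0 r))
    (hT : ∀ w ∈ ball (0 : ℂ) r, T.eval w * n w = g w * Φ w) :
    T ∈ annihilatorIdeal (momentFunctional (circleMoments n g r)) := by
  intro S
  unfold circleMoments
  rw [momentFunctional_circleIntegral hr.le (continuousOn_div_sphere hr hn hg hne)]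
  have hd : ∀ w ∈ closedBall (0 : ℂ) r \ ball 0 (r / 2),
      DifferentiableAt ℂ (fun w => (T * S).eval w * (n w / g w)) w := by
    rintro w ⟨hw, hw'⟩
    have h2 : r / 2 ≤ ‖w‖ := by simpa using hw'
    exact (T * S).differentiable.differentiableAt.mul ((hn w hw).differentiableAt.div
      (hg w hw).differentiableAt (hne w (by linarith) (by simpa using hw)))
  rw [Complex.circleIntegral_eq_of_differentiable_on_annulus_off_countable (r := r / 2)
    (by positivity) (by linarith) countable_empty
    (fun w hw => (hd w hw).continuousAt.continuousWithinAt)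
    (fun w hw => hd w ⟨ball_subset_closedBall hw.1.1, fun h =>
      hw.1.2 (ball_subset_closedBall h)⟩)]
  have hcongr : (∮ w in C(0, r / 2), (T * S).eval w * (n w / g w)) =
      ∮ w in C(0, r / 2), S.eval w * Φ w := by
    refine circleIntegral.integral_congr (by positivity) fun w hw => ?_
    rw [mem_sphere_zero_iff_norm] at hw
    have h1 := hT w (by rw [mem_ball_zero_iff, hw]; linarith)
    have h2 := hne w (by rw [hw]; linarith) (by rw [hw]; linarith)
    simp only [eval_mul]
    rw [mul_right_comm, mul_div_assoc', h1]
    field_simp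
  rw [hcongr]
  refine DiffContOnCl.circleIntegral_eq_zero (by positivity) ?_
  refine DifferentiableOn.diffContOnCl ?_
  rw [closure_ball _ (by positivity)]
  exact (S.differentiable.differentiableOn.mul hΦ).mono (closedBall_subset_ball (by linarith))

/-- The factor `w - ζ` is invertible on the disc. Hence an element of least degree has no root
outside the closed disc, which bounds its coefficients. -/
theorem mem_annihilatorIdeal_of_root_outside (hr : 0 < r)
    (hn : AnalyticOnNhd ℂ n (closedBall 0 r)) (hg : AnalyticOnNhd ℂ g (closedBall 0 r))
    (hne : ∀ w, r / 8 ≤ ‖w‖ → ‖w‖ ≤ r → g w ≠ 0) {T : ℂ[X]} {ζ : ℂ} (hζ : r < ‖ζ‖)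
    (hT : (X - C ζ) * T ∈ annihilatorIdeal (momentFunctional (circleMoments n g r))) :
    T ∈ annihilatorIdeal (momentFunctional (circleMoments n g r)) := by
  obtain ⟨Φ, hΦ, hTΦ, -⟩ := exists_extension_of_mem_annihilatorIdeal hr hn hg hne hT
  have h0 : ∀ w ∈ ball (0 : ℂ) r, w - ζ ≠ 0 := by
    intro w hw h
    rw [sub_eq_zero.1 h, mem_ball_zero_iff] at hw
    linarith
  refine mem_annihilatorIdeal_of_extension hr hn hg hne (Φ := fun w => Φ w / (w - ζ))
    (hΦ.div (by fun_prop) h0) fun w hw => ?_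
  have h1 := hTΦ w hw
  have h2 := h0 w hw
  simp only [eval_mul, eval_sub, eval_X, eval_C] at h1
  field_simp
  linear_combination h1

/-- Where `n / g` is regular, the extension `Φ` of `(w - ζ) * T * n / g` vanishes at `ζ`, so the
factor cancels. Hence an element of least degree has roots in the disc only at true poles of `n /
g`. -/
theorem mem_annihilatorIdeal_of_root_regular (hr : 0 < r)
    (hn : AnalyticOnNhd ℂ n (closedBall 0 r)) (hg : AnalyticOnNhd ℂ g (closedBall 0 r))
    (hne : ∀ w, r / 8 ≤ ‖w‖ → ‖w‖ ≤ r → g w ≠ 0) {T : ℂ[X]} {ζ : ℂ} (hζ : ‖ζ‖ < r)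
    {γ : ℂ → ℂ} (hγ : ContinuousAt γ ζ) (hγg : ∀ᶠ w in 𝓝 ζ, n w = γ w * g w)
    (hT : (X - C ζ) * T ∈ annihilatorIdeal (momentFunctional (circleMoments n g r))) :
    T ∈ annihilatorIdeal (momentFunctional (circleMoments n g r)) := by
  obtain ⟨Φ, hΦ, hTΦ, -⟩ := exists_extension_of_mem_annihilatorIdeal hr hn hg hne hT
  have hζb : ζ ∈ ball (0 : ℂ) r := by simpa using hζ
  have hζm : ζ ∈ closedBall (0 : ℂ) r := ball_subset_closedBall hζb
  have hg0 : ∀ᶠ w in 𝓝[≠] ζ, g w ≠ 0 := by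
    rcases (hg ζ hζm).eventually_eq_zero_or_eventually_ne_zero with h | h
    · have := hg.eqOn_zero_of_preconnected_of_eventuallyEq_zero
        (convex_closedBall (0 : ℂ) r).isPreconnected hζm h
      have hrm : ‖(r : ℂ)‖ = r := by simp [abs_of_pos hr]
      exact absurd (this (x := (r : ℂ)) (by simp [abs_of_pos hr]))
        (hne r (by rw [hrm]; linarith) hrm.le)
    · exact h
  have hΦc : ContinuousAt Φ ζ :=
    (hΦ.differentiableAt (isOpen_ball.mem_nhds hζb)).continuousAt
  have hbn : ∀ᶠ w in 𝓝[≠] ζ, w ∈ ball (0 : ℂ) r :=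
    nhdsWithin_le_nhds (isOpen_ball.mem_nhds hζb)
  have hΦeq : ∀ᶠ w in 𝓝[≠] ζ, Φ w = (w - ζ) * T.eval w * γ w := by
    filter_upwards [hg0, nhdsWithin_le_nhds hγg, hbn] with w h1 h2 h3
    have h4 := hTΦ w h3
    simp only [eval_mul, eval_sub, eval_X, eval_C] at h4
    rw [h2] at h4
    exact mul_left_cancel₀ h1 (by linear_combination -h4)
  have hΦ0 : Φ ζ = 0 := by
    have c1 : Tendsto (fun w => (w - ζ) * T.eval w * γ w) (𝓝 ζ) (𝓝 0) := by
      have : ContinuousAt (fun w => (w - ζ) * T.eval w * γ w) ζ := by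
        have := T.continuous.continuousAt (x := ζ)
        fun_prop
      simpa [ContinuousAt] using this
    exact tendsto_nhds_unique_of_eventuallyEq (hΦc.tendsto.mono_left nhdsWithin_le_nhds)
      (c1.mono_left nhdsWithin_le_nhds) hΦeq
  have hΦ1 : DifferentiableOn ℂ (_root_.dslope Φ ζ) (ball 0 r) :=
    (Complex.differentiableOn_dslope (isOpen_ball.mem_nhds hζb)).2 hΦ
  have hoff : ∀ w ∈ ball (0 : ℂ) r, w ≠ ζ → T.eval w * n w = g w * _root_.dslope Φ ζ w := by
    intro w hw hwζ
    have h4 := hTΦ w hw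
    simp only [eval_mul, eval_sub, eval_X, eval_C] at h4
    rw [eq_sub_mul_dslope hΦ0 w] at h4
    exact mul_left_cancel₀ (sub_ne_zero.2 hwζ) (by linear_combination h4)
  refine mem_annihilatorIdeal_of_extension hr hn hg hne hΦ1 fun w hw => ?_
  by_cases hwζ : w = ζ
  · subst hwζ
    have c1 : ContinuousAt (fun x => T.eval x * n x) w :=
      T.continuous.continuousAt.mul (hn w hζm).continuousAt
    have c2 : ContinuousAt (fun x => g x * _root_.dslope Φ w x) w :=
      (hg w hζm).continuousAt.mul (hΦ1.differentiableAt (isOpen_ball.mem_nhds hζb)).continuousAt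
    refine tendsto_nhds_unique_of_eventuallyEq (c1.tendsto.mono_left nhdsWithin_le_nhds)
      (c2.tendsto.mono_left nhdsWithin_le_nhds) (?_ : ∀ᶠ x in 𝓝[≠] w, _)
    filter_upwards [hbn, self_mem_nhdsWithin] with x hx hx'
    exact hoff x hx hx'
  · exact hoff w hw hwζ

/-- The polynomial with the zeros of `g` as roots annihilates the moments, which bounds the least
degree by the uniform `N`. -/
theorem exists_monic_mem_annihilatorIdeal (hr : 0 < r)
    (hn : AnalyticOnNhd ℂ n (closedBall 0 r)) (hg : AnalyticOnNhd ℂ g (closedBall 0 r))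
    (hne : ∀ w, r / 8 ≤ ‖w‖ → ‖w‖ ≤ r → g w ≠ 0) {M c : ℝ}
    (hM : ∀ w, ‖w‖ ≤ r → ‖g w‖ ≤ M) (hgc : c ≤ ‖g (r / 4 : ℝ)‖)
    {N : ℕ} (hN : M * (1 / 2) ^ (N + 1) < c) :
    ∃ b ∈ annihilatorIdeal (momentFunctional (circleMoments n g r)), b.Monic ∧ b.natDegree ≤ N ∧
      ∀ T ∈ annihilatorIdeal (momentFunctional (circleMoments n g r)), T ≠ 0 →
        b.natDegree ≤ T.natDegree := by
  classical
  obtain ⟨s, hsN, hs, h, hh, hh0, hgh⟩ := exists_eq_prod_mul hr hg hne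
    (fun w hw => hM w hw.le) hgc hN
  set T₀ : ℂ[X] := (s.map fun ζ => X - C ζ).prod with hT₀
  have hT₀m : T₀.Monic := monic_multiset_prod_of_monic _ _ fun ζ _ => monic_X_sub_C ζ
  have hT₀d : T₀.natDegree = s.card := natDegree_multiset_prod_X_sub_C_eq_card s
  have hT₀J : T₀ ∈ annihilatorIdeal (momentFunctional (circleMoments n g r)) := by
    refine mem_annihilatorIdeal_of_extension hr hn hg hne (Φ := fun w => n w / h w)
      (fun w hw => ((hn w (ball_subset_closedBall hw)).differentiableAt.div
        (hh w (ball_subset_closedBall hw)).differentiableAt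
        (hh0 w (ball_subset_closedBall hw))).differentiableWithinAt) fun w hw => ?_
    have h1 := hh0 w (ball_subset_closedBall hw)
    have h2 : T₀.eval w = (s.map fun ζ => w - ζ).prod := by
      rw [hT₀, eval_multiset_prod, Multiset.map_map]
      simp
    rw [hgh w, h2]
    field_simp
  have hex : ∃ k, ∃ T ∈ annihilatorIdeal (momentFunctional (circleMoments n g r)),
      T ≠ 0 ∧ T.natDegree = k := ⟨_, T₀, hT₀J, hT₀m.ne_zero, rfl⟩
  obtain ⟨T, hTJ, hT0, hTk⟩ := Nat.find_spec hex
  have hlc : T.leadingCoeff ≠ 0 := leadingCoeff_ne_zero.2 hT0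
  have hdeg : (T * C T.leadingCoeff⁻¹).natDegree = T.natDegree :=
    natDegree_mul_C (inv_ne_zero hlc)
  refine ⟨T * C T.leadingCoeff⁻¹, Ideal.mul_mem_right _ _ hTJ, monic_mul_leadingCoeff_inv hT0,
    ?_, fun T' hT' hT'0 => ?_⟩
  · rw [hdeg, hTk]
    exact (Nat.find_min' hex ⟨T₀, hT₀J, hT₀m.ne_zero, rfl⟩).trans (hT₀d.le.trans hsN)
  · rw [hdeg, hTk]
    exact Nat.find_min' hex ⟨T', hT', hT'0, rfl⟩

end CircleMoments

/-! ### Reduced fractions of analytic germs in several variables. -/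

section ReducedFraction

open Polynomial Metric

theorem Polynomial.Monic.momentFunctional_eq {b : ℂ[X]} (hb : b.Monic) {m : ℕ}
    (hm : b.natDegree = m) (c : ℕ → ℂ) :
    momentFunctional c b = c m + ∑ i : Fin m, b.coeff i * c i := by
  conv_lhs => rw [hb.as_sum]
  rw [map_add, momentFunctional_X_pow, map_sum, hm, Finset.sum_range]
  congr 1
  refine Finset.sum_congr rfl fun i _ => ?_
  rw [C_mul_X_pow_eq_monomial, momentFunctional_monomial]

theorem Polynomial.Monic.eval_eq_add_sum {b : ℂ[X]} (hb : b.Monic) {m : ℕ}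
    (hm : b.natDegree = m) (w : ℂ) :
    b.eval w = w ^ m + ∑ i : Fin m, b.coeff i * w ^ (i : ℕ) := by
  conv_lhs => rw [hb.as_sum]
  rw [hm, Finset.sum_range]
  simp [eval_finsetSum]

theorem Polynomial.Monic.exists_root_norm_le {b : ℂ[X]} (hb : b.Monic) {η : ℝ} (hη : 0 ≤ η)
    (h : ‖b.eval 0‖ < η ^ b.natDegree) : ∃ ζ, b.IsRoot ζ ∧ ‖ζ‖ ≤ η := by
  by_contra! hcon
  have hsp : b.Splits := IsAlgClosed.splits b
  have h1 := hsp.eval_eq_prod_roots_of_monic hb 0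
  have h2 : η ^ b.roots.card ≤ ‖(b.roots.map fun ζ => 0 - ζ).prod‖ :=
    le_norm_multiset_prod_sub hη fun ζ hζ => by
      rw [zero_sub, norm_neg]
      exact (hcon ζ (isRoot_of_mem_roots hζ)).le
  rw [← hsp.natDegree_eq_card_roots] at h2
  rw [h1] at h
  linarith

/-- With `C = 0` it also extends identities from the dense set `H ≠ 0`. -/
theorem norm_le_of_dense {X : Type*} [TopologicalSpace X] {W : Set X} (hW : IsOpen W) {D H : X → ℂ} (hD : ContinuousOn D W)
    (hH : ContinuousOn H W) (hdense : ∀ z ∈ W, ∃ᶠ y in 𝓝 z, H y ≠ 0) {C : ℝ}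
    (h : ∀ z ∈ W, H z ≠ 0 → ‖D z‖ ≤ C * ‖H z‖) : ∀ z ∈ W, ‖D z‖ ≤ C * ‖H z‖ := by
  intro z hz
  by_contra! hlt
  have c1 : ContinuousAt (fun y => C * ‖H y‖) z :=
    continuousAt_const.mul (hH.continuousAt (hW.mem_nhds hz)).norm
  have c2 : ContinuousAt (fun y => ‖D y‖) z := (hD.continuousAt (hW.mem_nhds hz)).norm
  obtain ⟨y, hy, hyW, hylt⟩ := ((hdense z hz).and_eventually
    ((hW.eventually_mem hz).and (c1.eventually_lt c2 hlt))).exists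
  exact absurd (h y hyW hy) (not_le.2 hylt)

variable {E : Type*} [NormedAddCommGroup E] [NormedSpace ℂ E]

theorem analyticAt_det {m : ℕ} {A : E → Matrix (Fin m) (Fin m) ℂ} {p : E}
    (hA : ∀ i j, AnalyticAt ℂ (fun z => A z i j) p) : AnalyticAt ℂ (fun z => (A z).det) p := by
  simp only [Matrix.det_apply]
  refine Finset.analyticAt_fun_sum _ fun σ _ => ?_
  have : AnalyticAt ℂ (fun z => ∏ i, A z (σ i) i) p := Finset.analyticAt_fun_prod _ fun i _ => hA _ _
  exact (this.const_smul (c := ((Equiv.Perm.sign σ : ℤ) : ℂ))).congr (Eventually.of_forall fun z => by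
    simp [Units.smul_def])

/-- A quotient of analytic functions can be written near a point as a quotient `a / b` for which
`b` vanishes only at points where the quotient is not holomorphic. -/
theorem AnalyticAt.exists_reduced_fraction {num den : E → ℂ} {p : E} (hnum : AnalyticAt ℂ num p)
    (hden : AnalyticAt ℂ den p) (hden0 : ¬ ∀ᶠ z in 𝓝 p, den z = 0) :
    ∃ a b : E → ℂ, AnalyticAt ℂ a p ∧ AnalyticAt ℂ b p ∧ (¬ ∀ᶠ z in 𝓝 p, b z = 0) ∧
      (∀ᶠ z in 𝓝 p, num z * b z = den z * a z) ∧
      ∀ᶠ q in 𝓝 p, ∀ g : E → ℂ, AnalyticAt ℂ g q → (∀ᶠ z in 𝓝 q, num z = g z * den z) →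
        b q ≠ 0 := by
  obtain ⟨v, r, M, c₀, hr, hc₀, hev⟩ := hden.exists_disc_direction hden0
    (hnum.eventually_analyticAt.and hden.eventually_analyticAt)
  obtain ⟨N, hN⟩ := exists_lt_of_geometric M hc₀
  obtain ⟨ε, hε, hU⟩ := Metric.eventually_nhds_iff_ball.1 hev
  have hr8 : r / 8 ≤ r := by linarith
  set U := ball p ε with hUdef
  have hUo : IsOpen U := isOpen_ball
  have hpU : p ∈ U := mem_ball_self hε
  set n : E → ℂ → ℂ := fun z w => num (z + w • v) with hndef
  set g : E → ℂ → ℂ := fun z w => den (z + w • v) with hgdef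
  have hn : ∀ z ∈ U, AnalyticOnNhd ℂ (n z) (closedBall 0 r) := fun z hz w hw =>
    ((hU z hz).1 w (by simpa using hw)).1.comp_line
  have hg : ∀ z ∈ U, AnalyticOnNhd ℂ (g z) (closedBall 0 r) := fun z hz w hw =>
    ((hU z hz).1 w (by simpa using hw)).2.comp_line
  have hne : ∀ z ∈ U, ∀ w, r / 8 ≤ ‖w‖ → ‖w‖ ≤ r → g z w ≠ 0 := fun z hz => (hU z hz).2.1
  set c : E → ℕ → ℂ := fun z => circleMoments (n z) (g z) r with hcdef
  have hfan : ∀ z ∈ U, ∀ w : ℂ, ‖w‖ = r → AnalyticAt ℂ (fun x => num x / den x) (z + w • v) :=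
    fun z hz w hw => ((hU z hz).1 w hw.le).1.div ((hU z hz).1 w hw.le).2
      (hne z hz w (by rw [hw]; exact hr8) hw.le)
  have hcan : ∀ j, ∀ z ∈ U, AnalyticAt ℂ (fun z => c z j) z := fun j z hz =>
    analyticAt_circleIntegral_translate (f := fun x => num x / den x) (φ := fun w => w ^ j) hr.le
      (by fun_prop) (hfan z hz)
  have hβ : ∀ z ∈ U, ∃ b ∈ annihilatorIdeal (momentFunctional (c z)), b.Monic ∧ b.natDegree ≤ N ∧
      ∀ T ∈ annihilatorIdeal (momentFunctional (c z)), T ≠ 0 → b.natDegree ≤ T.natDegree :=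
    fun z hz => exists_monic_mem_annihilatorIdeal hr (hn z hz) (hg z hz) (hne z hz)
      (hU z hz).2.2.1 (hU z hz).2.2.2 hN
  choose! β hβJ hβm hβN hβmin using hβ
  -- The degree of the denominator varies with the slice. Its maximum `m` is the generic value: the
  -- Hankel determinant `H` of size `m` is nonzero at `z₁`, hence on a dense set, and where it is
  -- nonzero the degree is `m`.
  obtain ⟨z₁, hz₁U, hz₁⟩ : ∃ z₁ ∈ U, ∀ z ∈ U, (β z).natDegree ≤ (β z₁).natDegree := by
    have hbdd : BddAbove ((fun z => (β z).natDegree) '' U) :=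
      ⟨N, by rintro _ ⟨z, hz, rfl⟩; exact hβN z hz⟩
    obtain ⟨z₁, hz₁, h1⟩ := Nat.sSup_mem ((nonempty_of_mem hpU).image _) hbdd
    exact ⟨z₁, hz₁, fun z hz => (le_csSup hbdd (mem_image_of_mem _ hz)).trans h1.ge⟩
  obtain ⟨m, hm⟩ : ∃ m, m = (β z₁).natDegree := ⟨_, rfl⟩
  rw [← hm] at hz₁
  set H : E → ℂ := fun z => (hankel (c z) m).det with hHdef
  have hHan : ∀ z ∈ U, AnalyticAt ℂ H z := fun z hz => analyticAt_det fun i j => hcan _ z hz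
  have hHz₁ : H z₁ ≠ 0 := by
    have := det_hankel_ne_zero (hβJ z₁ hz₁U) (hβm z₁ hz₁U) (hβmin z₁ hz₁U)
    rwa [← hm] at this
  have hdeg : ∀ z ∈ U, H z ≠ 0 → (β z).natDegree = m := by
    intro z hz hHz
    refine le_antisymm (hz₁ z hz) ?_
    by_contra! hlt
    exact hHz (det_hankel_eq_zero (hβJ z hz) (hβm z hz).ne_zero
      ((natDegree_lt_iff_degree_lt (hβm z hz).ne_zero).1 hlt))
  have hHdense : ∀ z ∈ U, ∃ᶠ y in 𝓝 z, H y ≠ 0 := by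
    intro z hz hcon
    have h0 : ∀ᶠ y in 𝓝 z, H y = 0 := hcon.mono fun y hy => not_not.1 hy
    have hHU : AnalyticOnNhd ℂ H U := fun y hy => hHan y hy
    exact hHz₁ (hHU.eqOn_zero_of_preconnected_of_eventuallyEq_zero
      (convex_ball p ε).isPreconnected hz h0 hz₁U)
  set D : Fin m → E → ℂ := fun i z => (hankel (c z) m).cramer (fun j => - c z (j + m)) i with hDdef
  have hDan : ∀ i, ∀ z ∈ U, AnalyticAt ℂ (D i) z := by
    intro i z hz
    simp only [hDdef, Matrix.cramer_apply]
    refine analyticAt_det fun k l => ?_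
    by_cases hl : l = i
    · subst hl
      simp only [Matrix.updateCol_self]
      exact (hcan _ z hz).neg
    · simp only [Matrix.updateCol_ne hl]
      exact hcan _ z hz
  have hDH : ∀ i, ∀ z ∈ U, H z ≠ 0 → D i z = H z * (β z).coeff i := fun i z hz hHz =>
    (det_mul_coeff_eq_cramer (hβJ z hz) (hβm z hz) (hdeg z hz hHz) i).symm
  have hroots : ∀ z ∈ U, ∀ ζ, (β z).IsRoot ζ → ‖ζ‖ ≤ r := by
    intro z hz ζ hζ
    by_contra! hlt
    have hfac := (mul_divByMonic_eq_iff_isRoot.2 hζ)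
    have hJ := hβJ z hz
    rw [← hfac] at hJ
    have h1 := mem_annihilatorIdeal_of_root_outside hr (hn z hz) (hg z hz) (hne z hz) hlt hJ
    have h0 : β z /ₘ (X - C ζ) ≠ 0 := by
      intro h0; rw [h0, mul_zero] at hfac; exact (hβm z hz).ne_zero hfac.symm
    have h2 := hβmin z hz _ h1 h0
    have h3 := congrArg natDegree hfac
    rw [natDegree_mul (X_sub_C_ne_zero ζ) h0, natDegree_X_sub_C] at h3
    omega
  -- Roots of modulus at most `r` and degree `m` bound the coefficients. The Cramer quotients `D i /
  -- H` are therefore bounded and extend analytically across `H = 0`.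
  obtain ⟨K, hK⟩ : ∃ K : ℝ, ∀ i : ℕ, ∀ z ∈ U, H z ≠ 0 → ‖(β z).coeff i‖ ≤ K := by
    refine ⟨max r 1 ^ m * m.choose (m / 2), fun i z hz hHz => ?_⟩
    have := coeff_bdd_of_roots_le (B := r) (d := m) (RingHom.id ℂ) (hβm z hz)
      (IsAlgClosed.splits _) (hdeg z hz hHz).le (fun ζ hζ => hroots z hz ζ (by
        rw [Polynomial.map_id] at hζ; exact isRoot_of_mem_roots hζ)) i
    simpa using this
  have hbound : ∀ i, ∀ z ∈ U, ‖D i z‖ ≤ K * ‖H z‖ := by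
    intro i
    refine norm_le_of_dense hUo (fun z hz => (hDan i z hz).continuousAt.continuousWithinAt)
      (fun z hz => (hHan z hz).continuousAt.continuousWithinAt) hHdense fun z hz hHz => ?_
    rw [hDH i z hz hHz, norm_mul, mul_comm]
    exact mul_le_mul_of_nonneg_right (hK i z hz hHz) (norm_nonneg _)
  have hq : ∀ i, ∃ q : E → ℂ, AnalyticAt ℂ q p ∧ ∀ᶠ z in 𝓝 p, D i z = q z * H z := fun i =>
    (hDan i p hpU).exists_eq_mul_of_norm_le (hHan p hpU) (fun h0 => hHdense p hpU
      (h0.mono fun y hy => not_not.2 hy))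
      (Filter.mem_of_superset (hUo.mem_nhds hpU) (hbound i))
  choose q hqan hqD using hq
  set A : ℕ → E → ℂ := fun k z => (2 * Real.pi * Complex.I)⁻¹ *
    ∮ w in C(0, r), w ^ k * (w⁻¹ * (n z w / g z w)) with hAdef
  have hAan : ∀ k, ∀ z ∈ U, AnalyticAt ℂ (A k) z := by
    intro k z hz
    have := analyticAt_circleIntegral_translate (f := fun x => num x / den x)
      (φ := fun w => w ^ k * w⁻¹) hr.le (ContinuousOn.mul (by fun_prop)
        (continuousOn_id.inv₀ fun w hw h => by
          rw [mem_sphere_zero_iff_norm] at hw; simp only [id] at h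
          rw [h, norm_zero] at hw; linarith)) (hfan z hz)
    have h2 := (analyticAt_const (v := (2 * Real.pi * Complex.I : ℂ)⁻¹)).fun_mul this
    simpa only [hAdef, hndef, hgdef, mul_assoc] using h2
  -- The denominator polynomial evaluated at the centre `w = 0` of the slice. The term `0 ^ m`
  -- counts when `m = 0`: then `b = 1`.
  set b : E → ℂ := fun z => 0 ^ m + ∑ i : Fin m, q i z * 0 ^ (i : ℕ) with hbdef
  set a : E → ℂ := fun z => A m z + ∑ i : Fin m, q i z * A i z with hadef
  have haan : AnalyticAt ℂ a p := (hAan m p hpU).add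
    (Finset.analyticAt_fun_sum _ fun i _ => (hqan i).mul (hAan _ p hpU))
  have hban : AnalyticAt ℂ b p := analyticAt_const.add
    (Finset.analyticAt_fun_sum _ fun i _ => (hqan i).mul analyticAt_const)
  obtain ⟨δ, hδ, hW⟩ := Metric.eventually_nhds_iff_ball.1
    ((eventually_all.2 hqD).and ((hUo.eventually_mem hpU).and
      (haan.eventually_analyticAt.and (hban.eventually_analyticAt.and
        (hnum.eventually_analyticAt.and hden.eventually_analyticAt)))))
  set W := ball p δ with hWdef
  have hWo : IsOpen W := isOpen_ball
  have hpW : p ∈ W := mem_ball_self hδ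
  have hcoeff : ∀ z ∈ W, H z ≠ 0 → ∀ i : Fin m, q i z = (β z).coeff i := by
    intro z hz hHz i
    have h1 := (hW z hz).1 i
    rw [hDH i z (hW z hz).2.1 hHz, mul_comm] at h1
    exact (mul_right_cancel₀ hHz h1).symm
  have hbβ : ∀ z ∈ W, H z ≠ 0 → b z = (β z).eval 0 := by
    intro z hz hHz
    rw [(hβm z (hW z hz).2.1).eval_eq_add_sum (hdeg z (hW z hz).2.1 hHz), hbdef]
    simp only [hcoeff z hz hHz]
  have hid0 : ∀ z ∈ W, H z ≠ 0 → num z * b z - den z * a z = 0 := by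
    intro z hz hHz
    have hzU := (hW z hz).2.1
    obtain ⟨Φ, -, hΦ, hΦ0⟩ := exists_extension_of_mem_annihilatorIdeal hr (hn z hzU) (hg z hzU)
      (hne z hzU) (hβJ z hzU)
    -- `Φ 0` is a Cauchy integral that is linear in the coefficients of `β z`; expanding it gives
    -- the defining formula of `a`.
    have haz : a z = Φ 0 := by
      rw [hΦ0, ← momentFunctional_circleIntegral hr.le (F := fun w => w⁻¹ * (n z w / g z w)) ?_,
        (hβm z hzU).momentFunctional_eq (hdeg z hzU hHz), mul_add, Finset.mul_sum, hadef]
      · simp only [hcoeff z hz hHz, hAdef]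
        congr 1
        refine Finset.sum_congr rfl fun i _ => ?_
        ring
      · exact (continuousOn_id.inv₀ fun w hw h => by
          rw [mem_sphere_zero_iff_norm] at hw; simp only [id] at h
          rw [h, norm_zero] at hw; linarith).mul
          (continuousOn_div_sphere hr (hn z hzU) (hg z hzU) (hne z hzU))
    have h1 := hΦ 0 (by simpa using hr)
    simp only [hndef, hgdef, zero_smul, add_zero] at h1
    rw [hbβ z hz hHz, haz]
    linear_combination h1
  have hid : ∀ z ∈ W, num z * b z = den z * a z := by
    intro z hz
    have h := norm_le_of_dense hWo (D := fun z => num z * b z - den z * a z) (H := H) (C := 0)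
      (fun y hy => ((hW y hy).2.2.2.2.1.continuousAt.mul (hW y hy).2.2.2.1.continuousAt).sub
        ((hW y hy).2.2.2.2.2.continuousAt.mul
          (hW y hy).2.2.1.continuousAt) |>.continuousWithinAt)
      (fun y hy => (hHan y (hW y hy).2.1).continuousAt.continuousWithinAt)
      (fun y hy => hHdense y (hW y hy).2.1)
      (fun y hy hHy => by rw [hid0 y hy hHy]; simp) z hz
    rw [zero_mul, norm_le_zero_iff] at h
    exact sub_eq_zero.1 h
  -- If `b z = 0`, then at a close generic point `y` the polynomial `β y` has a root `ζ` near 0,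
  -- since the product of its roots is small. The quotient is regular at `y + ζ • v`, so the root
  -- can be removed from the denominator, against minimality.
  have hstar : ∀ z ∈ W, ∀ γ : E → ℂ, AnalyticAt ℂ γ z → (∀ᶠ y in 𝓝 z, num y = γ y * den y) →
      b z ≠ 0 := by
    intro z hz γ hγ hγe hbz
    obtain ⟨ρ, hρ, hρball⟩ := Metric.eventually_nhds_iff_ball.1
      (hγ.eventually_analyticAt.and (hγe.eventually_nhds.and
        (hWo.eventually_mem hz)))
    obtain ⟨η, hη, hηr, hηρ⟩ : ∃ η : ℝ, 0 < η ∧ η < r ∧ η * ‖v‖ < ρ / 2 := by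
      have h1 : Tendsto (fun η : ℝ => η * ‖v‖) (𝓝[>] 0) (𝓝 0) := by
        have : Tendsto (fun η : ℝ => η * ‖v‖) (𝓝 0) (𝓝 (0 * ‖v‖)) :=
          (continuous_id.mul continuous_const).tendsto 0
        rw [zero_mul] at this
        exact this.mono_left nhdsWithin_le_nhds
      obtain ⟨η, h⟩ := ((h1.eventually (gt_mem_nhds (half_pos hρ))).and
        (Ioo_mem_nhdsGT hr)).exists
      exact ⟨η, h.2.1, h.2.2, h.1⟩
    have hsmall : ∀ᶠ y in 𝓝 z, ‖b y‖ < η ^ m := by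
      have := (hW z hz).2.2.2.1.continuousAt.norm
      exact this.eventually (gt_mem_nhds (by change ‖b z‖ < _; rw [hbz, norm_zero]; positivity))
    obtain ⟨y, hHy, hby, hyz⟩ := ((hHdense z (hW z hz).2.1).and_eventually
      (hsmall.and (isOpen_ball.eventually_mem (mem_ball_self (half_pos hρ))))).exists
    have hyW : y ∈ W := (hρball y (ball_subset_ball (by linarith) hyz)).2.2
    have hyU := (hW y hyW).2.1
    rw [hbβ y hyW hHy, ← hdeg y hyU hHy] at hby
    obtain ⟨ζ, hζ, hζη⟩ := (hβm y hyU).exists_root_norm_le hη.le hby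
    have hmem : y + ζ • v ∈ ball z ρ := by
      rw [mem_ball, dist_eq_norm] at hyz ⊢
      calc ‖y + ζ • v - z‖ = ‖(y - z) + ζ • v‖ := by congr 1; abel
        _ ≤ ‖y - z‖ + ‖ζ • v‖ := norm_add_le _ _
        _ ≤ ‖y - z‖ + η * ‖v‖ := by rw [norm_smul]; gcongr
        _ < ρ := by linarith
    have hfac := mul_divByMonic_eq_iff_isRoot.2 hζ
    have hJ := hβJ y hyU
    rw [← hfac] at hJ
    have hc : ContinuousAt (fun w : ℂ => y + w • v) ζ := by fun_prop
    have h1 := mem_annihilatorIdeal_of_root_regular hr (hn y hyU) (hg y hyU) (hne y hyU)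
      (hζη.trans_lt hηr) (γ := fun w => γ (y + w • v))
      (ContinuousAt.comp (f := fun w : ℂ => y + w • v) (hρball _ hmem).1.continuousAt hc)
      (hc.eventually (hρball _ hmem).2.1) hJ
    have h0 : β y /ₘ (X - C ζ) ≠ 0 := by
      intro h0; rw [h0, mul_zero] at hfac; exact (hβm y hyU).ne_zero hfac.symm
    have h2 := hβmin y hyU _ h1 h0
    have h3 := congrArg natDegree hfac
    rw [natDegree_mul (X_sub_C_ne_zero ζ) h0, natDegree_X_sub_C] at h3
    omega
  refine ⟨a, b, haan, hban, fun hb0 => ?_, Filter.mem_of_superset (hWo.mem_nhds hpW) hid,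
    Filter.mem_of_superset (hWo.mem_nhds hpW) hstar⟩
  have hden0' : ∃ᶠ z in 𝓝 p, den z ≠ 0 := fun h => hden0 (h.mono fun z hz => not_not.1 hz)
  obtain ⟨z, hdz, hzW, hbz⟩ := (hden0'.and_eventually
    ((hWo.eventually_mem hpW).and hb0)).exists
  obtain ⟨-, -, -, -, hnz, hgz⟩ := hW z hzW
  -- Where `den` is nonzero the quotient is holomorphic, so `b` cannot vanish there; thus the germ
  -- of `b` is not zero.
  refine hstar z hzW (fun y => num y / den y) (hnz.div hgz hdz) ?_ hbz
  filter_upwards [hgz.continuousAt.eventually_ne hdz] with y hy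
  rw [div_mul_cancel₀ _ hy]

end ReducedFraction

/-! ### The complete elliptic integral on the slit plane. -/

section PeriodIntegral

open MeasureTheory Complex

/-- The principal square root. -/
noncomputable def csqrt (z : ℂ) : ℂ := exp (log z / 2)

/-- This includes `z = 0`, where `log 0 = 0` makes the value `1`. -/
theorem csqrt_ne_zero (z : ℂ) : csqrt z ≠ 0 := exp_ne_zero _

theorem csqrt_mul_self {z : ℂ} (hz : z ≠ 0) : csqrt z * csqrt z = z := by
  rw [csqrt, ← exp_add, add_halves, exp_log hz]

theorem csqrt_re_pos {z : ℂ} (hz : z ∈ slitPlane) : 0 < (csqrt z).re := by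
  rw [csqrt, exp_re]
  have h1 : (log z / 2).im = arg z / 2 := by
    rw [show log z / 2 = log z / (2 : ℝ) by norm_num, div_ofReal_im, log_im]
  rw [h1]
  have h2 := neg_pi_lt_arg z
  have h3 := arg_le_pi z
  have h4 : arg z ≠ Real.pi := (mem_slitPlane_iff_arg.1 hz).1
  have h5 : arg z < Real.pi := lt_of_le_of_ne h3 h4
  exact mul_pos (Real.exp_pos _) (Real.cos_pos_of_mem_Ioo ⟨by linarith, by linarith⟩)

/-- The positive real part singles out the branch; product formulas for square roots below are
reduced to this sign check. -/
theorem csqrt_eq {z u : ℂ} (hz : z ∈ slitPlane) (hu : u * u = z) (hre : 0 < u.re) :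
    csqrt z = u := by
  have h1 := csqrt_mul_self (slitPlane_ne_zero hz)
  have h2 : (csqrt z - u) * (csqrt z + u) = 0 := by linear_combination h1 - hu
  rcases mul_eq_zero.1 h2 with h | h
  · exact sub_eq_zero.1 h
  · have h3 := congrArg re h
    have h4 := csqrt_re_pos hz
    rw [add_re, zero_re] at h3
    linarith

theorem csqrt_im_pos {z : ℂ} (hz : 0 < z.im) : 0 < (csqrt z).im := by
  have hs : z ∈ slitPlane := Or.inr hz.ne'
  have h1 := congrArg im (csqrt_mul_self (slitPlane_ne_zero hs))
  have h2 := csqrt_re_pos hs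
  rw [mul_im] at h1
  by_contra! h
  nlinarith

theorem csqrt_im_neg {z : ℂ} (hz : z.im < 0) : (csqrt z).im < 0 := by
  have hs : z ∈ slitPlane := Or.inr hz.ne
  have h1 := congrArg im (csqrt_mul_self (slitPlane_ne_zero hs))
  have h2 := csqrt_re_pos hs
  rw [mul_im] at h1
  by_contra! h
  nlinarith

theorem conj_mem_slitPlane {z : ℂ} (hz : z ∈ slitPlane) : (starRingEnd ℂ) z ∈ slitPlane := by
  rw [mem_slitPlane_iff] at hz ⊢
  simpa using hz

theorem csqrt_conj {z : ℂ} (hz : z ∈ slitPlane) :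
    csqrt ((starRingEnd ℂ) z) = (starRingEnd ℂ) (csqrt z) := by
  refine csqrt_eq (conj_mem_slitPlane hz) ?_ (by simpa using csqrt_re_pos hz)
  rw [← map_mul, csqrt_mul_self (slitPlane_ne_zero hz)]

theorem norm_csqrt {z : ℂ} (hz : z ≠ 0) : ‖csqrt z‖ = √‖z‖ := by
  rw [← csqrt_mul_self hz, norm_mul, Real.sqrt_mul_self (norm_nonneg _), csqrt_mul_self hz]

theorem hasDerivAt_csqrt {z : ℂ} (hz : z ∈ slitPlane) :
    HasDerivAt csqrt (csqrt z * (z⁻¹ / 2)) z :=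
  ((hasDerivAt_log hz).div_const 2).cexp

theorem continuousAt_csqrt {z : ℂ} (hz : z ∈ slitPlane) : ContinuousAt csqrt z :=
  (hasDerivAt_csqrt hz).continuousAt

theorem add_ofReal_mem_slitPlane {z : ℂ} (hz : z ∈ slitPlane) {x : ℝ} (hx : 0 ≤ x) :
    z + x ∈ slitPlane := by
  rw [mem_slitPlane_iff] at hz ⊢
  rcases hz with h | h
  · left; simp; linarith
  · right; simpa using h

/-- The integrand of `periodIntegral`. -/
noncomputable def periodKernel (z : ℂ) (x : ℝ) : ℂ :=
  (((√x * √(1 + x))⁻¹ : ℝ) : ℂ) * (csqrt (z + x))⁻¹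

/-- The complete elliptic integral `∫₀^∞ dx / √(x (1 + x) (z + x))`. -/
noncomputable def periodIntegral (z : ℂ) : ℂ := ∫ x in Ioi (0 : ℝ), periodKernel z x

theorem integrableOn_inv_sqrt_mul :
    IntegrableOn (fun x : ℝ => (√x * (1 + x))⁻¹) (Ioi 0) := by
  have hd : ∀ x ∈ Ioi (0 : ℝ), HasDerivAt (fun x => 2 * Real.arctan √x) (√x * (1 + x))⁻¹ x := by
    intro x hx
    have hx' : (0 : ℝ) < x := hx
    have h := ((Real.hasDerivAt_sqrt hx'.ne').arctan).const_mul 2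
    convert! h using 1
    rw [Real.sq_sqrt hx'.le]
    have := Real.sqrt_pos.2 hx'
    field_simp
  refine integrableOn_Ioi_deriv_of_nonneg (l := 2 * (Real.pi / 2)) ?_ hd (fun x hx => ?_) ?_
  · exact (by fun_prop : Continuous fun x => 2 * Real.arctan √x).continuousWithinAt
  · have hx' : (0 : ℝ) < x := hx
    positivity
  · exact ((Real.tendsto_arctan_atTop.mono_right nhdsWithin_le_nhds).comp
      Real.tendsto_sqrt_atTop).const_mul 2

/-- This makes the kernel at most a constant times `1 / (√x * (1 + x))`, the derivative of `2 arctan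
√x`. -/
theorem exists_le_norm_add {z : ℂ} (hz : z ∈ slitPlane) :
    ∃ c : ℝ, 0 < c ∧ ∀ x : ℝ, 0 ≤ x → c * (1 + x) ≤ ‖z + x‖ := by
  rcases hz with h | h
  · refine ⟨min z.re 1, lt_min h one_pos, fun x hx => ?_⟩
    have h1 : z.re + x ≤ ‖z + x‖ := by
      have := re_le_norm (z + x)
      simpa using this
    have h2 : min z.re 1 ≤ z.re := min_le_left _ _
    have h3 : min z.re 1 ≤ 1 := min_le_right _ _
    nlinarith
  · have hi : 0 < |z.im| := abs_pos.2 h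
    refine ⟨|z.im| / (1 + |z.im| + ‖z‖), by positivity, fun x hx => ?_⟩
    have h1 : |z.im| ≤ ‖z + x‖ := by
      have := abs_im_le_norm (z + x)
      simpa using this
    have h2 : x ≤ ‖z + x‖ + ‖z‖ := by
      have := norm_sub_le (z + x) z
      rw [add_sub_cancel_left, norm_real, Real.norm_eq_abs, abs_of_nonneg hx] at this
      exact this
    rw [div_mul_eq_mul_div, div_le_iff₀ (by positivity)]
    nlinarith [norm_nonneg z]

theorem continuousOn_periodKernel {z : ℂ} (hz : z ∈ slitPlane) :
    ContinuousOn (periodKernel z) (Ioi 0) := by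
  intro x hx
  have hx' : (0 : ℝ) < x := hx
  have h1 : ContinuousAt (fun x : ℝ => csqrt (z + x)) x :=
    ContinuousAt.comp (f := fun x : ℝ => z + x)
      (continuousAt_csqrt (add_ofReal_mem_slitPlane hz hx'.le)) (by fun_prop)
  have h2 : √x * √(1 + x) ≠ 0 := by positivity
  have h3 : ContinuousAt (fun x : ℝ => (√x * √(1 + x))⁻¹) x :=
    ContinuousAt.inv₀ (by fun_prop) h2
  exact ((continuous_ofReal.continuousAt.comp h3).mul (h1.inv₀ (csqrt_ne_zero _))).continuousWithinAt

theorem norm_csqrt_inv_le {w : ℂ} {c x : ℝ} (hc : 0 < c) (hx : 0 < x) (h : c * (1 + x) ≤ ‖w‖) :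
    ‖(csqrt w)⁻¹‖ ≤ (√c)⁻¹ * (√(1 + x))⁻¹ := by
  have h0 : 0 < c * (1 + x) := by positivity
  have hw : w ≠ 0 := norm_pos_iff.1 (h0.trans_le h)
  rw [norm_inv, norm_csqrt hw, ← mul_inv, ← Real.sqrt_mul hc.le]
  exact inv_anti₀ (Real.sqrt_pos.2 h0) (Real.sqrt_le_sqrt h)

theorem inv_sqrt_mul_eq {x : ℝ} (hx : 0 < x) :
    (√x * √(1 + x))⁻¹ * (√(1 + x))⁻¹ = (√x * (1 + x))⁻¹ := by
  rw [← mul_inv, mul_assoc, Real.mul_self_sqrt (by linarith)]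

theorem norm_periodKernel_le {z : ℂ} {c x : ℝ} (hc : 0 < c) (hx : 0 < x)
    (h : c * (1 + x) ≤ ‖z + x‖) :
    ‖periodKernel z x‖ ≤ (√c)⁻¹ * (√x * (1 + x))⁻¹ := by
  have h1 := norm_csqrt_inv_le hc hx h
  have h2 : 0 ≤ (√x * √(1 + x))⁻¹ := by positivity
  rw [periodKernel, norm_mul, norm_real, Real.norm_eq_abs, abs_of_nonneg h2, ← inv_sqrt_mul_eq hx]
  calc _ ≤ (√x * √(1 + x))⁻¹ * ((√c)⁻¹ * (√(1 + x))⁻¹) := by gcongr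
    _ = _ := by ring

theorem integrableOn_periodKernel {z : ℂ} (hz : z ∈ slitPlane) :
    IntegrableOn (periodKernel z) (Ioi 0) := by
  obtain ⟨c, hc, h⟩ := exists_le_norm_add hz
  refine (integrableOn_inv_sqrt_mul.const_mul (√c)⁻¹).mono'
    ((continuousOn_periodKernel hz).aestronglyMeasurable measurableSet_Ioi) ?_
  refine (ae_restrict_iff' measurableSet_Ioi).2 (ae_of_all _ fun x hx => ?_)
  exact norm_periodKernel_le hc hx (h x (le_of_lt hx))

theorem differentiableAt_periodIntegral {z : ℂ} (hz : z ∈ slitPlane) :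
    DifferentiableAt ℂ periodIntegral z := by
  obtain ⟨c, hc, h⟩ := exists_le_norm_add hz
  obtain ⟨ε, hε, hball⟩ := Metric.isOpen_iff.1 isOpen_slitPlane z hz
  set ρ := min ε (c / 2) with hρ
  have hρ0 : 0 < ρ := lt_min hε (by positivity)
  have hs : ∀ z' ∈ Metric.ball z ρ, z' ∈ slitPlane := fun z' hz' =>
    hball (Metric.ball_subset_ball (min_le_left _ _) hz')
  have hb : ∀ z' ∈ Metric.ball z ρ, ∀ x : ℝ, 0 ≤ x → c / 2 * (1 + x) ≤ ‖z' + x‖ := by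
    intro z' hz' x hx
    have h1 := h x hx
    have h2 : ‖z + x‖ ≤ ‖z' + x‖ + ‖z' - z‖ := by
      have := norm_sub_le (z' + x) (z' - z)
      rwa [show z' + (x : ℂ) - (z' - z) = z + x by ring] at this
    have h3 : ‖z' - z‖ < c / 2 := by
      rw [← dist_eq_norm]; exact (Metric.mem_ball.1 hz').trans_le (min_le_right _ _)
    nlinarith
  have key := hasDerivAt_integral_of_dominated_loc_of_deriv_le (μ := volume.restrict (Ioi 0))
    (F := periodKernel) (F' := fun z x => periodKernel z x * (-((z + x)⁻¹ / 2)))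
    (x₀ := z) (s := Metric.ball z ρ)
    (bound := fun x => (√(c / 2))⁻¹ * (c / 2)⁻¹ * (√x * (1 + x))⁻¹)
    (Metric.ball_mem_nhds z hρ0) ?_ ?_ ?_ ?_ ?_ ?_
  · exact key.2.differentiableAt
  · filter_upwards [isOpen_slitPlane.mem_nhds hz] with z' hz'
    exact (continuousOn_periodKernel hz').aestronglyMeasurable measurableSet_Ioi
  · exact integrableOn_periodKernel hz
  · refine ContinuousOn.aestronglyMeasurable ((continuousOn_periodKernel hz).mul ?_)
      measurableSet_Ioi
    refine (ContinuousOn.div_const (ContinuousOn.inv₀ (by fun_prop) fun x hx => ?_) 2).neg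
    exact slitPlane_ne_zero (add_ofReal_mem_slitPlane hz (le_of_lt hx))
  · refine (ae_restrict_iff' measurableSet_Ioi).2 (ae_of_all _ fun x hx z' hz' => ?_)
    have hx' : (0 : ℝ) < x := hx
    have h1 := norm_periodKernel_le (half_pos hc) hx' (hb z' hz' x hx'.le)
    have h2 : ‖-((z' + x)⁻¹ / 2)‖ ≤ (c / 2)⁻¹ := by
      rw [norm_neg, norm_div, norm_inv]
      have h3 : c / 2 ≤ ‖z' + x‖ := by
        have := hb z' hz' x hx'.le
        nlinarith
      have h4 : ‖z' + x‖⁻¹ ≤ (c / 2)⁻¹ := inv_anti₀ (by positivity) h3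
      have h5 : 0 ≤ (c / 2)⁻¹ := by positivity
      have : ‖(2 : ℂ)‖ = 2 := by simp
      rw [this]
      linarith
    rw [norm_mul]
    calc _ ≤ (√(c / 2))⁻¹ * (√x * (1 + x))⁻¹ * (c / 2)⁻¹ := by gcongr
      _ = _ := by ring
  · exact integrableOn_inv_sqrt_mul.const_mul _
  · refine (ae_restrict_iff' measurableSet_Ioi).2 (ae_of_all _ fun x hx z' hz' => ?_)
    have hx' : (0 : ℝ) < x := hx
    have hm := add_ofReal_mem_slitPlane (hs z' hz') hx'.le
    have h1 : HasDerivAt (fun z' : ℂ => csqrt (z' + x)) (csqrt (z' + x) * ((z' + x)⁻¹ / 2)) z' := by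
      exact (hasDerivAt_csqrt hm).comp_add_const z' x
    have h2 := (h1.fun_inv (csqrt_ne_zero _)).const_mul (((√x * √(1 + x))⁻¹ : ℝ) : ℂ)
    convert! h2 using 1
    have := csqrt_ne_zero (z' + x)
    rw [periodKernel]
    field_simp

theorem periodKernel_re_pos {z : ℂ} (hz : z ∈ slitPlane) {x : ℝ} (hx : 0 < x) :
    0 < (periodKernel z x).re := by
  have h1 : 0 < (√x * √(1 + x))⁻¹ := by positivity
  rw [periodKernel, re_ofReal_mul, inv_re]
  have h2 := csqrt_re_pos (add_ofReal_mem_slitPlane hz hx.le)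
  have h3 := normSq_pos.2 (csqrt_ne_zero (z + x))
  positivity

theorem setIntegral_Ioi_pos {f : ℝ → ℝ} (hf : IntegrableOn f (Ioi 0))
    (hpos : ∀ x, 0 < x → 0 < f x) : 0 < ∫ x in Ioi (0 : ℝ), f x := by
  rw [setIntegral_pos_iff_support_of_nonneg_ae]
  · have : Function.support f ∩ Ioi 0 = Ioi 0 :=
      inter_eq_right.2 fun x hx => (hpos x hx).ne'
    rw [this]; simp
  · exact (ae_restrict_iff' measurableSet_Ioi).2 (ae_of_all _ fun x hx => (hpos x hx).le)
  · exact hf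

theorem periodIntegral_re_pos {z : ℂ} (hz : z ∈ slitPlane) : 0 < (periodIntegral z).re := by
  have h := integrableOn_periodKernel hz
  have h1 := reCLM.integral_comp_comm h
  simp only [reCLM_apply] at h1
  rw [periodIntegral, ← h1]
  exact setIntegral_Ioi_pos h.re fun x hx => periodKernel_re_pos hz hx

theorem periodIntegral_im_neg {z : ℂ} (hz : 0 < z.im) : (periodIntegral z).im < 0 := by
  have hs : z ∈ slitPlane := Or.inr hz.ne'
  have h := integrableOn_periodKernel hs
  have h1 := imCLM.integral_comp_comm h
  simp only [imCLM_apply] at h1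
  rw [periodIntegral, ← h1, ← neg_pos, ← integral_neg]
  refine setIntegral_Ioi_pos h.im.neg fun x hx => ?_
  have h1 : 0 < (√x * √(1 + x))⁻¹ := by positivity
  rw [periodKernel, im_ofReal_mul, inv_im, ← mul_neg, ← neg_div, neg_neg]
  have h2 : 0 < (csqrt (z + x)).im := csqrt_im_pos (by simpa using hz)
  have h3 := normSq_pos.2 (csqrt_ne_zero (z + x))
  positivity

theorem periodKernel_conj {z : ℂ} (hz : z ∈ slitPlane) {x : ℝ} (hx : 0 < x) :
    periodKernel ((starRingEnd ℂ) z) x = (starRingEnd ℂ) (periodKernel z x) := by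
  have h := csqrt_conj (add_ofReal_mem_slitPlane hz hx.le)
  rw [map_add, conj_ofReal] at h
  rw [periodKernel, periodKernel, h, map_mul, map_inv₀, conj_ofReal]

theorem periodIntegral_conj {z : ℂ} (hz : z ∈ slitPlane) :
    periodIntegral ((starRingEnd ℂ) z) = (starRingEnd ℂ) (periodIntegral z) := by
  rw [periodIntegral, periodIntegral, ← integral_conj]
  exact setIntegral_congr_fun measurableSet_Ioi fun x hx => periodKernel_conj hz hx

/-- Both roots have positive real part and imaginary parts of the same sign, so their arguments
differ by less than a right angle. -/
theorem csqrt_add_mul_re_pos {w : ℂ} (hw : w ∈ slitPlane) {x : ℝ} (hx : 0 ≤ x) :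
    0 < (csqrt (w + x) * (csqrt w)⁻¹).re := by
  have hwx := add_ofReal_mem_slitPlane hw hx
  have h1 := csqrt_re_pos hw
  have h2 := csqrt_re_pos hwx
  have h3 : 0 ≤ (csqrt (w + x)).im * (csqrt w).im := by
    rcases lt_trichotomy w.im 0 with h | h | h
    · exact (mul_pos_of_neg_of_neg (csqrt_im_neg (by simpa using h)) (csqrt_im_neg h)).le
    · have h4 := congrArg im (csqrt_mul_self (slitPlane_ne_zero hw))
      rw [mul_im, h] at h4
      have : (csqrt w).im = 0 := by
        have : (csqrt w).re * (csqrt w).im = 0 := by linarith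
        exact (mul_eq_zero.1 this).resolve_left h1.ne'
      rw [this, mul_zero]
    · exact (mul_pos (csqrt_im_pos (by simpa using h)) (csqrt_im_pos h)).le
  have h4 := normSq_pos.2 (csqrt_ne_zero w)
  rw [mul_re, inv_re, inv_im]
  have : (csqrt (w + x)).re * ((csqrt w).re / normSq (csqrt w)) -
      (csqrt (w + x)).im * (-(csqrt w).im / normSq (csqrt w)) =
      ((csqrt (w + x)).re * (csqrt w).re + (csqrt (w + x)).im * (csqrt w).im) /
        normSq (csqrt w) := by ring
  rw [this]
  positivity

/-- Substitute `x ↦ 1 / x`. -/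
theorem periodIntegral_inv {w : ℂ} (hw : w ∈ slitPlane) :
    periodIntegral w⁻¹ = csqrt w * periodIntegral w := by
  have hsub := integral_comp_rpow_Ioi (periodKernel w⁻¹) (p := -1) (by norm_num)
  rw [periodIntegral, ← hsub, periodIntegral, ← integral_const_mul]
  refine setIntegral_congr_fun measurableSet_Ioi fun x hx => ?_
  have hx' : (0 : ℝ) < x := hx
  have hw0 := slitPlane_ne_zero hw
  have hxc : (x : ℂ) ≠ 0 := ofReal_ne_zero.2 hx'.ne'
  have hwx := add_ofReal_mem_slitPlane hw hx'.le
  have hinv : w⁻¹ ∈ slitPlane := by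
    rw [mem_slitPlane_iff, inv_re, inv_im]
    have := normSq_pos.2 hw0
    rcases hw with h | h
    · left; positivity
    · right; exact div_ne_zero (neg_ne_zero.2 h) this.ne'
  have hsq : csqrt (w⁻¹ + ((x⁻¹ : ℝ) : ℂ)) = csqrt (w + x) * (csqrt w)⁻¹ * ((√x)⁻¹ : ℝ) := by
    refine csqrt_eq (add_ofReal_mem_slitPlane hinv (by positivity)) ?_ ?_
    · have h1 := csqrt_mul_self hw0
      have h2 := csqrt_mul_self (slitPlane_ne_zero hwx)
      have h3 : (((√x)⁻¹ : ℝ) : ℂ) * (((√x)⁻¹ : ℝ) : ℂ) = (x : ℂ)⁻¹ := by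
        rw [← ofReal_mul, ← mul_inv, Real.mul_self_sqrt hx'.le, ofReal_inv]
      have h4 : (csqrt w)⁻¹ * (csqrt w)⁻¹ = w⁻¹ := by rw [← mul_inv, h1]
      calc _ = (csqrt (w + x) * csqrt (w + x)) * ((csqrt w)⁻¹ * (csqrt w)⁻¹) *
            ((((√x)⁻¹ : ℝ) : ℂ) * (((√x)⁻¹ : ℝ) : ℂ)) := by ring
        _ = _ := by
          rw [h2, h3, h4, ofReal_inv]; field_simp; ring
    · rw [re_mul_ofReal]
      exact mul_pos (csqrt_add_mul_re_pos hw hx'.le) (by positivity)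
  have e1 : |(-1 : ℝ)| * x ^ ((-1 : ℝ) - 1) = (x * x)⁻¹ := by
    rw [show ((-1 : ℝ) - 1) = -(2 : ℕ) by norm_num, Real.rpow_neg hx'.le, Real.rpow_natCast]
    simp [sq]
  have e2 : x ^ (-1 : ℝ) = x⁻¹ := Real.rpow_neg_one x
  have e3 : (√(x⁻¹) * √(1 + x⁻¹))⁻¹ = x * (√(1 + x))⁻¹ := by
    have : 1 + x⁻¹ = (1 + x) * x⁻¹ := by field_simp; ring
    rw [this, Real.sqrt_mul (by positivity), Real.sqrt_inv]
    have h5 : 0 < √x := Real.sqrt_pos.2 hx'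
    have h6 : 0 < √(1 + x) := Real.sqrt_pos.2 (by linarith)
    have h7 : √x ^ 2 = x := Real.sq_sqrt hx'.le
    field_simp
    rw [h7]
  rw [e1, e2, periodKernel, periodKernel, e3, hsq, real_smul]
  have h5 : 0 < √x := Real.sqrt_pos.2 hx'
  have h6 : 0 < √(1 + x) := Real.sqrt_pos.2 (by linarith)
  have h5c : ((√x : ℝ) : ℂ) ≠ 0 := ofReal_ne_zero.2 h5.ne'
  have h6c : ((√(1 + x) : ℝ) : ℂ) ≠ 0 := ofReal_ne_zero.2 h6.ne'
  have h7c : ((√x : ℝ) : ℂ) ^ 2 = x := by rw [← ofReal_pow, Real.sq_sqrt hx'.le]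
  have h8 := csqrt_ne_zero w
  have h9 := csqrt_ne_zero (w + x)
  push_cast
  field_simp
  rw [h7c]

end PeriodIntegral

/-! ### The Legendre form on the imaginary axis. -/

section PeriodRelation

open MeasureTheory Complex

theorem slitPlane_of_re_pos {z : ℂ} (h : 0 < z.re) : z ∈ slitPlane := Or.inl h

/-- A primitive eighth root of unity. -/
noncomputable def eighthRoot : ℂ := csqrt I

theorem eighthRoot_mul_self : eighthRoot * eighthRoot = I := csqrt_mul_self I_ne_zero

theorem eighthRoot_re_im : 0 < eighthRoot.re ∧ eighthRoot.im = eighthRoot.re := by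
  have h1 : (I : ℂ) ∈ slitPlane := Or.inr (by simp)
  have h2 : 0 < eighthRoot.re := csqrt_re_pos h1
  have h3 : 0 < eighthRoot.im := csqrt_im_pos (by simp)
  have h4 := congrArg re eighthRoot_mul_self
  rw [mul_re, I_re] at h4
  refine ⟨h2, ?_⟩
  nlinarith

theorem csqrt_I_mul_of_im_neg {z : ℂ} (hz : z.im < 0) :
    csqrt (I * z) = eighthRoot * csqrt z := by
  obtain ⟨h1, h2⟩ := eighthRoot_re_im
  have hs : z ∈ slitPlane := Or.inr hz.ne
  refine csqrt_eq (slitPlane_of_re_pos (by simpa using hz)) ?_ ?_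
  · linear_combination (csqrt z * csqrt z) * eighthRoot_mul_self
      + I * csqrt_mul_self (slitPlane_ne_zero hs)
  · have h3 := csqrt_re_pos hs
    have h4 := csqrt_im_neg hz
    rw [mul_re, h2]
    nlinarith

theorem csqrt_I_mul_ofReal {x : ℝ} (hx : 0 < x) :
    csqrt (I * x) = eighthRoot * (√x : ℝ) := by
  obtain ⟨h1, h2⟩ := eighthRoot_re_im
  refine csqrt_eq (Or.inr (by simpa using hx.ne')) ?_ ?_
  · have h7c : ((√x : ℝ) : ℂ) * (√x : ℝ) = x := by rw [← ofReal_mul, Real.mul_self_sqrt hx.le]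
    linear_combination ((√x : ℝ) : ℂ) * (√x : ℝ) * eighthRoot_mul_self + I * h7c
  · have := Real.sqrt_pos.2 hx
    rw [re_mul_ofReal]
    positivity

theorem csqrt_neg_I_mul_of_im_pos {z : ℂ} (hz : 0 < z.im) :
    csqrt (-(I * z)) = eighthRoot⁻¹ * csqrt z := by
  obtain ⟨h1, h2⟩ := eighthRoot_re_im
  have hs : z ∈ slitPlane := Or.inr hz.ne'
  have he : eighthRoot ≠ 0 := csqrt_ne_zero _
  refine csqrt_eq (slitPlane_of_re_pos (by simpa using hz)) ?_ ?_
  · have h5 : eighthRoot⁻¹ * eighthRoot⁻¹ = -I := by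
      rw [← mul_inv, eighthRoot_mul_self, inv_I]
    linear_combination (csqrt z * csqrt z) * h5 - I * csqrt_mul_self (slitPlane_ne_zero hs)
  · have h3 := csqrt_re_pos hs
    have h4 := csqrt_im_pos hz
    have h5 := normSq_pos.2 he
    rw [mul_re, inv_re, inv_im, h2]
    have : eighthRoot.re / normSq eighthRoot * (csqrt z).re -
        -eighthRoot.re / normSq eighthRoot * (csqrt z).im =
        eighthRoot.re / normSq eighthRoot * ((csqrt z).re + (csqrt z).im) := by ring
    rw [this]
    positivity

theorem csqrt_neg_I_mul_ofReal {x : ℝ} (hx : 0 < x) :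
    csqrt (-(I * x)) = eighthRoot⁻¹ * (√x : ℝ) := by
  obtain ⟨h1, h2⟩ := eighthRoot_re_im
  have he : eighthRoot ≠ 0 := csqrt_ne_zero _
  refine csqrt_eq (Or.inr (by simpa using hx.ne')) ?_ ?_
  · have h5 : eighthRoot⁻¹ * eighthRoot⁻¹ = -I := by
      rw [← mul_inv, eighthRoot_mul_self, inv_I]
    have h7c : ((√x : ℝ) : ℂ) * (√x : ℝ) = x := by rw [← ofReal_mul, Real.mul_self_sqrt hx.le]
    linear_combination ((√x : ℝ) : ℂ) * (√x : ℝ) * h5 - I * h7c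
  · have := Real.sqrt_pos.2 hx
    have h5 := normSq_pos.2 he
    rw [re_mul_ofReal, inv_re]
    positivity

/-- The integrand of the periods, on the right half-plane rotated to `t = -i w`. -/
noncomputable def legendreForm (l w : ℂ) : ℂ :=
  (csqrt w)⁻¹ * (csqrt (w - I))⁻¹ * (csqrt (w - I * l))⁻¹

theorem hasDerivAt_legendreForm {l w : ℂ} (h1 : w ∈ slitPlane) (h2 : w - I ∈ slitPlane)
    (h3 : w - I * l ∈ slitPlane) :
    HasDerivAt (legendreForm l)
      (legendreForm l w * (-(w⁻¹ + (w - I)⁻¹ + (w - I * l)⁻¹) / 2)) w := by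
  have d1 := (hasDerivAt_csqrt h1).fun_inv (csqrt_ne_zero _)
  have d2 := ((hasDerivAt_csqrt h2).comp_sub_const w I).fun_inv (csqrt_ne_zero _)
  have d3 := ((hasDerivAt_csqrt h3).comp_sub_const w (I * l)).fun_inv (csqrt_ne_zero _)
  have := (d1.fun_mul d2).fun_mul d3
  refine this.congr_deriv ?_
  have n1 := csqrt_ne_zero w
  have n2 := csqrt_ne_zero (w - I)
  have n3 := csqrt_ne_zero (w - I * l)
  simp only [legendreForm]
  have m1 := slitPlane_ne_zero h1
  have m2 := slitPlane_ne_zero h2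
  have m3 := slitPlane_ne_zero h3
  generalize w - I * l = C at *
  generalize w - I = B at *
  field_simp
  ring

/-- With `w = I * t`, the pieces `t < 0`, `t > 1` and `0 < t < 1` of the imaginary axis carry the
period kernels of `l`, `1 - l` and `-l / (1 - l)`. This lemma and the following ones treat one piece
each; powers of `eighthRoot` record the branches of the three roots. -/
theorem legendreForm_neg {l : ℂ} (hl : 0 < l.im) {x : ℝ} (hx : 0 < x) :
    legendreForm l (I * (-x : ℝ)) = eighthRoot ^ 3 * periodKernel l x := by
  have e1 : I * ((-x : ℝ) : ℂ) = -(I * x) := by push_cast; ring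
  have e2 : -(I * x) - I = -(I * ((1 + x : ℝ) : ℂ)) := by push_cast; ring
  have e3 : -(I * x) - I * l = -(I * (l + x)) := by ring
  rw [legendreForm, e1, e2, e3, csqrt_neg_I_mul_ofReal hx, csqrt_neg_I_mul_ofReal (by linarith),
    csqrt_neg_I_mul_of_im_pos (by simpa using hl), periodKernel]
  push_cast
  simp only [mul_inv, inv_inv]
  ring

theorem legendreForm_add_one {l : ℂ} (hl : 0 < l.im) {x : ℝ} (hx : 0 < x) :
    legendreForm l (I * (1 + x : ℝ)) = (eighthRoot⁻¹) ^ 3 * periodKernel (1 - l) x := by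
  have e2 : I * ((1 + x : ℝ) : ℂ) - I = I * x := by push_cast; ring
  have e3 : I * ((1 + x : ℝ) : ℂ) - I * l = I * (1 - l + x) := by push_cast; ring
  rw [legendreForm, e2, e3, csqrt_I_mul_ofReal hx, csqrt_I_mul_ofReal (by linarith),
    csqrt_I_mul_of_im_neg (by simpa using hl), periodKernel]
  push_cast
  simp only [mul_inv]
  ring

theorem one_sub_ne_zero_of_im_pos {l : ℂ} (hl : 0 < l.im) : 1 - l ≠ 0 := by
  intro h
  have := congrArg im h
  simp at this
  linarith

theorem im_neg_div_one_sub {l : ℂ} (hl : 0 < l.im) : (-l / (1 - l)).im < 0 := by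
  have h0 := one_sub_ne_zero_of_im_pos hl
  have h1 : -l / (1 - l) = 1 - (1 - l)⁻¹ := by field_simp; ring
  have h2 := normSq_pos.2 h0
  rw [h1, sub_im, inv_im]
  simp only [one_im, sub_im, zero_sub, neg_neg]
  have : 0 < l.im / normSq (1 - l) := by positivity
  linarith

theorem legendreForm_div_one_add {l : ℂ} (hl : 0 < l.im) {x : ℝ} (hx : 0 < x) :
    (((1 + x) ^ 2)⁻¹ : ℝ) • legendreForm l (I * (x / (1 + x) : ℝ)) =
      eighthRoot⁻¹ * (csqrt (1 - l))⁻¹ * periodKernel (-l / (1 - l)) x := by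
  have hx1 : (0 : ℝ) < 1 + x := by linarith
  have hx1c : (1 + x : ℂ) ≠ 0 := by
    have : ((1 + x : ℝ) : ℂ) ≠ 0 := ofReal_ne_zero.2 hx1.ne'
    simpa using this
  have h0 := one_sub_ne_zero_of_im_pos hl
  have e2 : I * ((x / (1 + x) : ℝ) : ℂ) - I = -(I * (((1 + x)⁻¹ : ℝ) : ℂ)) := by
    push_cast; field_simp; ring
  have e3 : I * ((x / (1 + x) : ℝ) : ℂ) - I * l = I * (((x / (1 + x) : ℝ) : ℂ) - l) := by ring
  have him : ((((x / (1 + x) : ℝ) : ℂ) - l)).im < 0 := by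
    rw [sub_im, ofReal_im]; linarith
  have hz := im_neg_div_one_sub hl
  set s := √(1 + x) with hs
  have hs0 : 0 < s := Real.sqrt_pos.2 hx1
  have hs0c : (s : ℂ) ≠ 0 := ofReal_ne_zero.2 hs0.ne'
  have hss : (s : ℂ) * s = 1 + x := by
    rw [← ofReal_mul, Real.mul_self_sqrt hx1.le]; push_cast; rfl
  set A := csqrt (1 - l) with hA
  set B := csqrt (-l / (1 - l) + x) with hB
  have hA0 : A ≠ 0 := csqrt_ne_zero _
  have hB0 : B ≠ 0 := csqrt_ne_zero _
  have hAA : A * A = 1 - l := csqrt_mul_self h0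
  have hb : (-l / (1 - l) + (x : ℂ)).im < 0 := by simpa using hz
  have hBB : B * B = -l / (1 - l) + x :=
    csqrt_mul_self (slitPlane_ne_zero (Or.inr hb.ne))
  have ha : (1 - l).im < 0 := by simpa using hl
  have sA := csqrt_re_pos (Or.inr ha.ne : 1 - l ∈ slitPlane)
  have sA' := csqrt_im_neg ha
  have sB := csqrt_re_pos (Or.inr hb.ne : -l / (1 - l) + (x : ℂ) ∈ slitPlane)
  have sB' := csqrt_im_neg hb
  have key : csqrt (((x / (1 + x) : ℝ) : ℂ) - l) = A * B * ((s⁻¹ : ℝ) : ℂ) := by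
    have hsq : A * B * ((s⁻¹ : ℝ) : ℂ) * (A * B * ((s⁻¹ : ℝ) : ℂ)) = ((x / (1 + x) : ℝ) : ℂ) - l := by
      have : A * B * ((s⁻¹ : ℝ) : ℂ) * (A * B * ((s⁻¹ : ℝ) : ℂ)) =
        (A * A) * (B * B) * ((s : ℂ) * s)⁻¹ := by push_cast; rw [mul_inv]; ring
      rw [this, hAA, hBB, hss]
      push_cast
      field_simp
      ring
    refine csqrt_eq (Or.inr him.ne) hsq ?_
    have h4 := congrArg im hsq
    -- `A` and `B` lie in the fourth quadrant, so the product has negative imaginary part. Its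
    -- square does too, which forces a positive real part.
    have h5 : (A * B * ((s⁻¹ : ℝ) : ℂ)).im < 0 := by
      rw [im_mul_ofReal, mul_im]
      refine mul_neg_of_neg_of_pos ?_ (by positivity)
      rw [← hA] at sA sA'
      rw [← hB] at sB sB'
      nlinarith
    rw [mul_im] at h4
    by_contra! h6
    nlinarith
  rw [legendreForm, e2, e3, csqrt_I_mul_ofReal (by positivity), csqrt_neg_I_mul_ofReal (by positivity),
    csqrt_I_mul_of_im_neg him, key, periodKernel, Real.sqrt_inv, Real.sqrt_div hx.le, ← hs, ← hB,
    real_smul]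
  have he : eighthRoot ≠ 0 := csqrt_ne_zero _
  have hxs : ((√x : ℝ) : ℂ) ≠ 0 := ofReal_ne_zero.2 (Real.sqrt_pos.2 hx).ne'
  push_cast
  rw [← hss]
  field_simp

end PeriodRelation

/-! ### The contour shift and the three-term relation. -/

section PeriodShift

open MeasureTheory Complex

/-- The branch points `0`, `I` and `I * l` have nonpositive real part, so moving to the right
increases the distance to each. The values on the axis therefore dominate the integrand on all
parallel lines. -/
theorem norm_legendreForm_le {l : ℂ} (hl : 0 < l.im) {t e : ℝ} (h0 : t ≠ 0) (h1 : t ≠ 1)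
    (he : 0 ≤ e) : ‖legendreForm l (e + I * t)‖ ≤ ‖legendreForm l (I * t)‖ := by
  have key : ∀ z : ℂ, z ≠ 0 → 0 ≤ z.re → ‖(csqrt (e + z))⁻¹‖ ≤ ‖(csqrt z)⁻¹‖ := by
    intro z hz hre
    have h : ‖z‖ ≤ ‖(e : ℂ) + z‖ := by
      rw [norm_def, norm_def]
      refine Real.sqrt_le_sqrt ?_
      rw [normSq_apply, normSq_apply, add_re, add_im, ofReal_re, ofReal_im]
      nlinarith [mul_nonneg he hre]
    have hz' : (e : ℂ) + z ≠ 0 := by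
      rw [← norm_pos_iff]
      exact (norm_pos_iff.2 hz).trans_le h
    rw [norm_inv, norm_inv, norm_csqrt hz, norm_csqrt hz']
    exact inv_anti₀ (Real.sqrt_pos.2 (norm_pos_iff.2 hz)) (Real.sqrt_le_sqrt h)
  have n1 : I * (t : ℂ) ≠ 0 := mul_ne_zero I_ne_zero (ofReal_ne_zero.2 h0)
  have n2 : I * (t : ℂ) - I ≠ 0 := by
    rw [show I * (t : ℂ) - I = I * ((t - 1 : ℝ) : ℂ) by push_cast; ring]
    exact mul_ne_zero I_ne_zero (ofReal_ne_zero.2 (sub_ne_zero.2 h1))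
  have n3 : 0 < (I * (t : ℂ) - I * l).re := by simpa using hl
  have n3' : I * (t : ℂ) - I * l ≠ 0 := slitPlane_ne_zero (slitPlane_of_re_pos n3)
  rw [legendreForm, legendreForm, norm_mul, norm_mul, norm_mul, norm_mul, add_sub_assoc,
    add_sub_assoc]
  gcongr
  · exact key _ n1 (by simp)
  · exact key _ n2 (by simp)
  · exact key _ n3' n3.le

theorem integrableOn_and_integral_of_image {g : ℝ → ℂ} {φ φ' : ℝ → ℝ} {z c : ℂ}
    (hφ : ∀ x ∈ Ioi (0 : ℝ), HasDerivAt φ (φ' x) x) (hinj : InjOn φ (Ioi 0))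
    (hz : z ∈ slitPlane) (h : ∀ x ∈ Ioi (0 : ℝ), |φ' x| • g (φ x) = c * periodKernel z x) :
    IntegrableOn g (φ '' Ioi 0) ∧ ∫ t in φ '' Ioi 0, g t = c * periodIntegral z := by
  have hd := fun x hx => (hφ x hx).hasDerivWithinAt (s := Ioi 0)
  constructor
  · rw [integrableOn_image_iff_integrableOn_abs_deriv_smul measurableSet_Ioi hd hinj]
    exact IntegrableOn.congr_fun ((integrableOn_periodKernel hz).const_mul c)
      (fun x hx => (h x hx).symm) measurableSet_Ioi
  · rw [integral_image_eq_integral_abs_deriv_smul measurableSet_Ioi hd hinj,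
      setIntegral_congr_fun measurableSet_Ioi h, periodIntegral, integral_const_mul]

theorem integrable_legendreForm_zero {l : ℂ} (hl : 0 < l.im) :
    Integrable (fun t : ℝ => legendreForm l (I * t)) ∧
      ∫ t : ℝ, legendreForm l (I * t) = eighthRoot ^ 3 * periodIntegral l +
        (eighthRoot⁻¹ * (csqrt (1 - l))⁻¹ * periodIntegral (-l / (1 - l)) +
          (eighthRoot⁻¹) ^ 3 * periodIntegral (1 - l)) := by
  obtain ⟨a1, a2⟩ := integrableOn_and_integral_of_image (g := fun t : ℝ => legendreForm l (I * t))
    (φ := fun x => -x) (φ' := fun _ => -1) (z := l) (c := eighthRoot ^ 3)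
    (fun x _ => hasDerivAt_neg x) neg_injective.injOn (Or.inr hl.ne')
    (fun x hx => by simpa using legendreForm_neg hl hx)
  obtain ⟨b1, b2⟩ := integrableOn_and_integral_of_image (g := fun t : ℝ => legendreForm l (I * t))
    (φ := fun x => 1 + x) (φ' := fun _ => 1) (z := 1 - l) (c := (eighthRoot⁻¹) ^ 3)
    (fun x _ => (hasDerivAt_id x).const_add 1) (add_right_injective 1).injOn
    (Or.inr (by simpa using hl.ne'))
    (fun x hx => by simpa using legendreForm_add_one hl hx)
  obtain ⟨c1, c2⟩ := integrableOn_and_integral_of_image (g := fun t : ℝ => legendreForm l (I * t))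
    (φ := fun x => x / (1 + x)) (φ' := fun x => ((1 + x) ^ 2)⁻¹) (z := -l / (1 - l))
    (c := eighthRoot⁻¹ * (csqrt (1 - l))⁻¹)
    (fun x hx => by
      have hx1 : (0 : ℝ) < x := hx
      have := (hasDerivAt_id x).fun_div ((hasDerivAt_id x).const_add 1)
        (by simp only [id]; positivity : (1 : ℝ) + id x ≠ 0)
      refine this.congr_deriv ?_
      simp only [id]
      field_simp
      ring)
    (fun x hx y hy hxy => by
      have hx1 : (0 : ℝ) < x := hx
      have hy1 : (0 : ℝ) < y := hy
      rw [div_eq_div_iff (by positivity) (by positivity)] at hxy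
      linarith)
    (Or.inr (im_neg_div_one_sub hl).ne)
    (fun x hx => by
      rw [abs_of_nonneg (by positivity)]
      exact legendreForm_div_one_add hl hx)
  have ia : (fun x : ℝ => -x) '' Ioi 0 = Iio 0 := by simp
  have ib : (fun x : ℝ => 1 + x) '' Ioi 0 = Ioi 1 := by simp
  have ic : (fun x : ℝ => x / (1 + x)) '' Ioi 0 = Ioo 0 1 := by
    ext y
    constructor
    · rintro ⟨x, hx, rfl⟩
      have hx1 : (0 : ℝ) < x := hx
      exact ⟨by positivity, by rw [div_lt_one (by positivity)]; linarith⟩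
    · rintro ⟨h0, h1⟩
      have h2 : 0 < 1 - y := by linarith
      refine ⟨y / (1 - y), div_pos h0 h2, ?_⟩
      simp only
      field_simp
      ring
  rw [ia] at a1 a2
  rw [ib] at b1 b2
  rw [ic] at c1 c2
  rw [← integrableOn_Iic_iff_integrableOn_Iio] at a1
  rw [← integral_Iic_eq_integral_Iio] at a2
  rw [← integrableOn_Ioc_iff_integrableOn_Ioo] at c1
  rw [← integral_Ioc_eq_integral_Ioo] at c2
  have d1 := c1.union b1
  rw [Ioc_union_Ioi_eq_Ioi zero_le_one] at d1
  have d2 := a1.union d1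
  rw [Iic_union_Ioi, integrableOn_univ] at d2
  refine ⟨d2, ?_⟩
  rw [← setIntegral_univ, ← Iic_union_Ioi (a := (0 : ℝ)),
    setIntegral_union (Iic_disjoint_Ioi le_rfl) measurableSet_Ioi a1 d1,
    ← Ioc_union_Ioi_eq_Ioi (zero_le_one' ℝ),
    setIntegral_union (Ioc_disjoint_Ioi le_rfl) measurableSet_Ioi c1 b1, a2, b2, c2]

theorem ae_ne_zero_ne_one : ∀ᵐ t : ℝ, t ≠ 0 ∧ t ≠ 1 := by
  have h0 : ∀ a : ℝ, ∀ᵐ t : ℝ, t ≠ a := fun a => by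
    simp [ae_iff]
  filter_upwards [h0 0, h0 1] with t h h' using ⟨h, h'⟩

theorem legendreForm_slitPlane {l : ℂ} (hl : 0 < l.im) {t e : ℝ}
    (h : 0 < e ∨ 0 ≤ e ∧ t ≠ 0 ∧ t ≠ 1) :
    (e + I * t : ℂ) ∈ slitPlane ∧ (e + I * t - I : ℂ) ∈ slitPlane ∧
      (e + I * t - I * l : ℂ) ∈ slitPlane := by
  rcases h with h | ⟨h, h0, h1⟩
  · refine ⟨Or.inl (by simpa using h), Or.inl (by simpa using h), Or.inl ?_⟩
    simp; linarith
  · refine ⟨Or.inr (by simpa using h0), Or.inr ?_, Or.inl ?_⟩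
    · simpa using sub_ne_zero.2 h1
    · simp; linarith

theorem integrable_legendreForm {l : ℂ} (hl : 0 < l.im) {e : ℝ} (he : 0 < e) :
    Integrable (fun t : ℝ => legendreForm l (e + I * t)) := by
  refine Integrable.mono (integrable_legendreForm_zero hl).1 ?_ ?_
  · refine Continuous.aestronglyMeasurable (continuous_iff_continuousAt.2 fun t => ?_)
    obtain ⟨h1, h2, h3⟩ := legendreForm_slitPlane hl (t := t) (Or.inl he)
    exact ContinuousAt.comp (f := fun t : ℝ => (e + I * t : ℂ)) (g := legendreForm l)
      (hasDerivAt_legendreForm h1 h2 h3).continuousAt (by fun_prop)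
  · filter_upwards [ae_ne_zero_ne_one] with t ht
    exact norm_legendreForm_le hl ht.1 ht.2 he.le

theorem norm_legendre_factor_le {l : ℂ} (hl : 0 < l.im) {t e : ℝ} (he : 0 < e) :
    ‖(-((e + I * t : ℂ)⁻¹ + (e + I * t - I : ℂ)⁻¹ + (e + I * t - I * l : ℂ)⁻¹) / 2)‖
      ≤ 3 / 2 * e⁻¹ := by
  have key : ∀ w : ℂ, e ≤ w.re → ‖w⁻¹‖ ≤ e⁻¹ := fun w hw => by
    rw [norm_inv]
    exact inv_anti₀ he (hw.trans (re_le_norm w))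
  rw [norm_div, norm_neg, show ‖(2 : ℂ)‖ = 2 by simp]
  have h1 := key (e + I * t : ℂ) (by simp)
  have h2 := key (e + I * t - I : ℂ) (by simp)
  have h3 := key (e + I * t - I * l : ℂ) (by simp; linarith)
  have := norm_add₃_le (a := (e + I * t : ℂ)⁻¹) (b := (e + I * t - I : ℂ)⁻¹)
    (c := (e + I * t - I * l : ℂ)⁻¹)
  linarith

theorem hasDerivAt_integral_legendreForm {l : ℂ} (hl : 0 < l.im) {e : ℝ} (he : 0 < e) :
    HasDerivAt (fun e : ℝ => ∫ t : ℝ, legendreForm l (e + I * t)) 0 e := by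
  set D : ℂ → ℂ := fun w => legendreForm l w * (-(w⁻¹ + (w - I)⁻¹ + (w - I * l)⁻¹) / 2) with hD
  have hderiv : ∀ e' : ℝ, 0 < e' → ∀ t : ℝ, HasDerivAt (legendreForm l) (D (e' + I * t))
      (e' + I * t) := fun e' he' t => by
    obtain ⟨h1, h2, h3⟩ := legendreForm_slitPlane hl (t := t) (Or.inl he')
    exact hasDerivAt_legendreForm h1 h2 h3
  have hmeas : AEStronglyMeasurable (fun t : ℝ => D (e + I * t)) := by
    refine Continuous.aestronglyMeasurable (continuous_iff_continuousAt.2 fun t => ?_)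
    obtain ⟨h1, h2, h3⟩ := legendreForm_slitPlane hl (t := t) (Or.inl he)
    have := slitPlane_ne_zero h1
    have := slitPlane_ne_zero h2
    have := slitPlane_ne_zero h3
    have hc : ContinuousAt D (e + I * t) := by
      refine (hderiv e he t).continuousAt.mul ?_
      fun_prop (disch := assumption)
    exact ContinuousAt.comp (f := fun t : ℝ => (e + I * t : ℂ)) (g := D) hc (by fun_prop)
  have hbound : ∀ e' : ℝ, e / 2 < e' → ∀ t : ℝ, t ≠ 0 ∧ t ≠ 1 →
      ‖D (e' + I * t)‖ ≤ ‖legendreForm l (I * t)‖ * (3 / 2 * (e / 2)⁻¹) := by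
    intro e' he' t ht
    have he0 : 0 < e' := by linarith
    rw [hD, norm_mul]
    refine mul_le_mul (norm_legendreForm_le hl ht.1 ht.2 he0.le)
      ((norm_legendre_factor_le hl he0).trans ?_) (norm_nonneg _) (norm_nonneg _)
    have : e'⁻¹ ≤ (e / 2)⁻¹ := inv_anti₀ (by linarith) he'.le
    linarith
  have hint := (integrable_legendreForm_zero hl).1.norm.mul_const (3 / 2 * (e / 2)⁻¹)
  have hDint : Integrable (fun t : ℝ => D (e + I * t)) := by
    refine hint.mono' hmeas ?_
    filter_upwards [ae_ne_zero_ne_one] with t ht using hbound e (by linarith) t ht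
  -- The integrand is the `t`-derivative of an integrable function. This is Cauchy's theorem in
  -- infinitesimal form: the integral over a vertical line does not depend on the line.
  have hzero : ∫ t : ℝ, D (e + I * t) * I = 0 := by
    refine integral_eq_zero_of_hasDerivAt_of_integrable (f := fun t : ℝ => legendreForm l (e + I * t))
      (fun t => ?_) (hDint.mul_const I) (integrable_legendreForm hl he)
    have h2 : HasDerivAt (fun t : ℝ => (e + I * t : ℂ)) I t := by
      simpa using ((hasDerivAt_id t).ofReal_comp.const_mul I).const_add (e : ℂ)
    exact (hderiv e he t).comp t h2
  rw [integral_mul_const] at hzero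
  have hzero' : ∫ t : ℝ, D (e + I * t) = 0 := (mul_eq_zero.1 hzero).resolve_right I_ne_zero
  rw [← hzero']
  refine (hasDerivAt_integral_of_dominated_loc_of_deriv_le
    (F := fun (e : ℝ) (t : ℝ) => legendreForm l (e + I * t))
    (F' := fun (e : ℝ) (t : ℝ) => D (e + I * t))
    (s := Ioi (e / 2)) (Ioi_mem_nhds (half_lt_self he)) ?_
    (integrable_legendreForm hl he) hmeas (bound := fun t : ℝ => ‖legendreForm l (I * t)‖ * (3 / 2 * (e / 2)⁻¹))
    ?_ hint ?_).2
  · filter_upwards [Ioi_mem_nhds he] with e' he'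
    exact (integrable_legendreForm hl he').aestronglyMeasurable
  · filter_upwards [ae_ne_zero_ne_one] with t ht e' he' using hbound e' he' t ht
  · refine ae_of_all _ fun t e' he' => ?_
    have he0 : 0 < e' := by have : e / 2 < e' := he'; linarith
    have h2 : HasDerivAt (fun e : ℝ => (e + I * t : ℂ)) 1 e' := by
      simpa using (hasDerivAt_id e').ofReal_comp.add_const (I * t : ℂ)
    have h4 := (hderiv e' he0 t).comp e' h2
    rw [mul_one] at h4
    exact h4

theorem integral_legendreForm_zero {l : ℂ} (hl : 0 < l.im) :
    ∫ t : ℝ, legendreForm l (I * t) = 0 := by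
  set J : ℝ → ℂ := fun e => ∫ t : ℝ, legendreForm l (e + I * t) with hJ
  have hconst : ∀ e ∈ Ioi (0 : ℝ), J e = J 1 := fun e he =>
    (convex_Ioi (0 : ℝ)).is_const_of_fderivWithin_eq_zero (𝕜 := ℝ) (f := J)
      (fun x hx => (hasDerivAt_integral_legendreForm hl hx).differentiableAt.differentiableWithinAt)
      (fun x hx => by
        have h1 := (hasDerivAt_integral_legendreForm hl hx).hasFDerivAt.hasFDerivWithinAt
          (s := Ioi 0)
        rw [h1.fderivWithin ((isOpen_Ioi).uniqueDiffWithinAt hx)]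
        ext; simp) he (mem_Ioi.2 one_pos)
  -- The form decays like `e ^ (-3/2)` pointwise. So the constant value of `J` is zero, and
  -- dominated convergence as `e → 0` carries this to the axis.
  have hbig : Tendsto J atTop (𝓝 0) := by
    have : Tendsto J atTop (𝓝 (∫ _ : ℝ, (0 : ℂ))) := by
      refine tendsto_integral_filter_of_dominated_convergence
        (fun t => ‖legendreForm l (I * t)‖) ?_ ?_ (integrable_legendreForm_zero hl).1.norm ?_
      · filter_upwards [eventually_gt_atTop 0] with e he
        exact (integrable_legendreForm hl he).aestronglyMeasurable
      · filter_upwards [eventually_gt_atTop 0] with e he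
        filter_upwards [ae_ne_zero_ne_one] with t ht
          using norm_legendreForm_le hl ht.1 ht.2 he.le
      · refine ae_of_all _ fun t => ?_
        refine squeeze_zero_norm' (a := fun e : ℝ => (√e)⁻¹ * (√e)⁻¹ * (√e)⁻¹) ?_ ?_
        · filter_upwards [eventually_gt_atTop 0] with e he
          have key : ∀ w : ℂ, e ≤ w.re → ‖(csqrt w)⁻¹‖ ≤ (√e)⁻¹ := fun w hw => by
            have hw0 : w ≠ 0 := slitPlane_ne_zero (slitPlane_of_re_pos (he.trans_le hw))
            rw [norm_inv, norm_csqrt hw0]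
            exact inv_anti₀ (Real.sqrt_pos.2 he) (Real.sqrt_le_sqrt (hw.trans (re_le_norm w)))
          rw [legendreForm, norm_mul, norm_mul]
          gcongr
          · exact key _ (by simp)
          · exact key _ (by simp)
          · exact key _ (by simp; linarith)
        · have h1 : Tendsto (fun e : ℝ => (√e)⁻¹) atTop (𝓝 0) :=
            tendsto_inv_atTop_zero.comp Real.tendsto_sqrt_atTop
          simpa using (h1.mul h1).mul h1
    simpa using this
  have hJ1 : J 1 = 0 := by
    refine tendsto_nhds_unique (tendsto_const_nhds.congr' ?_) hbig
    filter_upwards [eventually_gt_atTop 0] with e he using (hconst e he).symm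
  have hsmall : Tendsto J (𝓝[>] 0) (𝓝 (∫ t : ℝ, legendreForm l (I * t))) := by
    refine tendsto_integral_filter_of_dominated_convergence
      (fun t => ‖legendreForm l (I * t)‖) ?_ ?_ (integrable_legendreForm_zero hl).1.norm ?_
    · filter_upwards [self_mem_nhdsWithin] with e he
      exact (integrable_legendreForm hl he).aestronglyMeasurable
    · filter_upwards [self_mem_nhdsWithin] with e he
      filter_upwards [ae_ne_zero_ne_one] with t ht
        using norm_legendreForm_le hl ht.1 ht.2 (le_of_lt he)
    · filter_upwards [ae_ne_zero_ne_one] with t ht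
      obtain ⟨h1, h2, h3⟩ := legendreForm_slitPlane hl (t := t) (e := 0) (Or.inr ⟨le_rfl, ht⟩)
      have hc := (hasDerivAt_legendreForm h1 h2 h3).continuousAt
      have : ContinuousAt (fun e : ℝ => legendreForm l (e + I * t)) 0 :=
        ContinuousAt.comp (f := fun e : ℝ => (e + I * t : ℂ)) (g := legendreForm l) hc (by fun_prop)
      have h5 := this.tendsto
      simp only [ofReal_zero, zero_add] at h5
      exact h5.mono_left nhdsWithin_le_nhds
  refine (tendsto_nhds_unique (tendsto_const_nhds.congr' ?_) hsmall).symm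
  filter_upwards [self_mem_nhdsWithin] with e he
  rw [hconst e he, hJ1]

/-- The three-term relation between the periods. -/
theorem periodIntegral_div_one_sub {l : ℂ} (hl : 0 < l.im) :
    periodIntegral (-l / (1 - l)) =
      csqrt (1 - l) * (periodIntegral l + I * periodIntegral (1 - l)) := by
  have h := (integrable_legendreForm_zero hl).2
  rw [integral_legendreForm_zero hl] at h
  have he : eighthRoot ≠ 0 := csqrt_ne_zero _
  have hs := csqrt_ne_zero (1 - l)
  have h2 : eighthRoot * eighthRoot = I := eighthRoot_mul_self
  have h3 : eighthRoot⁻¹ * eighthRoot⁻¹ = -I := by rw [← mul_inv, h2, inv_I]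
  have h4 : eighthRoot * eighthRoot⁻¹ = 1 := mul_inv_cancel₀ he
  have h5 : csqrt (1 - l) * (csqrt (1 - l))⁻¹ = 1 := mul_inv_cancel₀ hs
  have h6 : eighthRoot * eighthRoot ^ 3 = -1 := by
    rw [show eighthRoot * eighthRoot ^ 3 = (eighthRoot * eighthRoot) * (eighthRoot * eighthRoot) by
      ring, h2, I_mul_I]
  have h7 : eighthRoot * eighthRoot⁻¹ ^ 3 = -I := by
    rw [← h3, show eighthRoot * eighthRoot⁻¹ ^ 3 = (eighthRoot * eighthRoot⁻¹) *
      (eighthRoot⁻¹ * eighthRoot⁻¹) by ring, h4, one_mul]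
  have h8 : 0 = eighthRoot * eighthRoot ^ 3 * periodIntegral l +
      ((eighthRoot * eighthRoot⁻¹) * (csqrt (1 - l))⁻¹ * periodIntegral (-l / (1 - l)) +
        eighthRoot * eighthRoot⁻¹ ^ 3 * periodIntegral (1 - l)) := by
    linear_combination eighthRoot * h
  rw [h6, h4, h7] at h8
  linear_combination (-csqrt (1 - l)) * h8 - periodIntegral (-l / (1 - l)) * h5

end PeriodShift

/-! ### The period ratio maps the doubly slit plane to the upper half-plane. -/

section PeriodRatio

open Complex

/-- The plane slit along `(-∞, 0]` and `[1, ∞)`. -/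
def doubleSlitPlane : Set ℂ := {l | l ∈ slitPlane ∧ 1 - l ∈ slitPlane}

/-- The ratio of the periods of the Legendre curve. -/
noncomputable def periodRatio (l : ℂ) : ℂ := I * periodIntegral l / periodIntegral (1 - l)

theorem mem_doubleSlitPlane_of_im_ne_zero {l : ℂ} (h : l.im ≠ 0) : l ∈ doubleSlitPlane :=
  ⟨Or.inr h, Or.inr (by simpa using h)⟩

theorem isOpen_doubleSlitPlane : IsOpen doubleSlitPlane :=
  isOpen_slitPlane.inter (isOpen_slitPlane.preimage (continuous_const.sub continuous_id))

theorem isPreconnected_doubleSlitPlane : IsPreconnected doubleSlitPlane := by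
  have h : StarConvex ℝ (1 / 2 : ℂ) doubleSlitPlane := by
    rintro l ⟨h1, h2⟩ a b ha hb hab
    have key : ∀ z : ℂ, z ∈ slitPlane → (a * (1 / 2) + b * z : ℂ) ∈ slitPlane := by
      intro z hz
      rw [mem_slitPlane_iff] at hz ⊢
      have e1 : ((a : ℂ) * (1 / 2) + b * z).re = a / 2 + b * z.re := by
        rw [add_re, re_ofReal_mul, re_ofReal_mul]; norm_num; ring
      have e2 : ((a : ℂ) * (1 / 2) + b * z).im = b * z.im := by
        rw [add_im, im_ofReal_mul, im_ofReal_mul]; norm_num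
      rw [e1, e2]
      rcases hb.eq_or_lt with h0 | h0
      · left; subst h0; linarith
      · rcases hz with hz | hz
        · left; have := mul_pos h0 hz; linarith
        · right; exact mul_ne_zero h0.ne' hz
    refine ⟨?_, ?_⟩
    · simpa [real_smul] using key l h1
    · have := key (1 - l) h2
      convert this using 1
      have habc : (a : ℂ) + b = 1 := by exact_mod_cast hab
      simp only [real_smul]
      linear_combination -habc
  have hne : (1 / 2 : ℂ) ∈ doubleSlitPlane := ⟨Or.inl (by norm_num), Or.inl (by norm_num)⟩
  exact (h.isPathConnected hne).isConnected.isPreconnected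

theorem periodIntegral_ne_zero {z : ℂ} (hz : z ∈ slitPlane) : periodIntegral z ≠ 0 := fun h => by
  have := periodIntegral_re_pos hz
  rw [h] at this
  simp at this

theorem analyticAt_periodIntegral {z : ℂ} (hz : z ∈ slitPlane) :
    AnalyticAt ℂ periodIntegral z :=
  analyticAt_iff_eventually_differentiableAt.2 <| by
    filter_upwards [isOpen_slitPlane.mem_nhds hz] with w hw using differentiableAt_periodIntegral hw

theorem analyticAt_periodRatio {l : ℂ} (hl : l ∈ doubleSlitPlane) :
    AnalyticAt ℂ periodRatio l := by
  have h1 := analyticAt_periodIntegral hl.1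
  have h2 : AnalyticAt ℂ (fun l => periodIntegral (1 - l)) l :=
    AnalyticAt.fun_comp (f := fun l : ℂ => 1 - l) (analyticAt_periodIntegral hl.2)
      (analyticAt_const.sub analyticAt_id)
  exact (analyticAt_const.mul h1).div h2 (periodIntegral_ne_zero hl.2)

theorem periodRatio_ne_zero {l : ℂ} (hl : l ∈ doubleSlitPlane) : periodRatio l ≠ 0 :=
  div_ne_zero (mul_ne_zero I_ne_zero (periodIntegral_ne_zero hl.1)) (periodIntegral_ne_zero hl.2)

theorem periodRatio_conj {l : ℂ} (hl : l ∈ doubleSlitPlane) :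
    periodRatio ((starRingEnd ℂ) l) = -(starRingEnd ℂ) (periodRatio l) := by
  have h : 1 - (starRingEnd ℂ) l = (starRingEnd ℂ) (1 - l) := by simp
  rw [periodRatio, periodRatio, h, periodIntegral_conj hl.1, periodIntegral_conj hl.2]
  simp only [map_div₀, map_mul, conj_I]
  ring

theorem im_inv_one_sub_pos {l : ℂ} (hl : 0 < l.im) : 0 < ((1 - l)⁻¹).im := by
  have h2 := normSq_pos.2 (one_sub_ne_zero_of_im_pos hl)
  rw [inv_im]
  simp only [one_im, sub_im, zero_sub, neg_neg]
  positivity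

/-- The three-term relation gives the denominator of the ratio at `1 / (1 - l)`, the inversion
formula its numerator. The product form also yields `periodRatio l ≠ 1`. -/
theorem periodRatio_inv_one_sub_aux {l : ℂ} (hl : 0 < l.im) :
    periodRatio (1 - l)⁻¹ * (1 - periodRatio l) = 1 := by
  have hz := periodIntegral_ne_zero (Or.inr (im_neg_div_one_sub hl).ne : -l / (1 - l) ∈ slitPlane)
  have h1 := periodIntegral_div_one_sub hl
  have hs : 1 - l ∈ slitPlane := Or.inr (by simpa using hl.ne')
  have h2 := periodIntegral_inv hs
  have h3 : 1 - (1 - l)⁻¹ = -l / (1 - l) := by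
    have := one_sub_ne_zero_of_im_pos hl
    field_simp; ring
  have h4 := csqrt_ne_zero (1 - l)
  have h5 := periodIntegral_ne_zero hs
  rw [h1] at hz
  have h6 := right_ne_zero_of_mul hz
  rw [periodRatio, periodRatio, h3, h1, h2]
  field_simp
  linear_combination -periodIntegral l * I_sq

theorem periodRatio_inv_one_sub {l : ℂ} (hl : 0 < l.im) :
    periodRatio (1 - l)⁻¹ = 1 / (1 - periodRatio l) :=
  eq_div_of_mul_eq (right_ne_zero_of_mul_eq_one (periodRatio_inv_one_sub_aux hl))
    (periodRatio_inv_one_sub_aux hl)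

theorem periodRatio_inv_one_sub_of_im_neg {l : ℂ} (hl : l.im < 0) :
    periodRatio (1 - l)⁻¹ = -1 / (1 + periodRatio l) := by
  have h0 : 0 < ((starRingEnd ℂ) l).im := by simpa using hl
  have h1 := periodRatio_inv_one_sub h0
  have h2 : (1 - (starRingEnd ℂ) l)⁻¹ = (starRingEnd ℂ) ((1 - l)⁻¹) := by simp
  have h3 : ((1 - (starRingEnd ℂ) l)⁻¹) ∈ doubleSlitPlane :=
    mem_doubleSlitPlane_of_im_ne_zero (im_inv_one_sub_pos h0).ne'
  have h4 : (1 - l)⁻¹ = (starRingEnd ℂ) ((1 - (starRingEnd ℂ) l)⁻¹) := by simp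
  rw [h4, periodRatio_conj h3, h1, periodRatio_conj (mem_doubleSlitPlane_of_im_ne_zero hl.ne)]
  simp only [map_div₀, map_add, map_one, conj_conj, sub_neg_eq_add]
  ring

theorem periodRatio_re_pos {l : ℂ} (hl : 0 < l.im) : 0 < (periodRatio l).re := by
  have hs : 1 - l ∈ slitPlane := Or.inr (by simpa using hl.ne')
  have a1 := periodIntegral_re_pos (Or.inr hl.ne' : l ∈ slitPlane)
  have a2 := periodIntegral_im_neg hl
  have b1 := periodIntegral_re_pos hs
  have b2 : 0 < (periodIntegral (1 - l)).im := by
    have h0 : 0 < ((starRingEnd ℂ) (1 - l)).im := by simpa using hl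
    have := periodIntegral_im_neg h0
    rw [periodIntegral_conj hs] at this
    simpa using this
  have h := normSq_pos.2 (periodIntegral_ne_zero hs)
  rw [periodRatio, div_re, I_mul_re, I_mul_im, ← add_div]
  apply div_pos _ h
  nlinarith

/-- A real value `r` would make `r`, `1 / (1 - r)` and `1 - 1 / r` all positive, being real parts of
the ratio at points of the upper half-plane. Their product is `-1`. -/
theorem periodRatio_im_ne_zero_of_im_pos {l : ℂ} (hl : 0 < l.im) : (periodRatio l).im ≠ 0 := by
  intro h0
  have h1 := periodRatio_re_pos hl
  have hl' := im_inv_one_sub_pos hl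
  have h2 := periodRatio_re_pos hl'
  have h3 := periodRatio_re_pos (im_inv_one_sub_pos hl')
  rw [periodRatio_inv_one_sub hl', periodRatio_inv_one_sub hl] at h3
  rw [periodRatio_inv_one_sub hl] at h2
  obtain ⟨r, hr⟩ : ∃ r : ℝ, periodRatio l = r := ⟨_, (ext rfl (by simpa using h0) :
    periodRatio l = ((periodRatio l).re : ℂ))⟩
  rw [hr] at h1 h2 h3
  norm_cast at h1 h2 h3
  have h4 : 0 < 1 - r := by simpa using h2
  have h5 : 1 - 1 / (1 - r) = -r / (1 - r) := by field_simp; ring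
  have h6 : 0 < -r / (1 - r) := by
    rw [← h5]; simpa using h3
  have : -r / (1 - r) < 0 := div_neg_of_neg_of_pos (by linarith) h4
  linarith

theorem periodRatio_im_ne_zero {l : ℂ} (hl : l ∈ doubleSlitPlane) : (periodRatio l).im ≠ 0 := by
  rcases lt_trichotomy l.im 0 with h | h | h
  · have h0 : 0 < ((starRingEnd ℂ) l).im := by simpa using h
    have := periodRatio_im_ne_zero_of_im_pos h0
    rw [periodRatio_conj hl] at this
    simpa using this
  · have hc : (starRingEnd ℂ) l = l := conj_eq_iff_im.2 h
    have h1 := periodRatio_conj hl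
    rw [hc] at h1
    intro h2
    have h3 : (starRingEnd ℂ) (periodRatio l) = periodRatio l := conj_eq_iff_im.2 h2
    rw [h3] at h1
    have : periodRatio l = 0 := by linear_combination h1 / 2
    exact periodRatio_ne_zero hl this
  · exact periodRatio_im_ne_zero_of_im_pos h

theorem half_mem_doubleSlitPlane : (1 / 2 : ℂ) ∈ doubleSlitPlane :=
  ⟨Or.inl (by norm_num), Or.inl (by norm_num)⟩

theorem periodRatio_half : periodRatio (1 / 2) = I := by
  have h := periodIntegral_ne_zero half_mem_doubleSlitPlane.1
  rw [periodRatio, show (1 - 1 / 2 : ℂ) = 1 / 2 by norm_num, mul_div_assoc, div_self h, mul_one]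

/-- The imaginary part has no zero on a connected set and is 1 at `1 / 2`. -/
theorem periodRatio_im_pos {l : ℂ} (hl : l ∈ doubleSlitPlane) : 0 < (periodRatio l).im := by
  by_contra! h
  have hc : ContinuousOn (fun l => (periodRatio l).im) doubleSlitPlane := fun z hz =>
    (continuous_im.continuousAt.comp (analyticAt_periodRatio hz).continuousAt).continuousWithinAt
  obtain ⟨z, hz, hz0⟩ := isPreconnected_doubleSlitPlane.intermediate_value hl
    half_mem_doubleSlitPlane hc (show (0 : ℝ) ∈ Icc _ _ by
      refine ⟨h, ?_⟩
      simp only [periodRatio_half, I_im]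
      norm_num)
  exact periodRatio_im_ne_zero hz hz0

/-- The ratio is not constant: it is `I` at `1 / 2` but has positive real part at `I`. -/
theorem periodRatio_eventually_ne {l : ℂ} (hl : l ∈ doubleSlitPlane) :
    ∀ᶠ w in 𝓝[≠] l, periodRatio w ≠ periodRatio l := by
  refine ((analyticAt_periodRatio hl).eventually_eq_or_eventually_ne
    (analyticAt_const (v := periodRatio l))).resolve_left fun h => ?_
  have h1 : EqOn periodRatio (fun _ => periodRatio l) doubleSlitPlane :=
    AnalyticOnNhd.eqOn_of_preconnected_of_eventuallyEq
      (fun z hz => analyticAt_periodRatio hz) (fun z _ => analyticAt_const)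
      isPreconnected_doubleSlitPlane hl h
  have h2 := h1 half_mem_doubleSlitPlane
  have h3 := h1 (mem_doubleSlitPlane_of_im_ne_zero (l := I) (by simp))
  have h4 := periodRatio_re_pos (l := I) (by simp)
  rw [h3, ← h2, periodRatio_half] at h4
  simp at h4

end PeriodRatio

/-! ### Bundles with discrete fibre over simply connected spaces. -/

section DiscreteBundles

/-- A fiber bundle core with discrete fibers from locally constant coordinate changes. -/
def FiberBundleCore.ofDiscrete {ι B F : Type*} [TopologicalSpace B] [TopologicalSpace F]
    [DiscreteTopology F] (V : ι → Set B) (hV : ∀ i, IsOpen (V i)) (idx : B → ι)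
    (hidx : ∀ x, x ∈ V (idx x)) (g : ι → ι → B → F → F) (hself : ∀ i, ∀ x ∈ V i, ∀ v, g i i x v = v)
    (hloc : ∀ i j, ∀ x ∈ V i ∩ V j, ∀ v, ∀ᶠ y in 𝓝 x, g i j y v = g i j x v)
    (hcomp : ∀ i j k, ∀ x ∈ V i ∩ V j ∩ V k, ∀ v, g j k x (g i j x v) = g i k x v) :
    FiberBundleCore ι B F where
  baseSet := V
  isOpen_baseSet := hV
  indexAt := idx
  mem_baseSet_at := hidx
  coordChange := g
  coordChange_self := hself
  continuousOn_coordChange i j := by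
    rintro ⟨x, v⟩ ⟨hx, -⟩
    refine ContinuousAt.continuousWithinAt ?_
    refine (continuousAt_const (y := g i j x v)).congr ?_
    have h1 : ∀ᶠ p : B × F in 𝓝 (x, v), g i j p.1 v = g i j x v :=
      (continuous_fst.tendsto (x, v)).eventually (hloc i j x hx v)
    have h2 : ∀ᶠ p : B × F in 𝓝 (x, v), p.2 = v :=
      (continuous_snd.tendsto (x, v)).eventually ((isOpen_discrete {v}).mem_nhds rfl)
    filter_upwards [h1, h2] with p hp1 hp2
    rw [hp2, hp1]
  coordChange_comp := hcomp

/-- A bundle with discrete fibers over a simply connected space has a section. -/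
theorem FiberBundleCore.exists_section {ι B F : Type*} [TopologicalSpace B] [TopologicalSpace F]
    [DiscreteTopology F] [Nonempty F] [SimplyConnectedSpace B] [LocallyPathConnectedSpace B]
    (Z : FiberBundleCore ι B F) :
    ∃ s : ι → B → F, (∀ i, ∀ x ∈ Z.baseSet i, ∀ᶠ y in 𝓝 x, s i y = s i x) ∧
      ∀ i j, ∀ x ∈ Z.baseSet i ∩ Z.baseSet j, s j x = Z.coordChange i j x (s i x) := by
  have hcov : IsCoveringMap Z.proj := FiberBundle.isCoveringMap (F := F) (E := Z.Fiber)
  obtain ⟨v⟩ := ‹Nonempty F›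
  obtain ⟨x₀⟩ : Nonempty B := inferInstance
  -- A section is a lift of the identity through the covering.
  obtain ⟨σ, ⟨-, hσ⟩, -⟩ := hcov.existsUnique_continuousMap_lifts (ContinuousMap.id B) x₀
    (⟨x₀, v⟩ : Z.TotalSpace) rfl
  have hp : ∀ x, (σ x).1 = x := fun x => congrFun hσ x
  refine ⟨fun i x => (Z.localTriv i (σ x)).2, fun i x hx => ?_, fun i j x hx => ?_⟩
  · have hmem : σ x ∈ (Z.localTriv i).source := by
      rw [Z.mem_localTriv_source, hp]; exact hx
    have hc : ContinuousAt (fun y => (Z.localTriv i (σ y)).2) x :=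
      continuous_snd.continuousAt.comp
        (((Z.localTriv i).toOpenPartialHomeomorph.continuousAt hmem).comp σ.continuous.continuousAt)
    exact hc.tendsto.eventually ((isOpen_discrete {_}).mem_nhds rfl)
  · simp only [Z.localTriv_apply]
    have := Z.coordChange_comp (Z.indexAt (σ x).1) i j (σ x).1
      ⟨⟨Z.mem_baseSet_at _, by rw [hp]; exact hx.1⟩, by rw [hp]; exact hx.2⟩ (σ x).2
    rw [← this, hp]

end DiscreteBundles

/-! ### Lifting maps from `ℂ \ {0, 1}` to the upper half-plane. -/

section UpperHalfPlaneLift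

open Complex UpperHalfPlane Matrix

/-- The three branches of `λ ↦ 1 / (1 - λ)`. -/
noncomputable def legendreRotation : Fin 3 → ℂ → ℂ :=
  ![fun l => l, fun l => (1 - l)⁻¹, fun l => (1 - (1 - l)⁻¹)⁻¹]

theorem legendreRotation_two {l : ℂ} (h0 : l ≠ 0) (h1 : l ≠ 1) :
    legendreRotation 2 l = 1 - l⁻¹ := by
  have h2 : 1 - l ≠ 0 := sub_ne_zero.2 h1.symm
  have h3 : 1 - (1 - l)⁻¹ ≠ 0 := by
    intro h
    have : (1 - l) * (1 - (1 - l)⁻¹) = -l := by rw [mul_sub, mul_inv_cancel₀ h2]; ring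
    rw [h, mul_zero] at this
    exact h0 (neg_eq_zero.1 this.symm)
  change (1 - (1 - l)⁻¹)⁻¹ = 1 - l⁻¹
  refine inv_eq_of_mul_eq_one_left ?_
  field_simp
  ring

theorem analyticAt_legendreRotation (i : Fin 3) {l : ℂ} (h0 : l ≠ 0) (h1 : l ≠ 1) :
    AnalyticAt ℂ (legendreRotation i) l := by
  have h2 : 1 - l ≠ 0 := sub_ne_zero.2 h1.symm
  fin_cases i
  · exact analyticAt_id
  · exact (analyticAt_const.sub analyticAt_id).inv h2
  · have : AnalyticAt ℂ (fun l : ℂ => 1 - l⁻¹) l := analyticAt_const.sub (analyticAt_id.inv h0)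
    refine this.congr ?_
    filter_upwards [isOpen_ne.mem_nhds h0, isOpen_ne.mem_nhds h1] with w hw0 hw1
    exact (legendreRotation_two hw0 hw1).symm

theorem legendreRotation_injective (i : Fin 3) : Function.Injective (legendreRotation i) := by
  fin_cases i
  · exact fun a b h => h
  · exact fun a b h => sub_right_injective (inv_injective h)
  · exact fun a b h => sub_right_injective (inv_injective (sub_right_injective (inv_injective h)))

/-- The rotation permutes the intervals `(-∞, 0)`, `(0, 1)` and `(1, ∞)` cyclically, so each of them
is brought into `(0, 1)` by exactly one of its powers. Different branches therefore overlap only off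
the real axis. -/
theorem exists_legendreRotation_mem {l : ℂ} (h0 : l ≠ 0) (h1 : l ≠ 1) :
    ∃ i, legendreRotation i l ∈ doubleSlitPlane := by
  by_cases him : l.im = 0
  · obtain ⟨r, rfl⟩ : ∃ r : ℝ, l = r := ⟨l.re, Complex.ext rfl (by simpa using him)⟩
    have h0' : r ≠ 0 := by exact_mod_cast h0
    have h1' : r ≠ 1 := by exact_mod_cast h1
    have key : ∀ t : ℝ, 0 < t → t < 1 → (t : ℂ) ∈ doubleSlitPlane := fun t ht ht1 =>
      ⟨Or.inl (by simpa using ht), Or.inl (by simpa using ht1)⟩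
    rcases lt_or_gt_of_ne h0' with h | h
    · refine ⟨1, ?_⟩
      have := key (1 - r)⁻¹ (inv_pos.2 (by linarith)) (inv_lt_one_of_one_lt₀ (by linarith))
      simpa [legendreRotation] using this
    · rcases lt_or_gt_of_ne h1' with h' | h'
      · exact ⟨0, key r h h'⟩
      · refine ⟨2, ?_⟩
        rw [legendreRotation_two h0 h1]
        have h2 := inv_lt_one_of_one_lt₀ h'
        have := key (1 - r⁻¹) (by linarith) (by have := inv_pos.2 h; linarith)
        simpa using this
  · exact ⟨0, mem_doubleSlitPlane_of_im_ne_zero him⟩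

theorem ofReal_mem_doubleSlitPlane {r : ℝ} (h : (r : ℂ) ∈ doubleSlitPlane) : 0 < r ∧ r < 1 := by
  obtain ⟨h1, h2⟩ := h
  rw [mem_slitPlane_iff] at h1 h2
  simpa using And.intro h1 h2

theorem im_ne_zero_of_legendreRotation_mem {l : ℂ} (h0 : l ≠ 0) (h1 : l ≠ 1) {i j : Fin 3}
    (hij : i ≠ j) (hi : legendreRotation i l ∈ doubleSlitPlane)
    (hj : legendreRotation j l ∈ doubleSlitPlane) : l.im ≠ 0 := by
  intro him
  obtain ⟨r, rfl⟩ : ∃ r : ℝ, l = r := ⟨l.re, Complex.ext rfl (by simpa using him)⟩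
  have h0' : r ≠ 0 := by exact_mod_cast h0
  have h1' : r ≠ 1 := by exact_mod_cast h1
  have k0 : legendreRotation 0 (r : ℂ) ∈ doubleSlitPlane → 0 < r ∧ r < 1 :=
    fun h => ofReal_mem_doubleSlitPlane h
  have k1 : legendreRotation 1 (r : ℂ) ∈ doubleSlitPlane → r < 0 := fun h => by
    have e : legendreRotation 1 (r : ℂ) = (((1 - r)⁻¹ : ℝ) : ℂ) := by simp [legendreRotation]
    rw [e] at h
    obtain ⟨a, b⟩ := ofReal_mem_doubleSlitPlane h
    have := (inv_lt_one₀ (inv_pos.1 a)).1 b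
    linarith
  have k2 : legendreRotation 2 (r : ℂ) ∈ doubleSlitPlane → 1 < r := fun h => by
    have e : legendreRotation 2 (r : ℂ) = ((1 - r⁻¹ : ℝ) : ℂ) := by
      rw [legendreRotation_two h0 h1]; simp
    rw [e] at h
    obtain ⟨a, b⟩ := ofReal_mem_doubleSlitPlane h
    have hp : 0 < r⁻¹ := by linarith
    exact (inv_lt_one₀ (inv_pos.1 hp)).1 (by linarith)
  fin_cases i <;> fin_cases j <;> first | exact absurd rfl hij | skip
  all_goals
    simp only [Fin.zero_eta, Fin.mk_one, Fin.reduceFinMk] at hi hj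
    first
    | (have a := k0 hi; have b := k1 hj; linarith)
    | (have a := k0 hi; have b := k2 hj; linarith)
    | (have a := k1 hi; have b := k0 hj; linarith)
    | (have a := k1 hi; have b := k2 hj; linarith)
    | (have a := k2 hi; have b := k0 hj; linarith)
    | (have a := k2 hi; have b := k1 hj; linarith)

/-- The period ratio as a point of the upper half-plane (only meaningful on the doubly slit
plane). -/
noncomputable def periodPoint (l : ℂ) : ℍ := by
  classical
  exact if h : l ∈ doubleSlitPlane then ⟨periodRatio l, periodRatio_im_pos h⟩ else UpperHalfPlane.I

theorem coe_periodPoint {l : ℂ} (h : l ∈ doubleSlitPlane) : (periodPoint l : ℂ) = periodRatio l := by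
  rw [periodPoint, dif_pos h]

/-- The transformation `τ ↦ 1 / (1 - τ)`. -/
def rotationUpper : SpecialLinearGroup (Fin 2) ℤ := ⟨!![0, 1; -1, 1], by simp⟩

/-- The transformation `τ ↦ -1 / (1 + τ)`. -/
def rotationLower : SpecialLinearGroup (Fin 2) ℤ := ⟨!![0, -1; 1, 1], by simp⟩

theorem periodPoint_rotation_upper {l : ℂ} (hl : 0 < l.im) :
    periodPoint (1 - l)⁻¹ = rotationUpper • periodPoint l := by
  apply UpperHalfPlane.ext
  rw [coe_periodPoint (mem_doubleSlitPlane_of_im_ne_zero (im_inv_one_sub_pos hl).ne'),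
    periodRatio_inv_one_sub hl, UpperHalfPlane.specialLinearGroup_apply]
  simp [rotationUpper, coe_periodPoint (mem_doubleSlitPlane_of_im_ne_zero hl.ne')]
  ring_nf

theorem im_inv_one_sub_neg {l : ℂ} (hl : l.im < 0) : ((1 - l)⁻¹).im < 0 := by
  have h0 : 0 < ((starRingEnd ℂ) l).im := by simpa using hl
  have := im_inv_one_sub_pos h0
  have h2 : (1 - (starRingEnd ℂ) l)⁻¹ = (starRingEnd ℂ) ((1 - l)⁻¹) := by simp
  rw [h2, conj_im] at this
  linarith

theorem periodPoint_rotation_lower {l : ℂ} (hl : l.im < 0) :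
    periodPoint (1 - l)⁻¹ = rotationLower • periodPoint l := by
  apply UpperHalfPlane.ext
  rw [coe_periodPoint (mem_doubleSlitPlane_of_im_ne_zero (im_inv_one_sub_neg hl).ne),
    periodRatio_inv_one_sub_of_im_neg hl, UpperHalfPlane.specialLinearGroup_apply]
  simp [rotationLower, coe_periodPoint (mem_doubleSlitPlane_of_im_ne_zero hl.ne)]
  ring_nf

/-- The modular transformation that relates the branch `i` of the period point to the branch `0`. -/
noncomputable def branchChange (l : ℂ) (i : Fin 3) : SpecialLinearGroup (Fin 2) ℤ :=
  if 0 < l.im then rotationUpper ^ (i : ℕ) else if l.im < 0 then rotationLower ^ (i : ℕ) else 1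

theorem branchChange_smul {l : ℂ} (hl : l.im ≠ 0) (i : Fin 3) :
    periodPoint (legendreRotation i l) = branchChange l i • periodPoint l := by
  rcases lt_or_gt_of_ne hl with h | h
  · rw [branchChange, if_neg h.not_gt, if_pos h]
    fin_cases i
    · exact (one_smul (SpecialLinearGroup (Fin 2) ℤ) _).symm
    · exact (periodPoint_rotation_lower h).trans (by simp)
    · refine (periodPoint_rotation_lower (im_inv_one_sub_neg h)).trans ?_
      rw [periodPoint_rotation_lower h, smul_smul, ← pow_two]
  · rw [branchChange, if_pos h]
    fin_cases i
    · exact (one_smul (SpecialLinearGroup (Fin 2) ℤ) _).symm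
    · exact (periodPoint_rotation_upper h).trans (by simp)
    · refine (periodPoint_rotation_upper (im_inv_one_sub_pos h)).trans ?_
      rw [periodPoint_rotation_upper h, smul_smul, ← pow_two]

theorem branchChange_eventually_eq {l : ℂ} (hl : l.im ≠ 0) :
    ∀ᶠ w in 𝓝 l, branchChange w = branchChange l := by
  rcases lt_or_gt_of_ne hl with h | h
  · filter_upwards [(isOpen_lt Complex.continuous_im continuous_const).mem_nhds h] with w hw
    have hw' : w.im < 0 := hw
    funext i
    rw [branchChange, branchChange, if_neg h.not_gt, if_pos h, if_neg hw'.not_gt, if_pos hw']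
  · filter_upwards [(isOpen_lt continuous_const Complex.continuous_im).mem_nhds h] with w hw
    have hw' : 0 < w.im := hw
    funext i
    rw [branchChange, branchChange, if_pos h, if_pos hw']

theorem analyticAt_smul_periodPoint (g : SpecialLinearGroup (Fin 2) ℤ) (i : Fin 3) {l : ℂ}
    (h0 : l ≠ 0) (h1 : l ≠ 1) (hl : legendreRotation i l ∈ doubleSlitPlane) :
    AnalyticAt ℂ (fun w => ((g • periodPoint (legendreRotation i w) : ℍ) : ℂ)) l := by
  have hr := analyticAt_legendreRotation i h0 h1
  have hp : AnalyticAt ℂ (fun w => ((periodPoint (legendreRotation i w) : ℍ) : ℂ)) l := by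
    have : AnalyticAt ℂ (fun w => periodRatio (legendreRotation i w)) l :=
      AnalyticAt.fun_comp (analyticAt_periodRatio hl) hr
    refine this.congr ?_
    filter_upwards [hr.continuousAt.eventually (isOpen_doubleSlitPlane.mem_nhds hl)] with w hw
    exact (coe_periodPoint hw).symm
  have he : (fun w => ((g • periodPoint (legendreRotation i w) : ℍ) : ℂ)) = fun w =>
      (((g 0 0 : ℝ) : ℂ) * (periodPoint (legendreRotation i w) : ℂ) + ((g 0 1 : ℝ) : ℂ)) /
      (((g 1 0 : ℝ) : ℂ) * (periodPoint (legendreRotation i w) : ℂ) + ((g 1 1 : ℝ) : ℂ)) := by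
    funext w
    rw [UpperHalfPlane.specialLinearGroup_apply]
    simp
  rw [he]
  refine ((analyticAt_const.mul hp).add analyticAt_const).div
    ((analyticAt_const.mul hp).add analyticAt_const) ?_
  have := UpperHalfPlane.denom_ne_zero (g : GL (Fin 2) ℝ) (periodPoint (legendreRotation i l))
  simpa [UpperHalfPlane.denom] using this

/-- A map from a simply connected space to `ℂ \ {0, 1}` factors locally through nonconstant
holomorphic functions to the upper half-plane, with a global value. -/
theorem exists_upperHalfPlane_lift {X : Type*} [TopologicalSpace X] [SimplyConnectedSpace X]
    [LocallyPathConnectedSpace X] {F : X → ℂ} (hF : Continuous F) (h0 : ∀ x, F x ≠ 0)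
    (h1 : ∀ x, F x ≠ 1) :
    ∃ φ : X → ℍ, ∀ x, ∃ ψ : ℂ → ℍ, AnalyticAt ℂ (fun w => (ψ w : ℂ)) (F x) ∧
      (∀ᶠ w in 𝓝[≠] F x, ψ w ≠ ψ (F x)) ∧ ∀ᶠ y in 𝓝 x, φ y = ψ (F y) := by
  let _ : TopologicalSpace (SpecialLinearGroup (Fin 2) ℤ) := ⊥
  have : DiscreteTopology (SpecialLinearGroup (Fin 2) ℤ) := ⟨rfl⟩
  set V : Fin 3 → Set X := fun i => {x | legendreRotation i (F x) ∈ doubleSlitPlane} with hV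
  have hVo : ∀ i, IsOpen (V i) := fun i => by
    refine isOpen_doubleSlitPlane.preimage (continuous_iff_continuousAt.2 fun x => ?_)
    exact ContinuousAt.comp (f := F) (analyticAt_legendreRotation i (h0 x) (h1 x)).continuousAt
      hF.continuousAt
  choose idx hidx using fun x => exists_legendreRotation_mem (h0 x) (h1 x)
  -- The cocycle is a quotient of branch changes. On an overlap of different branches `F` is not
  -- real, so the cocycle is locally constant there.
  let Z : FiberBundleCore (Fin 3) X (SpecialLinearGroup (Fin 2) ℤ) :=
    FiberBundleCore.ofDiscrete V hVo idx hidx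
      (fun i j x a => branchChange (F x) j * (branchChange (F x) i)⁻¹ * a)
      (fun i x _ v => by simp)
      (fun i j x hx v => by
        by_cases hij : i = j
        · subst hij; simp
        · have := im_ne_zero_of_legendreRotation_mem (h0 x) (h1 x) hij hx.1 hx.2
          filter_upwards [hF.continuousAt.eventually (branchChange_eventually_eq this)] with y hy
          rw [hy])
      (fun i j k x _ v => by group)
  obtain ⟨s, hs, hs'⟩ := Z.exists_section
  -- A section transforms under the same matrices as the period point, so the inverse removes the
  -- dependence on the branch.
  set T : Fin 3 → X → ℍ := fun i x => (s i x)⁻¹ • periodPoint (legendreRotation i (F x)) with hT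
  have hTT : ∀ i j x, x ∈ V i → x ∈ V j → T i x = T j x := by
    intro i j x hi hj
    by_cases hij : i = j
    · rw [hij]
    have him := im_ne_zero_of_legendreRotation_mem (h0 x) (h1 x) hij hi hj
    have e : s j x = branchChange (F x) j * (branchChange (F x) i)⁻¹ * s i x :=
      hs' i j x ⟨hi, hj⟩
    simp only [hT]
    rw [e, branchChange_smul him i, branchChange_smul him j, smul_smul, smul_smul]
    congr 1
    group
  refine ⟨fun x => T (idx x) x, fun x => ?_⟩
  set i := idx x with hi
  have hx : legendreRotation i (F x) ∈ doubleSlitPlane := hidx x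
  refine ⟨fun w => (s i x)⁻¹ • periodPoint (legendreRotation i w),
    analyticAt_smul_periodPoint _ i (h0 x) (h1 x) hx, ?_, ?_⟩
  · have hr := (analyticAt_legendreRotation i (h0 x) (h1 x)).continuousAt
    have ht : Tendsto (legendreRotation i) (𝓝[≠] F x) (𝓝[≠] legendreRotation i (F x)) :=
      tendsto_nhdsWithin_of_tendsto_nhds_of_eventually_within _
        (hr.tendsto.mono_left nhdsWithin_le_nhds) (by
          filter_upwards [self_mem_nhdsWithin] with w hw
          exact fun h => hw (legendreRotation_injective i h))
    filter_upwards [ht.eventually (periodRatio_eventually_ne hx),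
      nhdsWithin_le_nhds (hr.eventually (isOpen_doubleSlitPlane.mem_nhds hx))] with w hw hw' h
    have h2 := smul_left_cancel _ h
    apply hw
    rw [← coe_periodPoint hw', ← coe_periodPoint hx, h2]
  · filter_upwards [hs i x hx, (hVo i).mem_nhds hx] with y hy hy'
    rw [hTT (idx y) i y (hidx y) hy']
    simp only [hT]
    rw [hy]

/-- Boundedness version: the lift takes values in the unit disc. -/
theorem exists_disc_lift {X : Type*} [TopologicalSpace X] [SimplyConnectedSpace X]
    [LocallyPathConnectedSpace X] {F : X → ℂ} (hF : Continuous F) (h0 : ∀ x, F x ≠ 0)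
    (h1 : ∀ x, F x ≠ 1) :
    ∃ φ : X → ℂ, (∀ x, ‖φ x‖ ≤ 1) ∧
      (∀ x, ∃ ψ : ℂ → ℂ, AnalyticAt ℂ ψ (F x) ∧ ∀ᶠ y in 𝓝 x, φ y = ψ (F y)) ∧
      ((∀ x y, φ x = φ y) → ∀ x y, F x = F y) := by
  obtain ⟨φ, hφ⟩ := exists_upperHalfPlane_lift hF h0 h1
  have hne : ∀ z : ℍ, (z : ℂ) + Complex.I ≠ 0 := fun z h => by
    have h2 := congrArg Complex.im h
    have h3 := z.im_pos
    simp at h2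
    linarith
  refine ⟨fun x => ((φ x : ℂ) - Complex.I) / ((φ x : ℂ) + Complex.I), fun x => ?_, fun x => ?_,
    fun h => ?_⟩
  · rw [norm_div, div_le_one (norm_pos_iff.2 (hne _)), Complex.norm_def, Complex.norm_def]
    refine Real.sqrt_le_sqrt ?_
    have h3 := (φ x).im_pos
    rw [Complex.normSq_apply, Complex.normSq_apply]
    simp
    nlinarith
  · obtain ⟨ψ, hψ, -, he⟩ := hφ x
    refine ⟨fun w => ((ψ w : ℂ) - Complex.I) / ((ψ w : ℂ) + Complex.I),
      (hψ.sub analyticAt_const).div (hψ.add analyticAt_const) (hne _), ?_⟩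
    filter_upwards [he] with y hy
    rw [hy]
  · have hconst : ∀ x y, φ x = φ y := fun x y => by
      have h2 := h x y
      simp only at h2
      rw [div_eq_div_iff (hne _) (hne _)] at h2
      apply UpperHalfPlane.ext
      have h3 : (2 * Complex.I) * ((φ x : ℂ) - φ y) = 0 := by linear_combination h2
      exact sub_eq_zero.1 ((mul_eq_zero.1 h3).resolve_left (by simp))
    -- If `φ` is constant, so is `ψ ∘ F` near each point; as `ψ` takes the value `ψ (F x)` near `F
    -- x` only at `F x`, the map `F` is locally constant.
    have hloc : IsLocallyConstant F := by
      rw [IsLocallyConstant.iff_eventually_eq]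
      intro x
      obtain ⟨ψ, -, hne', he⟩ := hφ x
      filter_upwards [he, hF.continuousAt.eventually (eventually_nhdsWithin_iff.1 hne')] with y h2 h3
      by_contra h4
      exact h3 h4 (by rw [← h2, hconst y x, he.self_of_nhds])
    exact fun x y => hloc.apply_eq_of_preconnectedSpace x y

end UpperHalfPlaneLift

/-! ### Existence of a simply connected covering. -/

section UniversalCover

open CategoryTheory FundamentalGroupoid

/-- The homotopy class of a path, as a morphism of the fundamental groupoid. -/
abbrev Path.toHom {X : Type*} [TopologicalSpace X] {x y : X} (γ : Path x y) :
    FundamentalGroupoid.mk x ⟶ FundamentalGroupoid.mk y :=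
  FundamentalGroupoid.fromPath (Path.Homotopic.Quotient.mk γ)

theorem Path.toHom_surjective {X : Type*} [TopologicalSpace X] {x y : X}
    (a : FundamentalGroupoid.mk x ⟶ FundamentalGroupoid.mk y) : ∃ γ : Path x y, γ.toHom = a :=
  Path.Homotopic.Quotient.mk_surjective a

theorem Path.toHom_map_comp {X Y : Type*} [TopologicalSpace X] [TopologicalSpace Y] {x y z : X}
    (γ : Path x y) (δ : Path y z) (f : C(X, Y)) :
    ((γ.trans δ).map f.continuous).toHom =
      (γ.map f.continuous).toHom ≫ (δ.map f.continuous).toHom := by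
  have := (FundamentalGroupoid.map f).map_comp (X := .mk x) (Y := .mk y) (Z := .mk z)
    γ.toHom δ.toHom
  exact this

theorem eventually_joinedIn {X : Type*} [TopologicalSpace X] [LocallyPathConnectedSpace X]
    {U : Set X} (hU : IsOpen U) {x : X} (hx : x ∈ U) : ∀ᶠ y in 𝓝 x, JoinedIn U x y :=
  (hU.pathComponentIn x).mem_nhds (mem_pathComponentIn_self hx)

/-- Simply connected neighbourhoods provide local sections of the fundamental groupoid. -/
theorem exists_local_class {M : Type u} [TopologicalSpace M] [PathConnectedSpace M] (U : Set M)
    (hsc : SimplyConnectedSpace U) (i : M) (hi : i ∈ U) :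
    ∃ c : ∀ y : M, FundamentalGroupoid.mk i ⟶ FundamentalGroupoid.mk y,
      ∀ (x y : M) (δ : Path x y), (∀ t, δ t ∈ U) → c y = c x ≫ δ.toHom := by
  classical
  let ι : C(U, M) := ⟨Subtype.val, continuous_subtype_val⟩
  refine ⟨fun y => if hy : y ∈ U then
    ((PathConnectedSpace.somePath (⟨i, hi⟩ : U) ⟨y, hy⟩).map ι.continuous).toHom
    else (PathConnectedSpace.somePath i y).toHom, fun x y δ hδ => ?_⟩
  have hx : x ∈ U := by simpa using hδ 0
  have hy : y ∈ U := by simpa using hδ 1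
  simp only [dif_pos hx, dif_pos hy]
  let δ' : Path (⟨x, hx⟩ : U) ⟨y, hy⟩ :=
    { toFun := fun t => ⟨δ t, hδ t⟩
      continuous_toFun := by fun_prop
      source' := by simp
      target' := by simp }
  have e : δ.toHom = (δ'.map ι.continuous).toHom := by
    congr 1
  rw [e]
  refine Eq.trans ?_ (Path.toHom_map_comp (PathConnectedSpace.somePath (⟨i, hi⟩ : U) ⟨x, hx⟩) δ' ι)
  refine Path.Homotopic.Quotient.eq.2 (Path.Homotopic.map ?_ ι)
  exact SimplyConnectedSpace.paths_homotopic _ _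

/-- Points over `x` are homotopy classes of paths from `x₀` to `x`, arranged as a bundle whose fibre
is the fundamental group with the discrete topology. -/
theorem exists_universal_cover {M : Type u} [TopologicalSpace M] [PathConnectedSpace M]
    [LocallyPathConnectedSpace M]
    (hsc : ∀ x : M, ∃ U : Set M, IsOpen U ∧ x ∈ U ∧ SimplyConnectedSpace U) :
    ∃ (E : Type u) (_ : TopologicalSpace E) (p : E → M),
      IsCoveringMap p ∧ Function.Surjective p ∧ SimplyConnectedSpace E := by
  choose U hUo hU hUsc using hsc
  choose w hw using fun i => exists_local_class (U i) (hUsc i) i (hU i)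
  obtain ⟨x₀⟩ : Nonempty M := inferInstance
  let c : ∀ i : M, FundamentalGroupoid.mk x₀ ⟶ FundamentalGroupoid.mk i :=
    fun i => (PathConnectedSpace.somePath x₀ i).toHom
  let F : Type u := FundamentalGroupoid.mk x₀ ⟶ FundamentalGroupoid.mk x₀
  let _ : TopologicalSpace F := ⊥
  have : DiscreteTopology F := ⟨rfl⟩
  -- In the chart `i` the loop class `a` over `x` stands for the path class `a ≫ c i ≫ w i x`; the
  -- coordinate change keeps this class, which `L` below reads off.
  let Z : FiberBundleCore M M F := FiberBundleCore.ofDiscrete U hUo id hU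
    (fun i j x a => a ≫ c i ≫ w i x ≫ Groupoid.inv (w j x) ≫ Groupoid.inv (c j))
    (fun i x _ v => by simp)
    (fun i j x hx v => by
      filter_upwards [eventually_joinedIn ((hUo i).inter (hUo j)) hx] with y hy
      obtain ⟨δ, hδ⟩ := hy
      rw [hw i x y δ fun t => (hδ t).1, hw j x y δ fun t => (hδ t).2]
      simp)
    (fun i j k x _ v => by simp)
  let L : ∀ e : Z.TotalSpace, FundamentalGroupoid.mk x₀ ⟶ FundamentalGroupoid.mk e.1 :=
    fun e => (show F from e.2) ≫ c e.1 ≫ w e.1 e.1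
  have hL : ∀ (i : M) (e : Z.TotalSpace), L e =
      (show F from (Z.localTriv i e).2) ≫ c i ≫ w i e.1 := by
    intro i e
    have key : ∀ a : FundamentalGroupoid.mk x₀ ⟶ FundamentalGroupoid.mk x₀,
        a ≫ c e.1 ≫ w e.1 e.1 = (a ≫ c e.1 ≫ w e.1 e.1 ≫ Groupoid.inv (w i e.1) ≫
          Groupoid.inv (c i)) ≫ c i ≫ w i e.1 := fun a => by simp
    exact key e.2
  have hLinj : ∀ (x : M) (a b : F), L ⟨x, a⟩ = L ⟨x, b⟩ → a = b := by
    intro x a b h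
    change a ≫ c x ≫ w x x = b ≫ c x ≫ w x x at h
    exact (cancel_mono (c x ≫ w x x)).1 h
  have hcov : IsCoveringMap Z.proj := FiberBundle.isCoveringMap (F := F) (E := Z.Fiber)
  have : ContractibleSpace unitInterval :=
    (convex_Icc (0 : ℝ) 1).contractibleSpace ⟨0, by simp⟩
  have : LocallyPathConnectedSpace unitInterval :=
    (convex_Icc (0 : ℝ) 1).locallyPathConnectedSpace
  let pr : C(Z.TotalSpace, M) := ⟨Z.proj, hcov.continuous⟩
  have hassoc : ∀ {A B C D E : FundamentalGroupoid M} (a : A ⟶ B) (b : B ⟶ C) (c : C ⟶ D)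
      (d : D ⟶ E), a ≫ b ≫ (c ≫ d) = (a ≫ b ≫ c) ≫ d := fun a b c d => by simp
  have hcancel : ∀ {A B C : FundamentalGroupoid M} (a : A ⟶ C) (b : A ⟶ B) (m : B ⟶ C) (o : B ⟶ B),
      o = 𝟙 B → a ≫ Groupoid.inv m = b ≫ Groupoid.inv o → a = b ≫ m := by
    rintro A B C a b m o rfl h
    have h2 := congrArg (· ≫ m) h
    simpa using h2
  -- Along a path in the total space, `L` is multiplied by the class of the projected path: the
  -- discrepancy `k` is locally constant on the interval.
  have hpath : ∀ (Γ : C(unitInterval, Z.TotalSpace)) (t : unitInterval) (δ : Path 0 t),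
      L (Γ t) = L (Γ 0) ≫ (δ.map (pr.comp Γ).continuous).toHom := by
    intro Γ
    let k : unitInterval → (FundamentalGroupoid.mk x₀ ⟶ FundamentalGroupoid.mk (Γ 0).1) :=
      fun t => L (Γ t) ≫ Groupoid.inv
        (((PathConnectedSpace.somePath 0 t).map (pr.comp Γ).continuous).toHom)
    have hsimply : ∀ (s t : unitInterval) (δ δ' : Path s t),
        (δ.map (pr.comp Γ).continuous).toHom = (δ'.map (pr.comp Γ).continuous).toHom :=
      fun s t δ δ' => Path.Homotopic.Quotient.eq.2
        (Path.Homotopic.map (SimplyConnectedSpace.paths_homotopic _ _) (pr.comp Γ))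
    have hk : IsLocallyConstant k := by
      rw [IsLocallyConstant.iff_eventually_eq]
      intro t
      set i := (Γ t).1 with hi
      have hmem : Γ t ∈ (Z.localTriv i).source := by
        rw [Z.mem_localTriv_source]; exact hU i
      have hc : ContinuousAt (fun s => (Z.localTriv i (Γ s)).2) t :=
        continuous_snd.continuousAt.comp
          (((Z.localTriv i).toOpenPartialHomeomorph.continuousAt hmem).comp Γ.continuous.continuousAt)
      have hopen : IsOpen {s | (pr.comp Γ) s ∈ U i} := (hUo i).preimage (pr.comp Γ).continuous
      have ht : t ∈ {s | (pr.comp Γ) s ∈ U i} := hU i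
      filter_upwards [eventually_joinedIn hopen ht,
        hc.tendsto.eventually ((isOpen_discrete {_}).mem_nhds rfl)] with s hs hs'
      obtain ⟨δ, hδ⟩ := hs
      have hs'' : (Z.localTriv i (Γ s)).2 = (Z.localTriv i (Γ t)).2 := hs'
      have e1 : L (Γ s) = L (Γ t) ≫ (δ.map (pr.comp Γ).continuous).toHom := by
        have e3 : w i (Γ s).1 = w i (Γ t).1 ≫ (δ.map (pr.comp Γ).continuous).toHom :=
          hw i _ _ (δ.map (pr.comp Γ).continuous) fun r => hδ r
        rw [hL i (Γ s), hL i (Γ t), hs'', e3]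
        exact hassoc _ _ _ _
      have e2 : ((PathConnectedSpace.somePath 0 s).map (pr.comp Γ).continuous).toHom =
          ((PathConnectedSpace.somePath 0 t).map (pr.comp Γ).continuous).toHom ≫
            (δ.map (pr.comp Γ).continuous).toHom := by
        rw [← Path.toHom_map_comp]
        exact hsimply _ _ _ _
      simp only [k]
      rw [e1, e2]
      simp
    intro t δ
    have h := hk.apply_eq_of_preconnectedSpace t 0
    have e0 : ((PathConnectedSpace.somePath (0 : unitInterval) 0).map
        (pr.comp Γ).continuous).toHom = 𝟙 _ := by
      rw [hsimply 0 0 _ (Path.refl 0)]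
      rfl
    simp only [k] at h
    rw [hsimply 0 t _ δ] at h
    exact hcancel _ _ _ _ e0 h
  have hpath' : ∀ (e e' : Z.TotalSpace) (γ : Path e e'),
      L e' = L e ≫ (γ.map pr.continuous).toHom := by
    intro e e' γ
    rcases γ with ⟨Γ, h0, h1⟩
    subst h0
    subst h1
    let δ : Path (0 : unitInterval) 1 :=
      { toFun := id, continuous_toFun := continuous_id, source' := rfl, target' := rfl }
    exact hpath Γ 1 δ
  refine ⟨Z.TotalSpace, inferInstance, Z.proj, hcov, fun x => ⟨⟨x, 𝟙 (FundamentalGroupoid.mk x₀)⟩, rfl⟩, ?_⟩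
  rw [simply_connected_iff_paths_homotopic']
  constructor
  -- The point of the trivial path class. Lifting from it a path in the class `L ⟨x, a⟩` ends at
  -- `⟨x, a⟩`, because `L` is injective on fibres.
  · let e₀ : Z.TotalSpace := ⟨x₀, Groupoid.inv (c x₀ ≫ w x₀ x₀)⟩
    have he₀ : L e₀ = 𝟙 _ := by
      change Groupoid.inv (c x₀ ≫ w x₀ x₀) ≫ c x₀ ≫ w x₀ x₀ = 𝟙 _
      simp
    have hj : ∀ e, Joined e₀ e := by
      rintro ⟨x, a⟩
      obtain ⟨δ, hδ⟩ := Path.toHom_surjective (L ⟨x, a⟩)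
      obtain ⟨Γ, hΓ, hΓ0⟩ := hcov.exists_path_lifts δ.toContinuousMap e₀ δ.source
      have key : ∀ (e : Z.TotalSpace) (γ : Path e₀ e), e.1 = x → (∀ t, (γ t).1 = δ t) →
          e = ⟨x, a⟩ := by
        rintro ⟨y, b⟩ γ hy hγ
        have hy' : y = x := hy
        subst hy'
        have e1 : (γ.map pr.continuous) = δ := Path.ext (funext hγ)
        have e2 := hpath' _ _ γ
        rw [he₀, e1, hδ] at e2
        rw [hLinj y b a (e2.trans (Category.id_comp _))]
      have h1 : (Γ 1).1 = x := (congrFun hΓ 1).trans δ.target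
      have h2 := key (Γ 1) ⟨Γ, hΓ0, rfl⟩ h1 fun t => congrFun hΓ t
      exact ⟨⟨Γ, hΓ0, h2⟩⟩
    exact pathConnectedSpace_iff_eq.2 ⟨e₀, eq_univ_of_forall hj⟩
  · intro e e' γ γ'
    -- Two paths with the same ends have homotopic projections, since both classes equal `L e`
    -- inverse followed by `L e'`; homotopies lift through a covering.
    have h := (hpath' e e' γ).symm.trans (hpath' e e' γ')
    have h2 := (cancel_epi (L e)).1 h
    apply Path.Homotopic.Quotient.eq.1
    exact hcov.injective_path_homotopic_map e e' h2

end UniversalCover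

/-! ### The universal covering of a complex manifold. -/

section UniversalCoverManifold

theorem exists_simplyConnected_nhd (n : ℕ) {N : Type u} [TopologicalSpace N]
    [ChartedSpace (CSpace n) N] (x : N) :
    ∃ U : Set N, IsOpen U ∧ x ∈ U ∧ SimplyConnectedSpace U := by
  set c := chartAt (CSpace n) x
  have hx : c x ∈ c.target := c.map_source (mem_chart_source _ x)
  obtain ⟨r, hr, hball⟩ := Metric.isOpen_iff.1 c.open_target (c x) hx
  set B := Metric.ball (c x) r
  set e := c.symm.restrOpen B Metric.isOpen_ball
  have hs : e.source = B := by
    simp only [e, OpenPartialHomeomorph.restrOpen_source]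
    exact inter_eq_right.2 hball
  have hB : ContractibleSpace e.source := by
    rw [hs]
    exact (convex_ball (c x) r).contractibleSpace ⟨c x, Metric.mem_ball_self hr⟩
  have : ContractibleSpace e.target := e.toHomeomorphSourceTarget.symm.contractibleSpace
  refine ⟨e.target, e.open_target, ?_, inferInstance⟩
  have h1 : e (c x) ∈ e.target := e.map_source (by rw [hs]; exact Metric.mem_ball_self hr)
  have h2 : e (c x) = x := c.left_inv (mem_chart_source _ x)
  rwa [h2] at h1

/-- The manifold structure on the source of a local homeomorphism. -/
theorem exists_manifold_of_isLocalHomeomorph (n : ℕ) {E N : Type u} [TopologicalSpace E]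
    [TopologicalSpace N] [ChartedSpace (CSpace n) N] [IsManifold 𝓘(ℂ, CSpace n) ω N]
    {p : E → N} (hp : IsLocalHomeomorph p) :
    ∃ (_ : ChartedSpace (CSpace n) E), IsManifold 𝓘(ℂ, CSpace n) ω E ∧
      IsLocalDiffeomorph 𝓘(ℂ, CSpace n) 𝓘(ℂ, CSpace n) ω p := by
  choose φ hφ hφp using hp
  let ch : E → OpenPartialHomeomorph E (CSpace n) := fun e =>
    (φ e).trans (chartAt (CSpace n) (p e))
  let _ : ChartedSpace (CSpace n) E :=
    { atlas := range ch
      chartAt := ch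
      mem_chart_source := fun e => by
        simp only [ch, OpenPartialHomeomorph.trans_source]
        refine ⟨hφ e, ?_⟩
        change (φ e) e ∈ (chartAt (CSpace n) (p e)).source
        rw [← hφp e]
        exact mem_chart_source _ _
      chart_mem_atlas := fun e => ⟨e, rfl⟩ }
  have hgr : HasGroupoid E (contDiffGroupoid ω 𝓘(ℂ, CSpace n)) := by
    constructor
    rintro _ _ ⟨e, rfl⟩ ⟨e', rfl⟩
    set c := chartAt (CSpace n) (p e)
    set c' := chartAt (CSpace n) (p e')
    have hcc : c.symm.trans c' ∈ contDiffGroupoid ω 𝓘(ℂ, CSpace n) :=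
      HasGroupoid.compatible (chart_mem_atlas _ _) (chart_mem_atlas _ _)
    set t := (ch e).symm.trans (ch e')
    -- The local inverses of `p` cancel, so coordinate changes upstairs are restrictions of those of
    -- `N`.
    have key : ∀ z ∈ t.source, z ∈ (c.symm.trans c').source ∧ t z = c' (c.symm z) := by
      intro z hz
      simp only [t, ch, OpenPartialHomeomorph.trans_source, OpenPartialHomeomorph.symm_source,
        OpenPartialHomeomorph.trans_target, mem_inter_iff, mem_preimage] at hz
      obtain ⟨⟨hz1, hz2⟩, hz3, hz4⟩ := hz
      have e1 : (φ e') ((φ e).symm (c.symm z)) = c.symm z := by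
        rw [← hφp e']
        conv_lhs => rw [hφp e]
        exact (φ e).right_inv hz2
      have e2 : ((φ e).trans c).symm z = (φ e).symm (c.symm z) := rfl
      rw [e2, e1] at hz4
      refine ⟨?_, ?_⟩
      · rw [OpenPartialHomeomorph.trans_source]
        exact ⟨hz1, hz4⟩
      · change c' ((φ e') ((φ e).symm (c.symm z))) = _
        rw [e1]
    refine StructureGroupoid.mem_of_eqOnSource _
      (closedUnderRestriction' hcc t.open_source) ⟨?_, ?_⟩
    · rw [OpenPartialHomeomorph.restr_source, t.open_source.interior_eq]
      exact (inter_eq_right.2 fun z hz => (key z hz).1).symm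
    · exact fun z hz => (key z hz).2
  have hman : IsManifold 𝓘(ℂ, CSpace n) ω E := { hgr with }
  refine ⟨inferInstance, hman, fun e => ?_⟩
  set c := chartAt (CSpace n) (p e)
  have hch : chartAt (CSpace n) e = (φ e).trans c := rfl
  have d1 : ContMDiffOn 𝓘(ℂ, CSpace n) 𝓘(ℂ, CSpace n) ω ((φ e).trans c) ((φ e).trans c).source := by
    rw [← hch]; exact contMDiffOn_chart
  have d2 : ContMDiffOn 𝓘(ℂ, CSpace n) 𝓘(ℂ, CSpace n) ω ((φ e).trans c).symm
      ((φ e).trans c).target := by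
    rw [← hch]; exact contMDiffOn_chart_symm
  have d3 : ContMDiffOn 𝓘(ℂ, CSpace n) 𝓘(ℂ, CSpace n) ω c c.source := contMDiffOn_chart
  have d4 : ContMDiffOn 𝓘(ℂ, CSpace n) 𝓘(ℂ, CSpace n) ω c.symm c.target := contMDiffOn_chart_symm
  set Ψ := ((φ e).trans c).trans c.symm
  have hs : Ψ.source ⊆ ((φ e).trans c).source := inter_subset_left
  have ht : Ψ.target ⊆ c.source := inter_subset_left
  refine ⟨⟨Ψ.toPartialEquiv, Ψ.open_source, Ψ.open_target, ?_, ?_⟩, ?_, ?_⟩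
  · exact d4.comp (d1.mono hs) fun z hz => hz.2
  · exact d2.comp (d3.mono ht) fun z hz => hz.2
  · have h1 : e ∈ ((φ e).trans c).source := by
      rw [← hch]; exact mem_chart_source _ e
    exact ⟨h1, ((φ e).trans c).map_source h1 |>.1⟩
  · intro z hz
    have h1 := hs hz
    change p z = c.symm (c ((φ e) z))
    have h2 : c.symm (c ((φ e) z)) = (φ e) z := c.left_inv h1.2
    rw [h2]
    exact congrFun (hφp e) z

theorem nonempty_universalCovering (n : ℕ) (N : Type u) [TopologicalSpace N] [ConnectedSpace N]
    [ChartedSpace (CSpace n) N] [IsManifold 𝓘(ℂ, CSpace n) ω N] :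
    Nonempty (UniversalCovering n N) := by
  have : LocallyPathConnectedSpace N := ChartedSpace.locallyPathConnectedSpace (CSpace n) N
  have : PathConnectedSpace N := pathConnectedSpace_iff_connectedSpace.2 inferInstance
  obtain ⟨E, _, p, hcov, hsurj, _⟩ := exists_universal_cover (exists_simplyConnected_nhd n (N := N))
  obtain ⟨_, _, hdiff⟩ := exists_manifold_of_isLocalHomeomorph n hcov.isLocalHomeomorph
  exact ⟨{ total := E, proj := p, isCoveringMap := hcov, surjective := hsurj,
           isLocalBiholomorphism := hdiff }⟩

end UniversalCoverManifold

/-! ### Zero sets of analytic functions do not separate balls. -/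

section ZeroSets

variable {E : Type*} [NormedAddCommGroup E] [NormedSpace ℂ E]

theorem isPreconnected_complexBall (c : E) (r : ℝ) : IsPreconnected (Metric.ball c r) := by
  let _ := NormedSpace.restrictScalars ℝ ℂ E
  exact (convex_ball c r).isPreconnected

/-- The ring of germs of analytic functions has no zero divisors. -/
theorem AnalyticAt.eventually_zero_or_of_mul {f g : E → ℂ} {p : E} (hf : AnalyticAt ℂ f p)
    (hg : AnalyticAt ℂ g p) (h : ∀ᶠ z in 𝓝 p, f z * g z = 0) :
    (∀ᶠ z in 𝓝 p, f z = 0) ∨ ∀ᶠ z in 𝓝 p, g z = 0 := by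
  by_contra! hcon
  obtain ⟨hf0, hg0⟩ := hcon
  obtain ⟨r, hr, hball⟩ := Metric.eventually_nhds_iff_ball.1
    (hf.eventually_analyticAt.and (hg.eventually_analyticAt.and h))
  have hf0' : ∃ᶠ z in 𝓝 p, f z ≠ 0 := hf0
  obtain ⟨z, hz, hzB⟩ := (hf0'.and_eventually (Metric.ball_mem_nhds p hr)).exists
  have hgz : g =ᶠ[𝓝 z] 0 := by
    filter_upwards [(hball z hzB).1.continuousAt.eventually_ne hz,
      Metric.isOpen_ball.mem_nhds hzB] with y hy hyB
    exact (mul_eq_zero.1 (hball y hyB).2.2).resolve_left hy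
  have := AnalyticOnNhd.eqOn_zero_of_preconnected_of_eventuallyEq_zero
    (fun y hy => (hball y hy).2.1) (isPreconnected_complexBall p r) hzB hgz
  apply hg0
  filter_upwards [Metric.ball_mem_nhds p hr] with y hy hne using hne (this hy)

theorem AnalyticOnNhd.countable_zeros {f : ℂ → ℂ} {T : Set ℂ} (hf : AnalyticOnNhd ℂ f T)
    (hT : IsPreconnected T) {t₀ : ℂ} (h0 : t₀ ∈ T) (hf0 : f t₀ ≠ 0) :
    {t ∈ T | f t = 0}.Countable := by
  have key : ∀ t ∈ T, ∃ N ∈ 𝓝 t, ∀ s ∈ N, f s = 0 → s = t := by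
    intro t ht
    have h1 : ∀ᶠ s in 𝓝[≠] t, f s ≠ 0 := by
      refine (hf t ht).eventually_eq_zero_or_eventually_ne_zero.resolve_left fun h => hf0 ?_
      exact hf.eqOn_zero_of_preconnected_of_eventuallyEq_zero hT ht h h0
    refine ⟨_, eventually_nhdsWithin_iff.1 h1, fun s hs hs0 => ?_⟩
    by_contra hne
    exact hs hne hs0
  choose! N hN hN' using key
  obtain ⟨C, hCT, hC, hcov⟩ := TopologicalSpace.countable_cover_nhdsWithin
    (fun t ht => mem_nhdsWithin_of_mem_nhds (hN t ht))
  refine hC.mono fun t ht => ?_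
  obtain ⟨c, hc, htc⟩ := mem_iUnion₂.1 (hcov ht.1)
  rwa [hN' c (hCT hc) t htc ht.2]

/-- In the complex line through `z` and `w` the zeros are countable. The arcs `t + i s t (1 - t)`
from 0 to 1 meet only at their ends, so all but countably many avoid the zeros; a small `s` keeps
the arc in the ball. -/
theorem joinedIn_ball_diff_zeros {h : E → ℂ} {c : E} {r : ℝ}
    (hh : AnalyticOnNhd ℂ h (Metric.ball c r)) {z w : E} (hz : z ∈ Metric.ball c r)
    (hw : w ∈ Metric.ball c r) (hz0 : h z ≠ 0) (hw0 : h w ≠ 0) :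
    JoinedIn {y ∈ Metric.ball c r | h y ≠ 0} z w := by
  let _ := NormedSpace.restrictScalars ℝ ℂ E
  set ℓ : ℂ → E := fun t => z + t • (w - z) with hℓ
  have hℓc : Continuous ℓ := by fun_prop
  set T : Set ℂ := ℓ ⁻¹' Metric.ball c r with hT
  have hTconv : Convex ℝ T := by
    intro s hs t ht a b ha hb hab
    have h1 : ℓ (a • s + b • t) = a • ℓ s + b • ℓ t := by
      have e1 : z = a • z + b • z := by rw [← add_smul, hab, one_smul]
      simp only [hℓ]
      generalize w - z = v
      rw [smul_add, smul_add, add_smul, smul_assoc, smul_assoc]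
      nth_rewrite 1 [e1]
      abel
    change ℓ (a • s + b • t) ∈ Metric.ball c r
    rw [h1]
    exact convex_ball c r hs ht ha hb hab
  have hZ : {t ∈ T | h (ℓ t) = 0}.Countable :=
    AnalyticOnNhd.countable_zeros (f := fun t => h (ℓ t))
      (fun t ht => AnalyticAt.comp_line (hh _ ht)) hTconv.isPreconnected
      (t₀ := 0) (by simpa [hT, hℓ] using hz) (by simpa [hℓ] using hz0)
  -- The parameters `s` of the arcs that pass through a zero.
  set bad : Set ℝ := (fun t : ℂ => t.im / (t.re * (1 - t.re))) '' {t ∈ T | h (ℓ t) = 0}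
  have hbad : bad.Countable := hZ.image _
  set ρ := max (dist z c) (dist w c) with hρ
  have hρr : ρ < r := max_lt hz hw
  set ε := (r - ρ) / (‖w - z‖ + 1) with hε
  have hε0 : 0 < ε := div_pos (sub_pos.2 hρr) (by positivity)
  obtain ⟨s, ⟨hs0, hsε⟩, hs⟩ : ∃ s ∈ Ioo 0 ε, s ∉ bad := by
    by_contra! hcon
    have h1 : (Ioo 0 ε).Countable := hbad.mono hcon
    exact (Cardinal.Real.Ioo_countable_iff.1 h1).not_gt hε0
  set γ : ℝ → ℂ := fun t => ⟨t, s * (t * (1 - t))⟩ with hγ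
  have hγc : Continuous γ := by
    have : γ = fun t : ℝ => (t : ℂ) + ((s * (t * (1 - t)) : ℝ) : ℂ) * Complex.I := by
      funext t
      apply Complex.ext <;> simp [hγ]
    rw [this]
    fun_prop
  have hγ0 : γ 0 = 0 := by apply Complex.ext <;> simp [hγ]
  have hγ1 : γ 1 = 1 := by apply Complex.ext <;> simp [hγ]
  refine ⟨⟨⟨fun t => ℓ (γ t), by fun_prop⟩, by simp [hγ0, hℓ], by simp [hγ1, hℓ]⟩, fun t => ?_⟩
  change ℓ (γ t) ∈ Metric.ball c r ∧ h (ℓ (γ t)) ≠ 0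
  have ht0 : (0 : ℝ) ≤ t := t.2.1
  have ht1 : (t : ℝ) ≤ 1 := t.2.2
  have hmem : ℓ (γ t) ∈ Metric.ball c r := by
    set q : E := (1 - (t : ℝ)) • z + (t : ℝ) • w with hq
    have h1 : dist q c ≤ ρ := by
      have h2 := convex_closedBall c ρ (le_max_left (dist z c) (dist w c) : z ∈ Metric.closedBall c ρ)
        (le_max_right (dist z c) (dist w c) : w ∈ Metric.closedBall c ρ)
        (sub_nonneg.2 ht1) ht0 (by ring)
      exact h2
    have h3 : ℓ (γ t) - q = ((s * (t * (1 - t)) : ℝ) * Complex.I) • (w - z) := by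
      have : γ t = ((t : ℝ) : ℂ) + ((s * (t * (1 - t)) : ℝ) : ℂ) * Complex.I := by
        apply Complex.ext <;> simp [hγ]
      simp only [hℓ, this, hq, add_smul, sub_smul, one_smul, smul_sub]
      have e1 : ∀ x : E, ((t : ℝ) : ℂ) • x = (t : ℝ) • x := fun x => rfl
      rw [e1, e1]
      abel
    have h4 : dist (ℓ (γ t)) q ≤ s * ‖w - z‖ := by
      rw [dist_eq_norm, h3, norm_smul, norm_mul, Complex.norm_I, mul_one, Complex.norm_real,
        Real.norm_eq_abs, abs_of_nonneg (by
          have := mul_nonneg ht0 (sub_nonneg.2 ht1)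
          positivity)]
      gcongr
      have : (t : ℝ) * (1 - t) ≤ 1 := by nlinarith
      nlinarith
    have h5 : s * ‖w - z‖ < r - ρ := by
      have h6 : s * (‖w - z‖ + 1) < r - ρ := (lt_div_iff₀ (by positivity)).1 hsε
      nlinarith [norm_nonneg (w - z)]
    rw [Metric.mem_ball]
    linarith [dist_triangle (ℓ (γ t)) q c]
  refine ⟨hmem, fun h0 => ?_⟩
  rcases ht0.eq_or_lt with ht | ht
  · rw [← ht, hγ0] at h0
    exact hz0 (by simpa [hℓ] using h0)
  rcases ht1.eq_or_lt with ht' | ht'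
  · rw [ht', hγ1] at h0
    exact hw0 (by simpa [hℓ] using h0)
  refine hs ⟨γ t, ⟨hmem, h0⟩, ?_⟩
  have : (t : ℝ) * (1 - t) ≠ 0 := mul_ne_zero ht.ne' (by linarith)
  simp only [hγ]
  field_simp

theorem isPreconnected_ball_diff_zeros {h : E → ℂ} {c : E} {r : ℝ}
    (hh : AnalyticOnNhd ℂ h (Metric.ball c r)) :
    IsPreconnected {y ∈ Metric.ball c r | h y ≠ 0} :=
  isPreconnected_of_forall_pair fun z hz w hw => by
    obtain ⟨γ, hγ⟩ := joinedIn_ball_diff_zeros hh hz.1 hw.1 hz.2 hw.2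
    exact ⟨range γ, range_subset_iff.2 hγ, ⟨0, γ.source⟩, ⟨1, γ.target⟩,
      isPreconnected_range γ.continuous⟩

end ZeroSets

/-! ### Connected complements from local data. -/

section HypersurfaceComplement

/-- The complement of a nowhere dense set that does not separate small open sets is
connected. -/
theorem isConnected_compl_of_local {M : Type*} [TopologicalSpace M] [ConnectedSpace M] {S : Set M}
    (hdense : Dense Sᶜ)
    (hloc : ∀ p : M, ∃ B : Set M, IsOpen B ∧ p ∈ B ∧ IsPreconnected (B \ S)) :
    IsConnected Sᶜ := by
  refine ⟨hdense.nonempty, ?_⟩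
  rw [isPreconnected_iff_subset_of_disjoint]
  intro A A' hA hA' hcov hdisj
  have hdisj' : ∀ q, q ∉ S → q ∈ A → q ∈ A' → False := fun q h1 h2 h3 => by
    have : q ∈ Sᶜ ∩ (A ∩ A') := ⟨h1, h2, h3⟩
    rw [hdisj] at this
    exact this
  -- A separation of the complement extends across `S`: the two sides are open, cover the space, and
  -- are disjoint because the complement is dense.
  let side : Set M → Set M := fun A => {p | ∃ B : Set M, IsOpen B ∧ p ∈ B ∧ B \ S ⊆ A}
  have hside : ∀ A, IsOpen (side A) := fun A => isOpen_iff_mem_nhds.2 fun p ⟨B, hB, hp, hBA⟩ =>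
    mem_of_superset (hB.mem_nhds hp) fun q hq => ⟨B, hB, hq, hBA⟩
  have hun : univ ⊆ side A ∪ side A' := by
    intro p _
    obtain ⟨B, hB, hp, hpre⟩ := hloc p
    have h1 := isPreconnected_iff_subset_of_disjoint.1 hpre A A' hA hA'
      (fun q hq => hcov hq.2) (by
        ext q
        simp only [mem_inter_iff, mem_empty_iff_false, iff_false]
        exact fun ⟨h1, h2, h3⟩ => hdisj' q h1.2 h2 h3)
    exact h1.imp (fun h => ⟨B, hB, hp, h⟩) fun h => ⟨B, hB, hp, h⟩
  have hinter : side A ∩ side A' = ∅ := by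
    ext p
    simp only [mem_inter_iff, mem_empty_iff_false, iff_false]
    rintro ⟨⟨B, hB, hp, hBA⟩, B', hB', hp', hBA'⟩
    obtain ⟨q, hq, hqS⟩ := hdense.inter_open_nonempty (B ∩ B') (hB.inter hB') ⟨p, hp, hp'⟩
    exact hdisj' q hqS (hBA ⟨hq.1, hqS⟩) (hBA' ⟨hq.2, hqS⟩)
  rcases isPreconnected_iff_subset_of_disjoint.1 isPreconnected_univ (side A) (side A') (hside A)
    (hside A') hun (by rw [univ_inter, hinter]) with h | h
  · left
    intro q hq
    obtain ⟨B, hB, hqB, hBA⟩ := h (mem_univ q)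
    exact hBA ⟨hqB, hq⟩
  · right
    intro q hq
    obtain ⟨B, hB, hqB, hBA⟩ := h (mem_univ q)
    exact hBA ⟨hqB, hq⟩

end HypersurfaceComplement

/-! ### Transfer of the local theory to manifolds. -/

section HolomorphicGerms

variable {n : ℕ} {M : Type u} [TopologicalSpace M] [ChartedSpace (CSpace n) M]

theorem eventually_chart_symm_iff {P : M → Prop} (q : M) :
    (∀ᶠ z in 𝓝 (chartAt (CSpace n) q q), P ((chartAt (CSpace n) q).symm z)) ↔ ∀ᶠ y in 𝓝 q, P y :=
  (chartAt (CSpace n) q).eventually_nhds' P (mem_chart_source _ q)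

theorem holomorphicAt_const (c : ℂ) (q : M) : HolomorphicAt n (fun _ : M => c) q :=
  contMDiffAt_const

theorem HolomorphicAt.congr {g h : M → ℂ} {q : M} (hg : HolomorphicAt n g q)
    (he : ∀ᶠ y in 𝓝 q, h y = g y) : HolomorphicAt n h q :=
  ContMDiffAt.congr_of_eventuallyEq hg he

/-- The complement of an analytic hypersurface is dense. -/
theorem IsAnalyticHypersurface.dense_compl {S : Set M} (hS : IsAnalyticHypersurface n S) :
    Dense Sᶜ := by
  intro p
  obtain ⟨h, -, h0, hloc⟩ := hS.local_equation p
  rw [mem_closure_iff_frequently]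
  have h0' : ∃ᶠ y in 𝓝 p, h y ≠ 0 := not_eventually.1 h0
  exact (h0'.and_eventually hloc).mono fun y hy hyS => hy.1 (hy.2.1 hyS)

variable [IsManifold 𝓘(ℂ, CSpace n) ω M]

theorem holomorphicAt_iff_analyticAt {h : M → ℂ} {p q : M}
    (hq : q ∈ (chartAt (CSpace n) p).source) :
    HolomorphicAt n h q ↔
      AnalyticAt ℂ (h ∘ (chartAt (CSpace n) p).symm) (chartAt (CSpace n) p q) := by
  unfold HolomorphicAt
  rw [contMDiffAt_iff_source_of_mem_source hq]
  simp only [mfld_simps]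
  rw [contMDiffWithinAt_univ, contMDiffAt_iff_contDiffAt, ← contDiffWithinAt_univ,
    contDiffWithinAt_omega_iff_analyticWithinAt, analyticWithinAt_univ]

theorem holomorphicAt_iff_analyticAt_self {h : M → ℂ} {q : M} : HolomorphicAt n h q ↔
    AnalyticAt ℂ (h ∘ (chartAt (CSpace n) q).symm) (chartAt (CSpace n) q q) :=
  holomorphicAt_iff_analyticAt (mem_chart_source _ q)

theorem HolomorphicAt.mul {g h : M → ℂ} {q : M} (hg : HolomorphicAt n g q)
    (hh : HolomorphicAt n h q) : HolomorphicAt n (fun y => g y * h y) q := by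
  rw [holomorphicAt_iff_analyticAt_self] at *
  exact AnalyticAt.mul hg hh

theorem HolomorphicAt.sub {g h : M → ℂ} {q : M} (hg : HolomorphicAt n g q)
    (hh : HolomorphicAt n h q) : HolomorphicAt n (fun y => g y - h y) q := by
  rw [holomorphicAt_iff_analyticAt_self] at *
  exact AnalyticAt.sub hg hh

theorem HolomorphicAt.div {g h : M → ℂ} {q : M} (hg : HolomorphicAt n g q)
    (hh : HolomorphicAt n h q) (h0 : h q ≠ 0) : HolomorphicAt n (fun y => g y / h y) q := by
  rw [holomorphicAt_iff_analyticAt_self] at *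
  exact AnalyticAt.div hg hh (by simpa using h0)

theorem HolomorphicAt.eventually {h : M → ℂ} {q : M} (hh : HolomorphicAt n h q) :
    ∀ᶠ y in 𝓝 q, HolomorphicAt n h y := by
  have h1 := (holomorphicAt_iff_analyticAt_self.1 hh).eventually_analyticAt
  have hc : ContinuousAt (chartAt (CSpace n) q) q :=
    (chartAt (CSpace n) q).continuousAt (mem_chart_source _ q)
  filter_upwards [hc.eventually h1,
    (chartAt (CSpace n) q).open_source.mem_nhds (mem_chart_source _ q)] with y hy hys
  exact (holomorphicAt_iff_analyticAt hys).2 hy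

theorem HolomorphicAt.eventually_zero_or_of_mul {g h : M → ℂ} {q : M} (hg : HolomorphicAt n g q)
    (hh : HolomorphicAt n h q) (h0 : ∀ᶠ y in 𝓝 q, g y * h y = 0) :
    (∀ᶠ y in 𝓝 q, g y = 0) ∨ ∀ᶠ y in 𝓝 q, h y = 0 := by
  rw [← eventually_chart_symm_iff (n := n)] at h0
  rw [← eventually_chart_symm_iff (n := n) (P := fun y => g y = 0),
    ← eventually_chart_symm_iff (n := n) (P := fun y => h y = 0)]
  exact (holomorphicAt_iff_analyticAt_self.1 hg).eventually_zero_or_of_mul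
    (holomorphicAt_iff_analyticAt_self.1 hh) h0

theorem HolomorphicAt.exists_reduced_fraction {num den : M → ℂ} {p : M}
    (hnum : HolomorphicAt n num p) (hden : HolomorphicAt n den p)
    (hden0 : ¬ ∀ᶠ y in 𝓝 p, den y = 0) :
    ∃ a b : M → ℂ, HolomorphicAt n a p ∧ HolomorphicAt n b p ∧ (¬ ∀ᶠ y in 𝓝 p, b y = 0) ∧
      (∀ᶠ y in 𝓝 p, num y * b y = den y * a y) ∧
      ∀ᶠ q in 𝓝 p, ∀ g : M → ℂ, HolomorphicAt n g q → (∀ᶠ y in 𝓝 q, num y = g y * den y) →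
        b q ≠ 0 := by
  set c := chartAt (CSpace n) p with hc
  have hp : p ∈ c.source := mem_chart_source _ p
  rw [← eventually_chart_symm_iff (n := n)] at hden0
  obtain ⟨a, b, ha, hb, hb0, hab, hgerm⟩ := AnalyticAt.exists_reduced_fraction
    (holomorphicAt_iff_analyticAt_self.1 hnum) (holomorphicAt_iff_analyticAt_self.1 hden) hden0
  have hcc : ContinuousAt c p := c.continuousAt hp
  have key : ∀ a : CSpace n → ℂ, AnalyticAt ℂ a (c p) → HolomorphicAt n (a ∘ c) p := by
    intro a ha
    refine holomorphicAt_iff_analyticAt_self.2 (ha.congr ?_)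
    filter_upwards [c.open_target.mem_nhds (c.map_source hp)] with z hz
    simp only [Function.comp_apply]
    rw [← hc, c.right_inv hz]
  have hleft : ∀ᶠ y in 𝓝 p, c.symm (c y) = y := by
    filter_upwards [c.open_source.mem_nhds hp] with y hy using c.left_inv hy
  refine ⟨a ∘ c, b ∘ c, key a ha, key b hb, fun h => hb0 ?_, ?_, ?_⟩
  · rw [← eventually_chart_symm_iff (n := n)] at h
    filter_upwards [h, c.open_target.mem_nhds (c.map_source hp)] with z hz hzt
    simp only [Function.comp_apply] at hz
    rwa [← hc, c.right_inv hzt] at hz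
  · filter_upwards [hcc.eventually hab, hleft] with y hy hy'
    simp only [Function.comp_apply] at hy ⊢
    rwa [hy'] at hy
  · filter_upwards [hcc.eventually hgerm, c.open_source.mem_nhds hp] with q hq hqs g hg hgq
    refine hq (g ∘ c.symm) ((holomorphicAt_iff_analyticAt hqs).1 hg) ?_
    exact (c.eventually_nhds' (fun y => num y = g y * den y) hqs).2 hgq

/-- An analytic hypersurface does not separate a connected manifold. -/
theorem IsAnalyticHypersurface.isConnected_compl [ConnectedSpace M] {S : Set M}
    (hS : IsAnalyticHypersurface n S) : IsConnected Sᶜ := by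
  refine isConnected_compl_of_local hS.dense_compl fun p => ?_
  obtain ⟨h, hh, h0, hloc⟩ := hS.local_equation p
  set c := chartAt (CSpace n) p with hc
  have hp : p ∈ c.source := mem_chart_source _ p
  have h1 := (holomorphicAt_iff_analyticAt_self.1 hh).eventually_analyticAt
  obtain ⟨r, hr, hball⟩ := Metric.eventually_nhds_iff_ball.1
    ((h1.and ((eventually_chart_symm_iff p).2 hloc)).and
      (c.open_target.mem_nhds (c.map_source hp)))
  have hsub : Metric.ball (c p) r ⊆ c.target := fun z hz => (hball z hz).2
  refine ⟨c.symm '' Metric.ball (c p) r,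
    c.symm.isOpen_image_of_subset_source Metric.isOpen_ball hsub,
    ⟨c p, Metric.mem_ball_self hr, c.left_inv hp⟩, ?_⟩
  have h2 := isPreconnected_ball_diff_zeros (h := h ∘ c.symm) (c := c p) (r := r)
    fun z hz => (hball z hz).1.1
  have h3 : c.symm '' Metric.ball (c p) r \ S =
      c.symm '' {y ∈ Metric.ball (c p) r | (h ∘ c.symm) y ≠ 0} := by
    ext q
    constructor
    · rintro ⟨⟨z, hz, rfl⟩, hq⟩
      exact ⟨z, ⟨hz, fun h0 => hq ((hball z hz).1.2.2 h0)⟩, rfl⟩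
    · rintro ⟨z, ⟨hz, hz0⟩, rfl⟩
      exact ⟨⟨z, hz, rfl⟩, fun hq => hz0 ((hball z hz).1.2.1 hq)⟩
  rw [h3]
  exact h2.image _ (c.continuousOn_symm.mono fun z hz => hsub hz.1)

end HolomorphicGerms

/-! ### The exceptional hypersurface of a meromorphic function. -/

section MeromorphicFunctions

variable {n : ℕ} {M : Type u} [TopologicalSpace M] [ChartedSpace (CSpace n) M]
  [IsManifold 𝓘(ℂ, CSpace n) ω M]

namespace MeromorphicFunction

/-- The meromorphic function is the holomorphic germ `g` near `q`. -/
def HasGerm (f : MeromorphicFunction n M) (g : M → ℂ) (q : M) : Prop :=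
  HolomorphicAt n g q ∧ ∀ᶠ y in 𝓝 q, f.num q y = g y * f.den q y

variable (f : MeromorphicFunction n M)

/-- Being the germ `g` does not depend on the local quotient: the difference is killed by a nonzero
denominator, and germs form an integral domain. -/
theorem eventually_transfer {g : M → ℂ} {p p' q : M} (hp : q ∈ f.dom p) (hp' : q ∈ f.dom p')
    (hg : HolomorphicAt n g q) (h : ∀ᶠ y in 𝓝 q, f.num p y = g y * f.den p y) :
    ∀ᶠ y in 𝓝 q, f.num p' y = g y * f.den p' y := by
  have h1 : ∀ᶠ y in 𝓝 q, (f.num p' y - g y * f.den p' y) * f.den p y = 0 := by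
    filter_upwards [h, (f.isOpen_dom p).mem_nhds hp, (f.isOpen_dom p').mem_nhds hp'] with y h1 h2 h3
    have := f.compatible p p' y ⟨h2, h3⟩
    rw [h1] at this
    linear_combination -this
  have h2 := HolomorphicAt.eventually_zero_or_of_mul
    ((f.num_holomorphic p' q hp').sub (hg.mul (f.den_holomorphic p' q hp')))
    (f.den_holomorphic p q hp) h1
  exact (h2.resolve_right (f.den_ne_zero p q hp)).mono fun y hy => sub_eq_zero.1 hy

variable {f}

theorem HasGerm.eventually {g : M → ℂ} {q : M} (h : f.HasGerm g q) :
    ∀ᶠ y in 𝓝 q, f.HasGerm g y := by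
  filter_upwards [h.1.eventually, h.2.eventually_nhds, (f.isOpen_dom q).mem_nhds (f.mem_dom q)]
    with y h1 h2 h3
  exact ⟨h1, f.eventually_transfer h3 (f.mem_dom y) h1 h2⟩

theorem HasGerm.eventually_eq {g g' : M → ℂ} {q : M} (h : f.HasGerm g q) (h' : f.HasGerm g' q) :
    ∀ᶠ y in 𝓝 q, g y = g' y := by
  have h1 : ∀ᶠ y in 𝓝 q, (g y - g' y) * f.den q y = 0 := by
    filter_upwards [h.2, h'.2] with y h1 h2
    linear_combination h2 - h1
  have h2 := (h.1.sub h'.1).eventually_zero_or_of_mul (f.den_holomorphic q q (f.mem_dom q)) h1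
  exact (h2.resolve_right (f.den_ne_zero q q (f.mem_dom q))).mono fun y hy => sub_eq_zero.1 hy

/-- The identity theorem: a meromorphic function that is constant near a point is constant. -/
theorem isConstant_of_hasGerm [ConnectedSpace M] {c : ℂ} {q : M}
    (h : f.HasGerm (fun _ => c) q) : f.IsConstant := by
  set W : Set M := {q | f.HasGerm (fun _ => c) q} with hW
  have hopen : IsOpen W := isOpen_iff_mem_nhds.2 fun y hy => HasGerm.eventually hy
  have hclosed : IsClosed W := by
    refine isClosed_of_closure_subset fun y hy => ⟨holomorphicAt_const c y, ?_⟩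
    set ch := chartAt (CSpace n) y with hch
    have hys : y ∈ ch.source := mem_chart_source _ y
    have hD : HolomorphicAt n (fun x => f.num y x - c * f.den y x) y :=
      (f.num_holomorphic y y (f.mem_dom y)).sub
        ((holomorphicAt_const c y).mul (f.den_holomorphic y y (f.mem_dom y)))
    obtain ⟨r, hr, hball⟩ := Metric.eventually_nhds_iff_ball.1
      (((holomorphicAt_iff_analyticAt_self.1 hD).eventually_analyticAt.and
        ((eventually_chart_symm_iff y).2 ((f.isOpen_dom y).mem_nhds (f.mem_dom y)))).and
        (ch.open_target.mem_nhds (ch.map_source hys)))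
    have hsub : Metric.ball (ch y) r ⊆ ch.target := fun z hz => (hball z hz).2
    have hopenB := ch.symm.isOpen_image_of_subset_source Metric.isOpen_ball hsub
    obtain ⟨x, ⟨z, hz, rfl⟩, hx⟩ := mem_closure_iff.1 hy _ hopenB
      ⟨ch y, Metric.mem_ball_self hr, ch.left_inv hys⟩
    have h1 := f.eventually_transfer (f.mem_dom _) (hball z hz).1.2 hx.1 hx.2
    have h2 : (fun x => f.num y x - c * f.den y x) ∘ ch.symm =ᶠ[𝓝 z] 0 := by
      filter_upwards [(ch.continuousAt_symm (hsub hz)).eventually h1] with w hw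
      simp only [Function.comp_apply, hw, sub_self, Pi.zero_apply]
    have h3 := AnalyticOnNhd.eqOn_zero_of_preconnected_of_eventuallyEq_zero
      (fun w hw => (hball w hw).1.1) (isPreconnected_complexBall (ch y) r) hz h2
    rw [← eventually_chart_symm_iff (n := n)]
    filter_upwards [Metric.ball_mem_nhds (ch y) hr] with w hw
    exact sub_eq_zero.1 (h3 hw)
  have huniv : W = univ := IsClopen.eq_univ ⟨hclosed, hopen⟩ ⟨q, h⟩
  refine ⟨c, fun p y hy => ?_⟩
  have hy' : y ∈ W := huniv ▸ mem_univ y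
  exact (f.eventually_transfer (f.mem_dom y) hy hy'.1 hy'.2).self_of_nhds

variable (f)

/-- The set of the points where the function is not holomorphic, or takes one of the values
`0` and `1`. -/
def exceptionalSet : Set M := {q | ¬ ∃ g : M → ℂ, f.HasGerm g q ∧ g q ≠ 0 ∧ g q ≠ 1}

theorem isAnalyticHypersurface_exceptionalSet [ConnectedSpace M] (hf : ¬ f.IsConstant) :
    IsAnalyticHypersurface n f.exceptionalSet where
  isClosed := by
    rw [← isOpen_compl_iff, isOpen_iff_mem_nhds]
    intro q hq
    obtain ⟨g, hg, h0, h1⟩ := not_not.1 hq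
    filter_upwards [hg.eventually, hg.1.continuousAt.eventually_ne h0,
      hg.1.continuousAt.eventually_ne h1] with y a b c
    exact not_not.2 ⟨g, a, b, c⟩
  local_equation p := by
    have hnum := f.num_holomorphic p p (f.mem_dom p)
    have hden := f.den_holomorphic p p (f.mem_dom p)
    have hd0 := f.den_ne_zero p p (f.mem_dom p)
    obtain ⟨a, b, ha, hb, hb0, hab, hgerm⟩ := hnum.exists_reduced_fraction hden hd0
    have hnc : ∀ c : ℂ, ¬ ∀ᶠ y in 𝓝 p, a y = c * b y := by
      intro c hc
      refine hf (isConstant_of_hasGerm (c := c) (q := p) ⟨holomorphicAt_const c p, ?_⟩)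
      have h1 : ∀ᶠ y in 𝓝 p, (f.num p y - c * f.den p y) * b y = 0 := by
        filter_upwards [hc, hab] with y h1 h2
        rw [h1] at h2
        linear_combination h2
      have h2 := (hnum.sub ((holomorphicAt_const c p).mul hden)).eventually_zero_or_of_mul hb h1
      exact (h2.resolve_right hb0).mono fun y hy => sub_eq_zero.1 hy
    -- With `a / b` reduced, the factors account for the value 0, the points without a holomorphic
    -- germ, and the value 1. Reducedness ensures that `b` adds no further points.
    refine ⟨fun y => a y * b y * (a y - b y), (ha.mul hb).mul (ha.sub hb), fun h => ?_, ?_⟩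
    · rcases (ha.mul hb).eventually_zero_or_of_mul (ha.sub hb) h with h | h
      · rcases ha.eventually_zero_or_of_mul hb h with h | h
        · exact hnc 0 (by simpa using h)
        · exact hb0 h
      · exact hnc 1 (h.mono fun y hy => by rw [one_mul]; exact sub_eq_zero.1 hy)
    · filter_upwards [ha.eventually, hb.eventually, hab.eventually_nhds, hgerm,
        (f.isOpen_dom p).mem_nhds (f.mem_dom p)] with q haq hbq habq hgq hq
      have key : q ∉ f.exceptionalSet ↔ a q * b q * (a q - b q) ≠ 0 := by
        constructor
        · intro hqS
          obtain ⟨g, hg, h0, h1⟩ := not_not.1 hqS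
          have hg' := f.eventually_transfer (f.mem_dom q) hq hg.1 hg.2
          have hb' := hgq g hg.1 hg'
          have h2 : ∀ᶠ y in 𝓝 q, (g y * b y - a y) * f.den p y = 0 := by
            filter_upwards [habq, hg'] with y h1 h2
            rw [h2] at h1
            linear_combination h1
          have h3 := ((hg.1.mul hbq).sub haq).eventually_zero_or_of_mul
            (f.den_holomorphic p q hq) h2
          have h4 : g q * b q - a q = 0 := (h3.resolve_right (f.den_ne_zero p q hq)).self_of_nhds
          have h5 : a q = g q * b q := (sub_eq_zero.1 h4).symm
          have h6 : g q * b q - b q = (g q - 1) * b q := by ring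
          rw [h5, h6]
          exact mul_ne_zero (mul_ne_zero (mul_ne_zero h0 hb') hb')
            (mul_ne_zero (sub_ne_zero.2 h1) hb')
        · intro h
          have h2 := right_ne_zero_of_mul h
          have h3 := left_ne_zero_of_mul (left_ne_zero_of_mul h)
          have h4 := right_ne_zero_of_mul (left_ne_zero_of_mul h)
          refine not_not.2 ⟨fun y => a y / b y, ⟨haq.div hbq h4, ?_⟩, div_ne_zero h3 h4, ?_⟩
          · refine f.eventually_transfer hq (f.mem_dom q) (haq.div hbq h4) ?_
            filter_upwards [habq, hbq.continuousAt.eventually_ne h4] with y h1 h2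
            rw [div_mul_eq_mul_div, eq_div_iff h2, h1, mul_comm]
          · rw [Ne, div_eq_one_iff_eq h4]
            exact sub_ne_zero.1 h2
      rw [← not_iff_not]
      exact key

/-- The value of the function outside of the exceptional set. -/
theorem exists_value : ∃ F : M → ℂ, ∀ q ∉ f.exceptionalSet,
    f.HasGerm F q ∧ F q ≠ 0 ∧ F q ≠ 1 := by
  classical
  choose! G hG using fun (q : M) (hq : q ∉ f.exceptionalSet) => not_not.1 hq
  refine ⟨fun q => G q q, fun q hq => ?_⟩
  have h1 : ∀ᶠ y in 𝓝 q, G y y = G q y := by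
    filter_upwards [(hG q hq).1.eventually,
      (hG q hq).1.1.continuousAt.eventually_ne (hG q hq).2.1,
      (hG q hq).1.1.continuousAt.eventually_ne (hG q hq).2.2] with y a b c
    have hy : y ∉ f.exceptionalSet := not_not.2 ⟨G q, a, b, c⟩
    exact ((hG y hy).1.eventually_eq a).self_of_nhds
  refine ⟨⟨(hG q hq).1.1.congr h1, ?_⟩, (hG q hq).2⟩
  filter_upwards [(hG q hq).1.2, h1] with y h2 h3
  rw [h2, h3]

end MeromorphicFunction

end MeromorphicFunctions

/-! ### Coordinate spaces as test spaces, and Picard's little theorem. -/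

section ComplexLine

theorem holomorphicAt_model_iff {m : ℕ} {h : CSpace m → ℂ} {z : CSpace m} :
    HolomorphicAt m h z ↔ AnalyticAt ℂ h z := by
  unfold HolomorphicAt
  rw [contMDiffAt_iff_contDiffAt, ← contDiffWithinAt_univ,
    contDiffWithinAt_omega_iff_analyticWithinAt, analyticWithinAt_univ]

theorem AnalyticAt.contMDiffAt_complex {ψ : ℂ → ℂ} {w : ℂ} (h : AnalyticAt ℂ ψ w) :
    ContMDiffAt 𝓘(ℂ, ℂ) 𝓘(ℂ, ℂ) ω ψ w := by
  rw [contMDiffAt_iff_contDiffAt]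
  exact h.contDiffAt

theorem isClosed_of_isAnalyticSubset {m : ℕ} {A : Set (CSpace m)}
    (hA : (manifoldComplexSpace m (CSpace m)).IsAnalyticSubset A) : IsClosed A := by
  refine isClosed_of_closure_subset fun x hx => ?_
  obtain ⟨k, F, hF, hAF⟩ := hA x
  refine hAF.self_of_nhds.2 fun i => ?_
  by_contra hne
  have hc : ContinuousAt (F i) x := ContMDiffAt.continuousAt (hF i)
  rw [mem_closure_iff_frequently] at hx
  obtain ⟨y, hy, hy', hy''⟩ := (hx.and_eventually (hAF.and (hc.eventually_ne hne))).exists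
  exact hy'' (hy'.1 hy i)

/-- By the identity theorem on balls the interior is also closed. -/
theorem interior_eq_empty_of_isAnalyticSubset {m : ℕ} {A : Set (CSpace m)}
    (hA : (manifoldComplexSpace m (CSpace m)).IsAnalyticSubset A) (hne : A ≠ univ) :
    interior A = ∅ := by
  have hclosed : IsClosed (interior A) := by
    refine isClosed_of_closure_subset fun x hx => ?_
    obtain ⟨k, F, hF, hAF⟩ := hA x
    have hFa : ∀ᶠ y in 𝓝 x, ∀ i, AnalyticAt ℂ (F i) y :=
      eventually_all.2 fun i => (holomorphicAt_model_iff.1 (hF i)).eventually_analyticAt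
    obtain ⟨r, hr, hball⟩ := Metric.eventually_nhds_iff_ball.1 (hFa.and hAF)
    obtain ⟨y, hyB, hy⟩ := mem_closure_iff.1 hx _ Metric.isOpen_ball (Metric.mem_ball_self hr)
    refine mem_interior.2 ⟨Metric.ball x r, fun z hz => ?_, Metric.isOpen_ball,
      Metric.mem_ball_self hr⟩
    refine (hball z hz).2.2 fun i => ?_
    have h0 : F i =ᶠ[𝓝 y] 0 := by
      filter_upwards [isOpen_interior.mem_nhds hy, Metric.isOpen_ball.mem_nhds hyB] with w hw hwB
      exact (hball w hwB).2.1 (interior_subset hw) i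
    exact AnalyticOnNhd.eqOn_zero_of_preconnected_of_eventuallyEq_zero
      (fun w hw => (hball w hw).1 i) (isPreconnected_complexBall x r) hyB h0 hz
  have : PreconnectedSpace (CSpace m) := by
    let _ := NormedSpace.restrictScalars ℝ ℂ (CSpace m)
    infer_instance
  rcases isClopen_iff.1 ⟨hclosed, isOpen_interior⟩ with h | h
  · exact h
  · exact absurd (univ_subset_iff.1 (h ▸ interior_subset)) hne

theorem isIrreducible_model (m : ℕ) : (manifoldComplexSpace m (CSpace m)).IsIrreducible := by
  refine ⟨inferInstance, fun A B hA hB hAB => ?_⟩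
  by_contra! hcon
  have h1 : Dense Aᶜ := interior_eq_empty_iff_dense_compl.1
    (interior_eq_empty_of_isAnalyticSubset hA hcon.1)
  obtain ⟨x, hxB, hxA⟩ := h1.inter_open_nonempty Bᶜ (isClosed_of_isAnalyticSubset hB).isOpen_compl
    (nonempty_compl.2 hcon.2)
  have : x ∈ A ∪ B := hAB ▸ mem_univ x
  exact this.elim hxA hxB

/-- The little Picard theorem for functions on a coordinate space. -/
theorem eq_of_omit_zero_one {m : ℕ} {H : CSpace m → ℂ} (hH : ∀ z, AnalyticAt ℂ H z)
    (h0 : ∀ z, H z ≠ 0) (h1 : ∀ z, H z ≠ 1) (z w : CSpace m) : H z = H w := by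
  let _ := NormedSpace.restrictScalars ℝ ℂ (CSpace m)
  have : ContractibleSpace (CSpace m) := RealTopologicalVectorSpace.contractibleSpace
  have : LocallyPathConnectedSpace (CSpace m) := inferInstance
  obtain ⟨φ, hφ, hψ, hconst⟩ := exists_disc_lift
    (continuous_iff_continuousAt.2 fun z => (hH z).continuousAt) h0 h1
  have hdiff : Differentiable ℂ φ := fun x => by
    obtain ⟨ψ, hψa, he⟩ := hψ x
    exact ((AnalyticAt.fun_comp hψa (hH x)).congr (he.mono fun y hy => hy.symm)).differentiableAt
  refine hconst (fun x y => hdiff.apply_eq_apply_of_bounded ?_ x y) z w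
  refine (Metric.isBounded_closedBall (x := (0 : ℂ)) (r := 1)).subset
    (range_subset_iff.2 fun x => ?_)
  simpa using hφ x

end ComplexLine

/-! ### The theorem. -/

theorem proposition7p1 (n : ℕ) (M : Type u) [TopologicalSpace M] [T2Space M] [ConnectedSpace M]
    [ChartedSpace (CSpace n) M] [IsManifold 𝓘(ℂ, CSpace n) ω M]
    (hM : ∃ f : MeromorphicFunction n M, ¬ f.IsConstant) :
    ∃ (S : Set M) (hS : IsAnalyticHypersurface n S),
      (Nonempty (UniversalCovering n hS.complement) ∧
        ∀ X : UniversalCovering n hS.complement, HasNonconstantBoundedHolomorphic n X.total) ∧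
      ¬ (manifoldComplexSpace n hS.complement).IsUniversallyDominated := by
  obtain ⟨f, hf⟩ := hM
  have hS := f.isAnalyticHypersurface_exceptionalSet hf
  obtain ⟨F, hF⟩ := f.exists_value
  have : ConnectedSpace hS.complement := Subtype.connectedSpace hS.isConnected_compl
  set G : hS.complement → ℂ := fun x => F x.1 with hG
  have hGhol : ∀ x, HolomorphicAt n G x := fun x =>
    contMDiffAt_subtype_iff.2 (hF x.1 x.2).1.1
  have hGc : Continuous G := continuous_iff_continuousAt.2 fun x => (hGhol x).continuousAt
  have hG0 : ∀ x, G x ≠ 0 := fun x => (hF x.1 x.2).2.1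
  have hG1 : ∀ x, G x ≠ 1 := fun x => (hF x.1 x.2).2.2
  -- A constant `G` would make `f` constant near a point off the hypersurface, hence everywhere.
  have hGne : ¬ ∀ x y, G x = G y := fun h => by
    obtain ⟨x⟩ : Nonempty hS.complement := inferInstance
    refine hf (MeromorphicFunction.isConstant_of_hasGerm (c := G x) (q := x.1)
      ⟨holomorphicAt_const _ _, ?_⟩)
    filter_upwards [(hF x.1 x.2).1.2, hS.complement.isOpen.mem_nhds x.2] with y hy hyS
    have : F y = G x := h ⟨y, hyS⟩ x
    rw [hy, this]
  refine ⟨f.exceptionalSet, hS, ⟨nonempty_universalCovering n _, fun X => ?_⟩, fun hdom => ?_⟩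
  · have : LocallyPathConnectedSpace X.total :=
      ChartedSpace.locallyPathConnectedSpace (CSpace n) X.total
    obtain ⟨φ, hφ, hψ, hconst⟩ := exists_disc_lift (F := G ∘ X.proj)
      (hGc.comp X.isCoveringMap.continuous) (fun x => hG0 _) (fun x => hG1 _)
    refine ⟨φ, fun p => ?_, (Metric.isBounded_closedBall (x := (0 : ℂ)) (r := 1)).subset
      (range_subset_iff.2 fun x => ?_), ?_⟩
    · obtain ⟨ψ, hψa, he⟩ := hψ p
      have h1 : ContMDiffAt 𝓘(ℂ, CSpace n) 𝓘(ℂ, ℂ) ω (G ∘ X.proj) p :=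
        ContMDiffAt.comp p (hGhol (X.proj p)) X.isLocalBiholomorphism.contMDiff.contMDiffAt
      exact (ContMDiffAt.comp (g := ψ) p hψa.contMDiffAt_complex h1).congr_of_eventuallyEq he
    · simpa using hφ x
    · by_contra! hcon
      refine hGne fun x y => ?_
      obtain ⟨x', rfl⟩ := X.surjective x
      obtain ⟨y', rfl⟩ := X.surjective y
      exact hconst hcon x' y'
  -- The test space is the complex line: `G ∘ D` is entire and omits 0 and 1, hence constant, and
  -- density of the image of `D` makes `G` constant.
  · obtain ⟨D, ⟨hDc, hD⟩, hdense⟩ := hdom (CSpace 1) (manifoldComplexSpace 1 (CSpace 1))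
      (isIrreducible_model 1) ⟨fun z => z 0, fun z => holomorphicAt_model_iff.2
        ((EuclideanSpace.proj (𝕜 := ℂ) (0 : Fin 1)).analyticAt z),
        0, EuclideanSpace.single 0 1, by simp⟩
    have hconst := eq_of_omit_zero_one (H := G ∘ D)
      (fun z => holomorphicAt_model_iff.1 (hD z G (hGhol (D z)))) (fun z => hG0 _) (fun z => hG1 _)
    have h1 : G = fun _ => G (D 0) := by
      refine hdense.equalizer hGc continuous_const ?_
      funext z
      exact hconst z 0
    exact hGne fun x y => by rw [h1]
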